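/- Let $G$ be a Lie group acting smoothly and properly on a connected smooth manifold $M$ (without boundary, finite dimensional, Hausdorff, second countable), let $\pi : M \to M/G$ be the orbit map, and give $M/G$ the quotient topology and the algebra $C^\infty(M/G)$ of those functions $f : M/G \to \mathbb{R}$ for which $f\circ\pi$ is smooth on $M$. For a subset $T\subseteq M/G$ let $C^\infty(T)$ be the algebra of functions on $T$ that are locally restrictions of functions in $C^\infty(M/G)$. A smooth vector field on $M/G$ is a derivation $Y$ of $C^\infty(M/G)$ that generates a local one-parameter group of local diffeomorphisms: every point of $M/G$ has an open neighbourhood $U$ and an $\varepsilon>0$ such that for all $|t|<\varepsilon$ the flow $\varphi_t$ of $Y$ is defined on $U$ (so that $\frac{d}{dt} f(\varphi_t(y)) = (Yf)(\varphi_t(y))$ and $\varphi_0(y)=y$ for $y \in U$, $f\in C^\infty(M/G)$) and is a diffeomorphism of $U$ onto an open subset of $M/G$, i.e. a bijection that, together with its inverse, pulls back smooth functions to smooth functions. **Theorem 1.** Let $H$ be a compact subgroup of $G$, let $M_{(H)}=\{m\in M : G_m \text{ is conjugate to } H\}$ be the corresponding orbit type, where $G_m$ is the isotropy group of $m$, and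 let $C$ be a connected component of $M_{(H)}$. Let $Y$ be a smooth vector field on $M/G$. Then $C$ is an embedded smooth submanifold of $M$; $Y$ restricts to a derivation $Y_{|\pi(C)}$ of $C^\infty(\pi(C))$, that is, $Y_{|\pi(C)}(f_{|\pi(C)}) = (Yf)_{|\pi(C)}$ for all $f\in C^\infty(M/G)$; and there is a smooth $G$-invariant vector field $X$ on $C$ that is $\pi_{|C}$-related to $Y_{|\pi(C)}$, that is, $X(h\circ\pi_{|C}) = (Y_{|\pi(C)}h)\circ\pi_{|C}$ for all $h\in C^\infty(\pi(C))$. Here $G$-invariance means $T_m\Phi_g\,X(m)=X(g\cdot m)$ for all $g\in G$, $m\in C$, where $\Phi_g(m)=g\cdot m$; when $G$ is not connected and $C$ is not itself $G$-invariant, this says that $X$ extends to a $G$-invariant vector field on $G\cdot C$. -/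

import Mathlib

open scoped Manifold ContDiff Topology

noncomputable section

/-! ### Differential subspaces and vector fields on a differential space

A differential structure on a space `S` is given by an algebra `A` of real functions on `S`,
the smooth functions. -/

/-- The differential structure induced on a subset `T` of a space `S` with differential structure
`A`: the functions on `T` that locally are restrictions of functions in `A`. -/
def restrictedFunctions {S : Type*} [TopologicalSpace S] (A : Subalgebra ℝ (S → ℝ)) (T : Set S) :
    Subalgebra ℝ (T → ℝ) where
  carrier := {h | ∀ x : T, ∃ U : Set S, IsOpen U ∧ (x : S) ∈ U ∧
    ∃ f ∈ A, ∀ y : T, (y : S) ∈ U → h y = f y}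
  mul_mem' := by
    intro h k hh hk x
    obtain ⟨U, hU, hxU, f, hf, hfU⟩ := hh x
    obtain ⟨V, hV, hxV, g, hg, hgV⟩ := hk x
    exact ⟨U ∩ V, hU.inter hV, ⟨hxU, hxV⟩, f * g, A.mul_mem hf hg, fun y hy => by
      simp [hfU y hy.1, hgV y hy.2]⟩
  add_mem' := by
    intro h k hh hk x
    obtain ⟨U, hU, hxU, f, hf, hfU⟩ := hh x
    obtain ⟨V, hV, hxV, g, hg, hgV⟩ := hk x
    exact ⟨U ∩ V, hU.inter hV, ⟨hxU, hxV⟩, f + g, A.add_mem hf hg, fun y hy => by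
      simp [hfU y hy.1, hgV y hy.2]⟩
  algebraMap_mem' := fun r x =>
    ⟨Set.univ, isOpen_univ, Set.mem_univ _, algebraMap ℝ (S → ℝ) r, A.algebraMap_mem r,
      fun _ _ => rfl⟩

/-- The restriction of a smooth function to a subset. -/
def restrictFunction {S : Type*} [TopologicalSpace S] (A : Subalgebra ℝ (S → ℝ)) (T : Set S)
    (f : A) : restrictedFunctions A T :=
  ⟨fun y => (f : S → ℝ) y,
    fun _ => ⟨Set.univ, isOpen_univ, Set.mem_univ _, f, f.2, fun _ _ => rfl⟩⟩

/-- `φ` restricts to a diffeomorphism of the differential subspace `U` onto the differential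
subspace `W`. -/
def IsDiffeoBetween {S : Type*} [TopologicalSpace S] (A : Subalgebra ℝ (S → ℝ)) (φ : S → S)
    (U W : Set S) : Prop :=
  ∃ e : U ≃ W, (∀ y : U, (e y : S) = φ y) ∧
    (∀ h ∈ restrictedFunctions A W, (fun y => h (e y)) ∈ restrictedFunctions A U) ∧
    (∀ h ∈ restrictedFunctions A U, (fun z => h (e.symm z)) ∈ restrictedFunctions A W)

/-- `γ` is, on the open interval `(-ε, ε)`, an integral curve of the derivation `Y`, starting
at `x`. -/
def IsIntegralCurveFrom {S : Type*} {A : Subalgebra ℝ (S → ℝ)} (Y : Derivation ℝ A A)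
    (ε : ℝ) (x : S) (γ : ℝ → S) : Prop :=
  γ 0 = x ∧ ∀ t ∈ Set.Ioo (-ε) ε, ∀ f : A,
    HasDerivAt (fun s => (f : S → ℝ) (γ s)) ((Y f : S → ℝ) (γ t)) t

/-- A derivation `Y` of the algebra of smooth functions is a vector field if it generates a local
one-parameter group of local diffeomorphisms: every point has an open neighbourhood `U` on which
the flow `φ_t` of `Y` is defined for `|t| < ε` and is a diffeomorphism of `U` onto an
open subset. -/
def IsVectorFieldOnSpace {S : Type*} [TopologicalSpace S] {A : Subalgebra ℝ (S → ℝ)}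
    (Y : Derivation ℝ A A) : Prop :=
  ∀ x : S, ∃ U : Set S, IsOpen U ∧ x ∈ U ∧ ∃ ε > (0 : ℝ), ∃ φ : ℝ → S → S,
    (∀ y ∈ U, IsIntegralCurveFrom Y ε y (fun t => φ t y)) ∧
    ∀ t ∈ Set.Ioo (-ε) ε, ∃ W : Set S, IsOpen W ∧ IsDiffeoBetween A (φ t) U W

/-- `Z` is the restriction to `T` of the derivation `Y`: `Z (f|T) = (Y f)|T`. -/
def IsRestrictionOf {S : Type*} [TopologicalSpace S] {A : Subalgebra ℝ (S → ℝ)} {T : Set S}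
    (Z : Derivation ℝ (restrictedFunctions A T) (restrictedFunctions A T))
    (Y : Derivation ℝ A A) : Prop :=
  ∀ f : A, Z (restrictFunction A T f) = restrictFunction A T (Y f)

/-! ### The orbit space -/

/-- The orbit map `π : M → M/G`. -/
def orbitMap (G : Type*) {M : Type*} [Group G] [MulAction G M] (m : M) :
    MulAction.orbitRel.Quotient G M :=
  Quotient.mk (MulAction.orbitRel G M) m

/-- The algebra `C^∞(M/G)` of the functions on the orbit space whose pull-back by the orbit map is
smooth on `M`. -/
def smoothOrbitFunctions (E : Type*) [NormedAddCommGroup E] [NormedSpace ℝ E]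
    (G M : Type*) [TopologicalSpace M] [ChartedSpace E M] [Group G] [MulAction G M] :
    Subalgebra ℝ (MulAction.orbitRel.Quotient G M → ℝ) where
  carrier := {f | ContMDiff 𝓘(ℝ, E) 𝓘(ℝ, ℝ) ∞ (fun m : M => f (orbitMap G m))}
  mul_mem' := fun hf hg => ContMDiff.mul hf hg
  add_mem' := fun hf hg => ContMDiff.add hf hg
  algebraMap_mem' := fun _ => contMDiff_const

/-- The orbit type `M_(H)`: the points whose isotropy group is conjugate to `H`. -/
def orbitType {G : Type*} (M : Type*) [Group G] [MulAction G M] (H : Subgroup G) : Set M :=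
  {m | ∃ g : G, MulAction.stabilizer G m = H.map (MulAut.conj g).toMonoidHom}

/-! ### Submanifolds and vector fields on them -/

/-- `S` is an embedded smooth submanifold of `M`: around each of its points there is a chart of `M`
in which `S` is a linear subspace. -/
def IsEmbeddedSubmanifold (E : Type*) [NormedAddCommGroup E] [NormedSpace ℝ E]
    {M : Type*} [TopologicalSpace M] [ChartedSpace E M] (S : Set M) : Prop :=
  ∀ p ∈ S, ∃ φ ∈ IsManifold.maximalAtlas 𝓘(ℝ, E) ∞ M, p ∈ φ.source ∧
    ∃ F : Submodule ℝ E, φ '' (φ.source ∩ S) = φ.target ∩ (F : Set E)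

/-- `v` is tangent to `S` at `m`: it is the velocity at time `0` of a smooth curve in `S`. -/
def IsTangentTo (E : Type*) [NormedAddCommGroup E] [NormedSpace ℝ E]
    {M : Type*} [TopologicalSpace M] [ChartedSpace E M] (S : Set M) (m : M)
    (v : TangentSpace 𝓘(ℝ, E) m) : Prop :=
  ∃ ε > (0 : ℝ), ∃ γ : ℝ → M, γ 0 = m ∧ (∀ t ∈ Set.Ioo (-ε) ε, γ t ∈ S) ∧
    ContMDiffOn 𝓘(ℝ, ℝ) 𝓘(ℝ, E) ∞ γ (Set.Ioo (-ε) ε) ∧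
    HasMFDerivAt 𝓘(ℝ, ℝ) 𝓘(ℝ, E) γ 0 ((1 : ℝ →L[ℝ] ℝ).smulRight v)

/-- The values of `X` on the embedded submanifold `S` form a smooth vector field on `S`: they are
tangent to `S`, and locally `X` is on `S` the restriction of a smooth vector field on an open
subset of `M`. -/
def IsSmoothVectorFieldOn (E : Type*) [NormedAddCommGroup E] [NormedSpace ℝ E]
    {M : Type*} [TopologicalSpace M] [ChartedSpace E M] [IsManifold 𝓘(ℝ, E) ∞ M] (S : Set M)
    (X : (m : M) → TangentSpace 𝓘(ℝ, E) m) : Prop :=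
  (∀ m ∈ S, IsTangentTo E S m (X m)) ∧
  ∀ m ∈ S, ∃ U : Set M, IsOpen U ∧ m ∈ U ∧ ∃ X' : (m : M) → TangentSpace 𝓘(ℝ, E) m,
    ContMDiffOn 𝓘(ℝ, E) 𝓘(ℝ, E).tangent ∞
      (fun x => (⟨x, X' x⟩ : TangentBundle 𝓘(ℝ, E) M)) U ∧
    ∀ x ∈ U ∩ S, X' x = X x

/-- The vector field `X` on the submanifold `C` of `M` is related, by the restriction of the orbit
map to a map `C → π(C)`, to the derivation `Z` of the algebra of smooth functions on `π(C)`: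
`X (h ∘ π) = (Z h) ∘ π` on `C`. The derivative of `h ∘ π` in the direction of the vector `X m`, which
is tangent to `C`, is computed with any smooth function `u` on `M` that extends `h ∘ π` near `m`. -/
def IsOrbitMapRelated (E : Type*) [NormedAddCommGroup E] [NormedSpace ℝ E]
    (G : Type*) {M : Type*} [TopologicalSpace M] [ChartedSpace E M] [Group G] [MulAction G M]
    (C : Set M) (X : (m : M) → TangentSpace 𝓘(ℝ, E) m)
    (Z : Derivation ℝ (restrictedFunctions (smoothOrbitFunctions E G M) (orbitMap G '' C))
      (restrictedFunctions (smoothOrbitFunctions E G M) (orbitMap G '' C))) : Prop :=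
  ∀ h : restrictedFunctions (smoothOrbitFunctions E G M) (orbitMap G '' C),
    ∀ u : M → ℝ, ContMDiff 𝓘(ℝ, E) 𝓘(ℝ, ℝ) ∞ u →
      ∀ (m : M) (hm : m ∈ C),
        (∀ᶠ x in 𝓝 m, ∀ hx : x ∈ C,
          u x = (h : orbitMap G '' C → ℝ) ⟨orbitMap G x, Set.mem_image_of_mem _ hx⟩) →
        mfderiv 𝓘(ℝ, E) 𝓘(ℝ, ℝ) u m (X m) =
          (Z h : orbitMap G '' C → ℝ) ⟨orbitMap G m, Set.mem_image_of_mem _ hm⟩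

end

/-! Everything is read off in a slice chart. Around `m` the isotropy group K of `m` is compact,
because the action is proper. A chart splits the model space into the range of a projection `P`,
whose directions are swept out by translations in `G`, and the slice, a neighbourhood of 0 in the
kernel of `P`, on which K acts linearly. Every point of the chart is a translate of a slice point,
and a group element that moves a slice point to a slice point lies in K (`exists_linearSlice`). The
chart comes from Bochner averaging, and the orbit directions come from the constant rank theorem
applied to g ↦ g • m.

The isotropy group of a slice point is thus contained in K. If it is also conjugate to K, it equals
K: the two have the same dimension, and a compact group with open identity component has finitely
many components (`stabilizer_eq_of_le_of_conj`). Hence a slice point has the orbit type of `m`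
exactly when K fixes it, that is when `Q s = s` for the averaging projection `Q`. In the chart the
orbit type is therefore a linear subspace, so it is locally connected and its components are
embedded submanifolds that are open in it.

For the lift, let `v` be a fixed point of the slice and follow an integral curve of `Y` from its
orbit. The coordinates of `Q s` and the function R(s) = q (s - Q s), for an invariant positive
definite form `q`, descend after a cutoff to smooth functions on the orbit space. Since R ≥ 0
vanishes at `v` and the integral curve is defined for negative as well as positive times, Y R = 0
there. An invariant function F satisfies F s = F (Q s) + O(R s) near `v`, because an invariant
linear form factors through `Q`. So Y F at `v` is the derivative of F in the fixed direction whose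
coordinates are the values of `Y` on the coordinates of `Q s`
(`LinearSlice.derivation_apply_eq_fderiv`). The integral curves are essential: on ℝ/{±1} with
coordinate y = x², the derivation d/dy does not annihilate R = y at 0.

This direction depends smoothly on the slice point and extends to a smooth invariant field on the
tube. Cut off by an invariant weight it becomes global, and countably many such weighted lifts are
summed and divided by the total weight (`IsWeightedLift.exists_glue`). Finally, (Y f)(π p) is the
derivative of f ∘ π along X(p), which is tangent to `C`. It therefore depends only on `f` along
π(C), so `Y` restricts to π(C). -/

/-! ### The inverse function theorem and maps of constant rank -/

section Calculus

variable {V : Type*} [NormedAddCommGroup V] [NormedSpace ℝ V] [FiniteDimensional ℝ V]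
  {W : Type*} [NormedAddCommGroup W] [NormedSpace ℝ W] [FiniteDimensional ℝ W]

/-- The smooth inverse function theorem, on a prescribed open set. -/
theorem exists_openPartialHomeomorph_of_contDiffOn {n : ℕ∞ω} (hn : n ≠ 0) {f : V → V} {U : Set V}
    (hU : IsOpen U) (hf : ContDiffOn ℝ n f U) {a : V} (ha : a ∈ U) (f' : V ≃L[ℝ] V)
    (hf' : HasFDerivAt f (f' : V →L[ℝ] V) a) :
    ∃ e : OpenPartialHomeomorph V V, a ∈ e.source ∧ e.source ⊆ U ∧ (∀ x, e x = f x) ∧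
      ContDiffOn ℝ n e e.source ∧ ContDiffOn ℝ n e.symm e.target ∧
      ∀ x ∈ e.source, ∃ L : V ≃L[ℝ] V, HasFDerivAt f (L : V →L[ℝ] V) x := by
  have hfa : ContDiffAt ℝ n f a := hf.contDiffAt (hU.mem_nhds ha)
  have h1n : (1 : ℕ∞ω) ≤ n := ENat.one_le_iff_ne_zero_withTop.2 hn
  have hcont : ContinuousOn (fderiv ℝ f) U :=
    (hf.of_le h1n).continuousOn_fderiv_of_isOpen hU le_rfl
  -- Cutting down to the points with invertible derivative makes the inverse smooth on its whole
  -- domain, not only at the image of `a`.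
  set O := U ∩ fderiv ℝ f ⁻¹' (Set.range ((↑) : (V ≃L[ℝ] V) → (V →L[ℝ] V))) with hO
  have hOo : IsOpen O := hcont.isOpen_inter_preimage hU ContinuousLinearEquiv.isOpen
  set e₀ := hfa.toOpenPartialHomeomorph f hf' hn with he₀
  have he₀f : ∀ x, e₀ x = f x := fun x =>
    congrFun (hfa.toOpenPartialHomeomorph_coe hf' hn) x
  set e := e₀.restrOpen O hOo with he
  have hef : ∀ x, e x = f x := he₀f
  have hsrc : e.source = e₀.source ∩ O := rfl
  have hder : ∀ x ∈ e.source, ∃ L : V ≃L[ℝ] V, HasFDerivAt f (L : V →L[ℝ] V) x := by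
    intro x hx
    obtain ⟨L, hL⟩ := Set.mem_preimage.1 hx.2.2
    refine ⟨L, ?_⟩
    rw [hL]
    exact ((hf.contDiffAt (hU.mem_nhds hx.2.1)).differentiableAt hn).hasFDerivAt
  have hefun : (e : V → V) = f := funext hef
  refine ⟨e, ⟨hfa.mem_toOpenPartialHomeomorph_source hf' hn, ha, ⟨f', hf'.fderiv.symm⟩⟩,
    fun x hx => hx.2.1, hef, ?_, ?_, hder⟩
  · rw [hefun]; exact hf.mono fun x hx => hx.2.1
  · intro y hy
    have hx := e.map_target hy
    obtain ⟨L, hL⟩ := hder _ hx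
    refine (e.contDiffAt_symm hy (f₀' := L) ?_ ?_).contDiffWithinAt
    · rw [hefun]; exact hL
    · rw [hefun]; exact hf.contDiffAt (hU.mem_nhds hx.2.1)

/-- A projection cannot lower the rank of a map close to one whose range it fixes, if the rank
does not exceed that of the limit. -/
theorem eventually_ker_comp_le (A : V →L[ℝ] W) (P : W →L[ℝ] W) (hPA : P ∘L A = A) :
    ∀ᶠ L : V →L[ℝ] W in 𝓝 A,
      Module.finrank ℝ (L : V →ₗ[ℝ] W).range ≤ Module.finrank ℝ (A : V →ₗ[ℝ] W).range →
      ∀ v, P (L v) = 0 → L v = 0 := by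
  have hcont : Continuous fun L : V →L[ℝ] W => P ∘L L := by fun_prop
  have hopen := (isOpen_setOfPred_nat_le_rank (𝕜 := ℝ) (E := V) (F := W)
    (Module.finrank ℝ (A : V →ₗ[ℝ] W).range)).preimage hcont
  have hA : A ∈ (fun L : V →L[ℝ] W => P ∘L L) ⁻¹'
      {f : V →L[ℝ] W | ((Module.finrank ℝ (A : V →ₗ[ℝ] W).range : ℕ) : Cardinal) ≤
        (f : V →ₗ[ℝ] W).rank} := by
    rw [Set.mem_preimage, Set.mem_ofPred_eq]
    rw [hPA, LinearMap.rank, Module.finrank_eq_rank]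
  -- Rank is lower semicontinuous, so rank (P L) ≥ rank A ≥ rank L near `A`. The kernel of `L` lies
  -- in that of `P L`, and the dimensions force equality.
  filter_upwards [hopen.mem_nhds hA] with L hL hrank v hv
  have h1 : Module.finrank ℝ (A : V →ₗ[ℝ] W).range ≤
      Module.finrank ℝ ((P ∘L L : V →L[ℝ] W) : V →ₗ[ℝ] W).range := by
    have := hL
    rw [Set.mem_preimage, Set.mem_ofPred_eq, LinearMap.rank, ← Module.finrank_eq_rank] at this
    exact_mod_cast this
  have h2 := LinearMap.finrank_range_add_finrank_ker (L : V →ₗ[ℝ] W)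
  have h3 := LinearMap.finrank_range_add_finrank_ker ((P ∘L L : V →L[ℝ] W) : V →ₗ[ℝ] W)
  have hle : (L : V →ₗ[ℝ] W).ker ≤ ((P ∘L L : V →L[ℝ] W) : V →ₗ[ℝ] W).ker := by
    intro x hx
    have : L x = 0 := hx
    change P (L x) = 0
    rw [this, map_zero]
  have heq := Submodule.eq_of_le_of_finrank_le hle (by omega)
  have : v ∈ ((P ∘L L : V →L[ℝ] W) : V →ₗ[ℝ] W).ker := hv
  rw [← heq] at this
  exact this

/-- The constant rank theorem: a map whose rank does not exceed that of its derivative `A` at `0`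
factors near `0`, in suitable coordinates, through the projection `B A`, where `B` is a section
of `A` over its range. -/
theorem exists_straightening {h : V → W} {U : Set V} (hU : IsOpen U) (h0U : (0 : V) ∈ U)
    (hh : ContDiffOn ℝ 1 h U) (hh0 : h 0 = 0) {A : V →L[ℝ] W} (hA : HasFDerivAt h A 0)
    (hrank : ∀ x ∈ U, Module.finrank ℝ (fderiv ℝ h x : V →ₗ[ℝ] W).range ≤
      Module.finrank ℝ (A : V →ₗ[ℝ] W).range)
    {P : W →L[ℝ] W} {B : W →L[ℝ] V} (hPA : P ∘L A = A) (hAB : A ∘L B = P) (hBP : B ∘L P = B) :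
    ∃ (e : OpenPartialHomeomorph V V) (r : ℝ), 0 < r ∧ (0 : V) ∈ e.source ∧ e.source ⊆ U ∧
      (∀ x, e x = B (P (h x)) + (x - B (A x))) ∧
      e.target = {y | ‖B (A y)‖ < r ∧ ‖y - B (A y)‖ < r} ∧
      ContDiffOn ℝ 1 e.symm e.target ∧ HasFDerivAt e.symm (ContinuousLinearMap.id ℝ V) 0 ∧
      ∀ y ∈ e.target, h (e.symm y) = h (e.symm (B (A y))) := by
  have hPP : ∀ w, P (P w) = P w := fun w => by
    have : P (A (B w)) = A (B w) := DFunLike.congr_fun hPA (B w)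
    have h2 : A (B w) = P w := DFunLike.congr_fun hAB w
    rwa [h2] at this
  have hAB' : ∀ w, A (B w) = P w := DFunLike.congr_fun hAB
  have hPA' : ∀ v, P (A v) = A v := DFunLike.congr_fun hPA
  have hBP' : ∀ w, B (P w) = B w := DFunLike.congr_fun hBP
  -- These coordinates make `P ∘ h` linear, since A (f x) = P (h x). The summand x - B (A x) makes
  -- the derivative at 0 the identity.
  set f : V → V := fun x => B (P (h x)) + (x - B (A x)) with hf
  have hcont : ContinuousOn (fderiv ℝ h) U := hh.continuousOn_fderiv_of_isOpen hU le_rfl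
  -- the open set on which `P` is injective on the range of the derivative
  have hnear : ∀ᶠ x in 𝓝 (0 : V), ∀ v, P (fderiv ℝ h x v) = 0 → fderiv ℝ h x v = 0 := by
    have h1 : Filter.Tendsto (fderiv ℝ h) (𝓝 0) (𝓝 A) := by
      have := (hcont.continuousAt (hU.mem_nhds h0U)).tendsto
      rwa [hA.fderiv] at this
    filter_upwards [h1.eventually (eventually_ker_comp_le A P hPA), hU.mem_nhds h0U] with x hx hxU
    exact hx (hrank x hxU)
  obtain ⟨U', hU'U, hU'o, h0U'⟩ := mem_nhds_iff.1 (hnear.and (hU.mem_nhds h0U))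
  have hfU : ContDiffOn ℝ 1 f U' := by
    have : ContDiffOn ℝ 1 h U' := hh.mono fun x hx => (hU'U hx).2
    have hBP1 : ContDiff ℝ 1 fun w => B (P w) := by fun_prop
    have h2 : ContDiff ℝ 1 fun x : V => x - B (A x) := by fun_prop
    exact (hBP1.comp_contDiffOn this).add h2.contDiffOn
  have hfder : ∀ x (L : V →L[ℝ] W), HasFDerivAt h L x → HasFDerivAt f
      (B ∘L P ∘L L + (ContinuousLinearMap.id ℝ V - B ∘L A)) x := by
    intro x L hL
    exact ((B ∘L P).hasFDerivAt.comp x hL).add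
      ((hasFDerivAt_id x).sub (B ∘L A).hasFDerivAt)
  have hf0 : HasFDerivAt f ((ContinuousLinearEquiv.refl ℝ V : V ≃L[ℝ] V) : V →L[ℝ] V) 0 := by
    convert hfder 0 A hA using 1
    ext v
    simp [hPA']
  obtain ⟨e₀, h0e₀, he₀U, he₀f, he₀c, he₀s, he₀d⟩ :=
    exists_openPartialHomeomorph_of_contDiffOn one_ne_zero hU'o hfU h0U' _ hf0
  have hfz : f 0 = 0 := by simp [hf, hh0]
  have ht : e₀.target ∈ 𝓝 (0 : V) := by
    have := e₀.map_source h0e₀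
    rw [he₀f, hfz] at this
    exact e₀.open_target.mem_nhds this
  obtain ⟨ε, hε, hball⟩ := Metric.mem_nhds_iff.1 ht
  -- A product box, so that the segment from `B (A y)` to `y` stays inside it.
  set T : Set V := {y | ‖B (A y)‖ < ε / 2 ∧ ‖y - B (A y)‖ < ε / 2} with hT
  have hTo : IsOpen T := by
    rw [hT, Set.ofPred_and]
    refine IsOpen.inter (isOpen_lt ?_ continuous_const) (isOpen_lt ?_ continuous_const) <;> fun_prop
  have hTt : T ⊆ e₀.target := by
    intro y hy
    apply hball
    rw [mem_ball_zero_iff]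
    calc ‖y‖ = ‖B (A y) + (y - B (A y))‖ := by congr 1; abel
      _ ≤ _ := norm_add_le _ _
      _ < ε := by linarith [hy.1, hy.2]
  set e := (e₀.symm.restrOpen T hTo).symm with he
  have hes : (e.symm : V → V) = e₀.symm := rfl
  have hee : (e : V → V) = e₀ := rfl
  have htgt : e.target = T := by
    change e₀.target ∩ T = T
    exact Set.inter_eq_right.2 hTt
  have hsrcsub : e.source ⊆ e₀.source := by
    intro x hx
    exact hx.1
  have h0T : (0 : V) ∈ T := by simp [hT, hε]
  have hsymm0 : e₀.symm 0 = 0 := by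
    have := e₀.left_inv h0e₀
    rwa [he₀f, hfz] at this
  have h0src : (0 : V) ∈ e.source := by
    have := e.map_target (htgt ▸ h0T)
    rwa [hes, hsymm0] at this
  refine ⟨e, ε / 2, by positivity, h0src, fun x hx => (hU'U (he₀U (hsrcsub hx))).2,
    he₀f, htgt, ?_, ?_, ?_⟩
  · rw [hes]; exact he₀s.mono (htgt ▸ hTt)
  · have hef0 : HasFDerivAt e₀ ((ContinuousLinearEquiv.refl ℝ V : V ≃L[ℝ] V) : V →L[ℝ] V)
        (e₀.symm 0) := by
      rw [hsymm0, show (e₀ : V → V) = f from funext he₀f]; exact hf0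
    exact e₀.hasFDerivAt_symm (hTt h0T) hef0
  · intro y hy
    rw [htgt] at hy
    rw [hes]
    -- Along this segment `A`, hence `P ∘ h ∘ e₀.symm`, is constant. As `P` is injective on the
    -- range of the derivative of `h`, the function `h ∘ e₀.symm` is constant too.
    set c : ℝ → V := fun t => B (A y) + t • (y - B (A y)) with hc
    have hBA : ∀ t, B (A (c t)) = B (A y) := by
      intro t
      simp [hc, hAB', hPA']
    have hcT : ∀ t ∈ Set.Icc (0 : ℝ) 1, c t ∈ T := by
      intro t ht
      refine ⟨by rw [hBA]; exact hy.1, ?_⟩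
      rw [hBA]
      calc ‖c t - B (A y)‖ = |t| * ‖y - B (A y)‖ := by simp [hc, norm_smul]
        _ ≤ 1 * ‖y - B (A y)‖ := by
          gcongr; rw [abs_of_nonneg ht.1]; exact ht.2
        _ < ε / 2 := by rw [one_mul]; exact hy.2
    have hcd : ∀ t, HasDerivAt c (y - B (A y)) t := by
      intro t
      have := ((hasDerivAt_id t).smul_const (y - B (A y))).const_add (B (A y))
      simpa [hc] using this
    have hder : ∀ t ∈ Set.Icc (0 : ℝ) 1, HasDerivAt (fun t => h (e₀.symm (c t))) 0 t := by
      intro t ht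
      have hx := e₀.map_target (hTt (hcT t ht))
      obtain ⟨L, hL⟩ := he₀d _ hx
      have hs : HasFDerivAt e₀.symm (L.symm : V →L[ℝ] V) (c t) :=
        e₀.hasFDerivAt_symm (hTt (hcT t ht)) (by rwa [show (e₀ : V → V) = f from funext he₀f])
      have hxU := hU'U (he₀U hx)
      have hhd : HasFDerivAt h (fderiv ℝ h (e₀.symm (c t))) (e₀.symm (c t)) :=
        ((hh.contDiffAt (hU.mem_nhds hxU.2)).differentiableAt one_ne_zero).hasFDerivAt
      have h3 := hhd.comp_hasDerivAt t (hs.comp_hasDerivAt t (hcd t))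
      set θ := L.symm (y - B (A y)) with hθ
      have hLθ : L θ = y - B (A y) := by simp [hθ]
      have hLeq := DFunLike.congr_fun (hL.unique (hfder _ _ hhd)) θ
      have h4 : P (fderiv ℝ h (e₀.symm (c t)) θ) = 0 := by
        have h5 := congrArg A (hLeq.symm.trans hLθ)
        simpa [hAB', hPA', hPP] using h5
      have h6 := hxU.1 θ h4
      have h7 : (fderiv ℝ h (e₀.symm (c t))) ((L.symm : V →L[ℝ] V) (y - B (A y))) = 0 := h6
      rw [h7] at h3
      exact h3
    have := constant_of_has_deriv_right_zero (a := 0) (b := 1)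
      (f := fun t => h (e₀.symm (c t)))
      (fun t ht => (hder t ht).continuousAt.continuousWithinAt)
      (fun t ht => (hder t ⟨ht.1, ht.2.le⟩).hasDerivWithinAt) 1 ⟨zero_le_one, le_rfl⟩
    simpa [hc] using this

end Calculus

/-! ### Smoothness of integrals depending on a parameter -/

section ParametricIntegral

open MeasureTheory

universe u

variable {EG : Type*} [NormedAddCommGroup EG] [NormedSpace ℝ EG]
  {N : Type*} [TopologicalSpace N] [ChartedSpace EG N]
  {E : Type u} [NormedAddCommGroup E] [NormedSpace ℝ E] [FiniteDimensional ℝ E]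

/-- Only the vector variable is differentiated, and the manifold variable is a parameter. The result
has the same form as the hypothesis, which makes the induction for integrals possible. -/
theorem contMDiffOn_partial_fderiv [IsManifold 𝓘(ℝ, EG) ∞ N]
    {E' : Type*} [NormedAddCommGroup E'] [NormedSpace ℝ E']
    {F : N × E → E'} {Ω : Set (N × E)} (hΩ : IsOpen Ω)
    (hF : ContMDiffOn (𝓘(ℝ, EG).prod 𝓘(ℝ, E)) 𝓘(ℝ, E') ∞ F Ω) :
    ContMDiffOn (𝓘(ℝ, EG).prod 𝓘(ℝ, E)) 𝓘(ℝ, E →L[ℝ] E') ∞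
      (fun p => fderiv ℝ (fun w => F (p.1, w)) p.2) Ω := by
  intro p hp
  have hFp : ContMDiffAt (𝓘(ℝ, EG).prod 𝓘(ℝ, E)) 𝓘(ℝ, E') ∞ F p :=
    hF.contMDiffAt (hΩ.mem_nhds hp)
  have h1 : ContMDiffAt ((𝓘(ℝ, EG).prod 𝓘(ℝ, E)).prod 𝓘(ℝ, E)) 𝓘(ℝ, E') ∞
      (Function.uncurry fun (q : N × E) (w : E) => F (q.1, w)) (p, p.2) := by
    refine ContMDiffAt.comp (g := F) (f := fun r : (N × E) × E => (r.1.1, r.2)) (p, p.2) hFp ?_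
    exact (contMDiffAt_fst.comp _ contMDiffAt_fst).prodMk contMDiffAt_snd
  have h2 := ContMDiffAt.mfderiv (m := ∞) (fun (q : N × E) (w : E) => F (q.1, w)) Prod.snd h1
    contMDiffAt_snd (by simp)
  refine (h2.congr_of_eventuallyEq (Filter.Eventually.of_forall fun x => ?_)).contMDiffWithinAt
  exact (congrFun (inTangentCoordinates_model_space (I := 𝓘(ℝ, E)) (I' := 𝓘(ℝ, E')) Prod.snd
    (fun x : N × E => F (x.1, x.2)) (fun x => fderiv ℝ (fun w => F (x.1, w)) x.2) p) x).symm.trans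
    (by simp only [mfderiv_eq_fderiv])

variable {K : Type*} [TopologicalSpace K] [CompactSpace K] [MeasurableSpace K] [BorelSpace K]

/-- Dominated differentiation: compactness of `K` yields one bound on the derivatives for all `k`
and all parameters near `v`. -/
theorem hasFDerivAt_integral_of_compactSpace [IsManifold 𝓘(ℝ, EG) ∞ N]
    {E' : Type*} [NormedAddCommGroup E'] [NormedSpace ℝ E']
    [FiniteDimensional ℝ E'] (μ : Measure K) [IsFiniteMeasure μ] {ι : K → N} (hι : Continuous ι)
    {V : Set E} (hV : IsOpen V) {Ω : Set (N × E)} (hΩ : IsOpen Ω)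
    (hVΩ : ∀ k, ∀ v ∈ V, (ι k, v) ∈ Ω) {F : N × E → E'}
    (hF : ContMDiffOn (𝓘(ℝ, EG).prod 𝓘(ℝ, E)) 𝓘(ℝ, E') ∞ F Ω) {v : E} (hv : v ∈ V) :
    HasFDerivAt (fun v => ∫ k, F (ι k, v) ∂μ)
      (∫ k, fderiv ℝ (fun w => F (ι k, w)) v ∂μ) v := by
  have hcont : ∀ w ∈ V, Continuous fun k => F (ι k, w) := fun w hw =>
    hF.continuousOn.comp_continuous (by fun_prop) fun k => hVΩ k w hw
  have hF' := contMDiffOn_partial_fderiv hΩ hF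
  have hcont' : ∀ w ∈ V, Continuous fun k => fderiv ℝ (fun w => F (ι k, w)) w := fun w hw =>
    hF'.continuousOn.comp_continuous (f := fun k => (ι k, w)) (by fun_prop) fun k => hVΩ k w hw
  obtain ⟨C, hC⟩ := (isCompact_univ (X := K)).exists_bound_of_continuousOn
    (hcont' v hv).continuousOn
  have hev : ∀ᶠ w in 𝓝 v, ∀ k ∈ (Set.univ : Set K),
      ‖fderiv ℝ (fun w => F (ι k, w)) w‖ ≤ C + 1 := by
    refine isCompact_univ.eventually_forall_of_forall_eventually fun k _ => ?_
    have hc : ContinuousAt (fun p : E × K => ‖fderiv ℝ (fun w => F (ι p.2, w)) p.1‖) (v, k) := by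
      have := (hF'.continuousOn.continuousAt (hΩ.mem_nhds (hVΩ k v hv))).comp_of_eq
        (f := fun p : E × K => (ι p.2, p.1)) (x := (v, k)) (by fun_prop) rfl
      exact this.norm
    have : ‖fderiv ℝ (fun w => F (ι k, w)) v‖ < C + 1 := by
      linarith [hC k (Set.mem_univ _)]
    exact (hc.eventually_lt_const this).mono fun _ h => h.le
  have hnhds := Filter.inter_mem hev (hV.mem_nhds hv)
  refine hasFDerivAt_integral_of_dominated_of_fderiv_le (F' := fun w k =>
    fderiv ℝ (fun w => F (ι k, w)) w) (bound := fun _ => C + 1) hnhds ?_ ?_ ?_ ?_ ?_ ?_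
  · filter_upwards [hV.mem_nhds hv] with w hw
    exact (hcont w hw).aestronglyMeasurable
  · exact (hcont v hv).integrable_of_hasCompactSupport (HasCompactSupport.of_compactSpace _)
  · exact (hcont' v hv).aestronglyMeasurable
  · exact Filter.Eventually.of_forall fun k w hw => hw.1 k (Set.mem_univ _)
  · exact integrable_const _
  · refine Filter.Eventually.of_forall fun k w hw => ?_
    have h1 : ContMDiffAt (𝓘(ℝ, EG).prod 𝓘(ℝ, E)) 𝓘(ℝ, E') ∞ F (ι k, w) :=
      hF.contMDiffAt (hΩ.mem_nhds (hVΩ k w hw.2))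
    have h2 : ContMDiffAt 𝓘(ℝ, E) 𝓘(ℝ, E') ∞ (fun w => F (ι k, w)) w :=
      h1.comp w (contMDiffAt_const.prodMk contMDiffAt_id)
    exact (h2.contDiffAt.differentiableAt (by simp)).hasFDerivAt

/-- The integral over a compact space of a smooth function of a parameter is smooth. -/
theorem contDiffOn_integral_of_compactSpace [IsManifold 𝓘(ℝ, EG) ∞ N]
    {E' : Type u} [NormedAddCommGroup E'] [NormedSpace ℝ E']
    [FiniteDimensional ℝ E'] (μ : Measure K) [IsFiniteMeasure μ] {ι : K → N} (hι : Continuous ι)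
    {V : Set E} (hV : IsOpen V) {Ω : Set (N × E)} (hΩ : IsOpen Ω)
    (hVΩ : ∀ k, ∀ v ∈ V, (ι k, v) ∈ Ω) {F : N × E → E'}
    (hF : ContMDiffOn (𝓘(ℝ, EG).prod 𝓘(ℝ, E)) 𝓘(ℝ, E') ∞ F Ω) :
    ContDiffOn ℝ ∞ (fun v => ∫ k, F (ι k, v) ∂μ) V := by
  rw [contDiffOn_infty]
  intro n
  -- The target space changes from `E'` to `E →L[ℝ] E'` at each step. This is why `E` and `E'` share
  -- a universe.
  induction n generalizing E' with
  | zero =>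
    exact contDiffOn_zero.2 fun v hv =>
      (hasFDerivAt_integral_of_compactSpace μ hι hV hΩ hVΩ hF hv).continuousAt.continuousWithinAt
  | succ n ih =>
    rw [show ((n + 1 : ℕ) : ℕ∞ω) = (n : ℕ∞ω) + 1 by norm_cast,
      contDiffOn_succ_iff_fderiv_of_isOpen hV]
    refine ⟨fun v hv => (hasFDerivAt_integral_of_compactSpace μ hι hV hΩ hVΩ hF
      hv).differentiableAt.differentiableWithinAt, fun h => by simp at h, ?_⟩
    refine (ih (contMDiffOn_partial_fderiv hΩ hF)).congr fun v hv => ?_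
    exact (hasFDerivAt_integral_of_compactSpace μ hι hV hΩ hVΩ hF hv).fderiv

end ParametricIntegral

/-! ### Averaging representations of compact groups -/

section Averaging

open MeasureTheory

variable {K : Type*} [Group K] [TopologicalSpace K] [IsTopologicalGroup K] [CompactSpace K]

variable (K) in
theorem exists_probabilityMeasure_isMulLeftInvariant [MeasurableSpace K] [BorelSpace K] :
    ∃ μ : Measure K, IsProbabilityMeasure μ ∧ μ.IsMulLeftInvariant := by
  refine ⟨Measure.haarMeasure ⊤, ⟨?_⟩, inferInstance⟩
  simpa using Measure.haarMeasure_self (K₀ := (⊤ : TopologicalSpace.PositiveCompacts K))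

theorem Continuous.integrable_of_compactSpace {K : Type*} [TopologicalSpace K] [CompactSpace K]
    [MeasurableSpace K] [BorelSpace K] {F : Type*} [NormedAddCommGroup F] {f : K → F}
    (hf : Continuous f) (μ : Measure K) [IsFiniteMeasure μ] : Integrable f μ :=
  hf.integrable_of_hasCompactSupport (HasCompactSupport.of_compactSpace _)

variable {E : Type*} [NormedAddCommGroup E] [NormedSpace ℝ E] [FiniteDimensional ℝ E]
  {ρ : K →* (E →L[ℝ] E)}

/-- The average of a representation is an equivariant projection onto the fixed vectors. -/
theorem exists_projection_fixed (hρ : Continuous ρ) :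
    ∃ Q : E →L[ℝ] E, (∀ k v, ρ k (Q v) = Q v) ∧ (∀ k v, Q (ρ k v) = Q v) ∧
      (∀ v, (∀ k, ρ k v = v) → Q v = v) ∧
      (∀ l : E →L[ℝ] ℝ, (∀ k v, l (ρ k v) = l v) → ∀ v, l (Q v) = l v) ∧
      (∀ B : E →L[ℝ] E, (∀ k v, ρ k (B v) = B (ρ k v)) → ∀ v, Q (B v) = B (Q v)) := by
  borelize K
  obtain ⟨μ, _, _⟩ := exists_probabilityMeasure_isMulLeftInvariant K
  have hint : Integrable (fun k => ρ k) μ := hρ.integrable_of_compactSpace μ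
  have hint' : Integrable (fun k => ρ k⁻¹) μ :=
    (hρ.comp continuous_inv).integrable_of_compactSpace μ
  set Q : E →L[ℝ] E := ∫ k, ρ k ∂μ with hQ
  set Q' : E →L[ℝ] E := ∫ k, ρ k⁻¹ ∂μ with hQ'
  have hQv : ∀ v, Q v = ∫ k, ρ k v ∂μ := fun v => ContinuousLinearMap.integral_apply hint v
  have hQ'v : ∀ v, Q' v = ∫ k, ρ k⁻¹ v ∂μ := fun v => ContinuousLinearMap.integral_apply hint' v
  have hiv : ∀ v, Integrable (fun k => ρ k v) μ := fun v =>
    (hρ.clm_apply continuous_const).integrable_of_compactSpace μ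
  have hcomm : ∀ {F : Type _} [NormedAddCommGroup F] [NormedSpace ℝ F] [CompleteSpace F]
      (L : E →L[ℝ] F) (v : E), L (Q v) = ∫ k, L (ρ k v) ∂μ := by
    intro F _ _ _ L v
    rw [hQv]
    exact (L.integral_comp_comm (hiv v)).symm
  have h1 : ∀ k v, ρ k (Q v) = Q v := by
    intro k v
    rw [hcomm (ρ k) v, hQv]
    have := integral_mul_left_eq_self (μ := μ) (fun u => ρ u v) k
    rw [← this]
    simp
  have h2 : ∀ k v, Q' (ρ k v) = Q' v := by
    intro k v
    rw [hQ'v, hQ'v]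
    have := integral_mul_left_eq_self (μ := μ) (fun u => ρ u⁻¹ v) k⁻¹
    rw [← this]
    simp
  have hfix : ∀ v, (∀ k, ρ k v = v) → Q v = v := by
    intro v hv
    rw [hQv]; simp [hv]
  -- Left invariance of the measure gives ρ k ∘ Q = Q, and Q' ∘ ρ k = Q' for the average over
  -- inverses. Computing Q' ∘ Q in two ways identifies them, so no right invariance is needed.
  have hQQ' : ∀ v, Q v = Q' v := by
    intro v
    have e1 : Q' (Q v) = Q v := by
      rw [hQ'v]; simp [h1]
    have e2 : Q' (Q v) = Q' v := by
      rw [hcomm Q' v]; simp [h2]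
    rw [← e1, e2]
  refine ⟨Q, h1, fun k v => by rw [hQQ', hQQ', h2], hfix, fun l hl v => ?_, fun B hB v => ?_⟩
  · rw [hQv, ← l.integral_comp_comm (hiv v)]; simp [hl]
  · rw [hcomm B v, hQv]; simp [hB]

/-- An invariant subspace is the range of an equivariant projection. -/
theorem exists_equivariant_projection (hρ : Continuous ρ) (T : Submodule ℝ E)
    (hT : ∀ k, ∀ v ∈ T, ρ k v ∈ T) :
    ∃ P : E →L[ℝ] E, (∀ v, P v ∈ T) ∧ (∀ v ∈ T, P v = v) ∧ ∀ k v, ρ k (P v) = P (ρ k v) := by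
  borelize K
  obtain ⟨μ, _, _⟩ := exists_probabilityMeasure_isMulLeftInvariant K
  obtain ⟨p, hp⟩ := Submodule.ClosedComplemented.of_finiteDimensional (𝕜 := ℝ) T
  set P₀ : E →L[ℝ] E := T.subtypeL ∘L p with hP₀
  have hP₀T : ∀ v, P₀ v ∈ T := fun v => (p v).2
  have hP₀v : ∀ v ∈ T, P₀ v = v := fun v hv => by
    simpa [hP₀] using congrArg Subtype.val (hp ⟨v, hv⟩)
  -- Each conjugate of `P₀` is again a projection onto the invariant subspace `T`, and this survives
  -- averaging.
  have hc : Continuous fun k => ρ k ∘L P₀ ∘L ρ k⁻¹ :=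
    hρ.clm_comp (continuous_const.clm_comp (hρ.comp continuous_inv))
  have hint := hc.integrable_of_compactSpace μ
  set P : E →L[ℝ] E := ∫ k, ρ k ∘L P₀ ∘L ρ k⁻¹ ∂μ with hP
  have hPv : ∀ v, P v = ∫ k, ρ k (P₀ (ρ k⁻¹ v)) ∂μ := fun v =>
    ContinuousLinearMap.integral_apply hint v
  have hiv : ∀ v, Integrable (fun k => ρ k (P₀ (ρ k⁻¹ v))) μ := fun v =>
    (hc.clm_apply continuous_const).integrable_of_compactSpace μ
  have hinv : ∀ k v, ρ k (ρ k⁻¹ v) = v := fun k v => by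
    rw [← mul_apply_eq_comp, ← map_mul]; simp
  refine ⟨P, fun v => ?_, fun v hv => ?_, fun k v => ?_⟩
  · rw [hPv]
    have hq : ∀ k, ρ k (P₀ (ρ k⁻¹ v)) = P₀ (ρ k (P₀ (ρ k⁻¹ v))) := fun k =>
      (hP₀v _ (hT k _ (hP₀T _))).symm
    rw [show (∫ k, ρ k (P₀ (ρ k⁻¹ v)) ∂μ) = P₀ (∫ k, ρ k (P₀ (ρ k⁻¹ v)) ∂μ) by
      rw [← P₀.integral_comp_comm (hiv v)]
      exact integral_congr_ae (Filter.Eventually.of_forall hq)]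
    exact hP₀T _
  · rw [hPv]
    have : ∀ k, ρ k (P₀ (ρ k⁻¹ v)) = v := fun k => by
      rw [hP₀v _ (hT _ _ hv), hinv]
    simp [this]
  · rw [hPv, hPv, ← (ρ k).integral_comp_comm (hiv v)]
    have := integral_mul_left_eq_self (μ := μ) (fun u => ρ u (P₀ (ρ u⁻¹ (ρ k v)))) k
    rw [← this]
    refine integral_congr_ae (Filter.Eventually.of_forall fun u => ?_)
    have : ρ (k * u)⁻¹ (ρ k v) = ρ u⁻¹ v := by
      rw [← mul_apply_eq_comp, ← map_mul]; simp
    simp only [this]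
    rw [map_mul]; rfl

/-- A representation of a compact group leaves a positive definite quadratic form invariant. -/
theorem exists_invariant_quadratic (hρ : Continuous ρ) :
    ∃ q : E → ℝ, ContDiff ℝ ∞ q ∧ q 0 = 0 ∧ (∀ k v, q (ρ k v) = q v) ∧
      ∃ c > 0, ∀ v, c * ‖v‖ ^ 2 ≤ q v := by
  borelize K
  obtain ⟨μ, _, _⟩ := exists_probabilityMeasure_isMulLeftInvariant K
  set ι : E ≃L[ℝ] EuclideanSpace ℝ (Fin (Module.finrank ℝ E)) := toEuclidean with hι
  set u : K → (E →L[ℝ] EuclideanSpace ℝ (Fin (Module.finrank ℝ E))) :=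
    fun k => (ι : E →L[ℝ] _) ∘L ρ k⁻¹ with hu
  have huc : Continuous u := continuous_const.clm_comp (hρ.comp continuous_inv)
  -- The pullback of the Euclidean inner product by `u k`. Integrating the bilinear form, and not
  -- its diagonal, makes smoothness of the average evident.
  set b : K → (E →L[ℝ] E →L[ℝ] ℝ) := fun k =>
    ((ContinuousLinearMap.compL ℝ E _ ℝ).flip (u k)) ∘L (innerSL ℝ) ∘L (u k) with hb
  have hbc : Continuous b :=
    ((ContinuousLinearMap.continuous _).comp huc).clm_comp (continuous_const.clm_comp huc)
  have hbv : ∀ k v, b k v v = ‖u k v‖ ^ 2 := fun k v => by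
    rw [← real_inner_self_eq_norm_sq]; rfl
  have hint := Continuous.integrable_of_compactSpace (F := E →L[ℝ] E →L[ℝ] ℝ) hbc μ
  set B : E →L[ℝ] E →L[ℝ] ℝ := ∫ k, b k ∂μ with hB
  have hBv : ∀ v, B v v = ∫ k, ‖u k v‖ ^ 2 ∂μ := fun v => by
    rw [hB, ContinuousLinearMap.integral_apply hint,
      ContinuousLinearMap.integral_apply (hint.apply_continuousLinearMap v)]
    simp only [hbv]
  have hinv : ∀ k v, ι.symm (u k⁻¹ (ρ k⁻¹ v)) = v := fun k v => by
    simp only [hu, ContinuousLinearMap.comp_apply, inv_inv]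
    rw [← mul_apply_eq_comp, ← map_mul]; simp
  have hinv' : ∀ k v, ρ k (ι.symm (u k v)) = v := fun k v => by
    simp only [hu, ContinuousLinearMap.comp_apply, ContinuousLinearEquiv.coe_coe,
      ContinuousLinearEquiv.symm_apply_apply]
    rw [← mul_apply_eq_comp, ← map_mul]; simp
  set w : K → (EuclideanSpace ℝ (Fin (Module.finrank ℝ E)) →L[ℝ] E) :=
    fun k => ρ k ∘L (ι.symm : _ →L[ℝ] E) with hw
  have hwc : Continuous w := hρ.clm_comp continuous_const
  -- A uniform bound on the inverses of `u k` keeps the averaged form bounded below by a multiple of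
  -- the squared norm.
  obtain ⟨C, hC⟩ := (isCompact_univ (X := K)).exists_bound_of_continuousOn hwc.continuousOn
  have hC0 : 0 < |C| + 1 := by positivity
  have hlow : ∀ k v, ‖v‖ ≤ (|C| + 1) * ‖u k v‖ := fun k v => by
    calc ‖v‖ = ‖w k (u k v)‖ := by rw [← hinv' k v]; simp [hw, hinv']
      _ ≤ ‖w k‖ * ‖u k v‖ := (w k).le_opNorm _
      _ ≤ _ := by
        gcongr
        linarith [hC k (Set.mem_univ _), le_abs_self C]
  refine ⟨fun v => B v v, ?_, by simp, fun k v => ?_, ((|C| + 1) ^ 2)⁻¹, by positivity, fun v => ?_⟩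
  · exact B.contDiff.clm_apply contDiff_id
  · simp only [hBv]
    have := integral_mul_left_eq_self (μ := μ) (fun t => ‖u t (ρ k v)‖ ^ 2) k
    rw [← this]
    refine integral_congr_ae (Filter.Eventually.of_forall fun t => ?_)
    have : ρ (k * t)⁻¹ (ρ k v) = ρ t⁻¹ v := by
      rw [← mul_apply_eq_comp, ← map_mul]; simp
    simp only [hu, ContinuousLinearMap.comp_apply, this]
  · simp only [hBv]
    have hle : ∀ k, ((|C| + 1) ^ 2)⁻¹ * ‖v‖ ^ 2 ≤ ‖u k v‖ ^ 2 := fun k => by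
      rw [inv_mul_le_iff₀ (by positivity), ← mul_pow]
      gcongr
      exact hlow k v
    calc ((|C| + 1) ^ 2)⁻¹ * ‖v‖ ^ 2 = ∫ _ : K, ((|C| + 1) ^ 2)⁻¹ * ‖v‖ ^ 2 ∂μ := by simp
      _ ≤ _ := by
        refine integral_mono (integrable_const _) ?_ hle
        exact ((huc.clm_apply continuous_const).norm.pow 2).integrable_of_compactSpace μ

end Averaging

/-! ### Linearization of a proper action around a point -/

section Charts

variable {E : Type*} [NormedAddCommGroup E] [NormedSpace ℝ E]
  {M : Type*} [TopologicalSpace M] [ChartedSpace E M]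

theorem trans_mem_maximalAtlas {κ : OpenPartialHomeomorph M E}
    (hκ : κ ∈ IsManifold.maximalAtlas 𝓘(ℝ, E) ∞ M) {e : OpenPartialHomeomorph E E}
    (he : ContDiffOn ℝ ∞ e e.source) (he' : ContDiffOn ℝ ∞ e.symm e.target) :
    κ ≫ₕ e ∈ IsManifold.maximalAtlas 𝓘(ℝ, E) ∞ M := by
  have hmem : e ∈ contDiffGroupoid ∞ 𝓘(ℝ, E) := by
    rw [contDiffGroupoid, mem_groupoid_of_pregroupoid]
    simpa [contDiffPregroupoid] using And.intro he he'
  rw [IsManifold.maximalAtlas, mem_maximalAtlas_iff] at hκ ⊢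
  intro e' he'
  obtain ⟨h1, h2⟩ := hκ e' he'
  constructor
  · rw [OpenPartialHomeomorph.trans_symm_eq_symm_trans_symm, OpenPartialHomeomorph.trans_assoc]
    exact StructureGroupoid.trans _ (StructureGroupoid.symm _ hmem) h1
  · rw [← OpenPartialHomeomorph.trans_assoc]
    exact StructureGroupoid.trans _ h2 hmem

theorem restr_mem_contDiff_maximalAtlas {κ : OpenPartialHomeomorph M E}
    (hκ : κ ∈ IsManifold.maximalAtlas 𝓘(ℝ, E) ∞ M) {s : Set M} (hs : IsOpen s) :
    κ.restr s ∈ IsManifold.maximalAtlas 𝓘(ℝ, E) ∞ M :=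
  restr_mem_maximalAtlas _ hκ hs

end Charts

section Linearization

variable {G : Type*} [TopologicalSpace G] [Group G]
  {E : Type*} [NormedAddCommGroup E] [NormedSpace ℝ E] [FiniteDimensional ℝ E]
  {M : Type*} [TopologicalSpace M] [ChartedSpace E M] [IsManifold 𝓘(ℝ, E) ∞ M]
  [MulAction G M]

theorem isCompact_stabilizer {G M : Type*} [TopologicalSpace G] [Group G] [TopologicalSpace M]
    [MulAction G M] [ProperSMul G M] (m : M) :
    IsCompact (MulAction.stabilizer G m : Set G) := by
  have := ProperSMul.isCompact_setOfPred_inter_nonempty (G := G) (isCompact_singleton (x := m))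
    (isCompact_singleton (x := m))
  convert this using 1
  ext g
  simp [eq_comm]

/-- The tube lemma. When `K` is a compact subgroup this set is `K`-invariant, so it provides
invariant domains for charts. -/
theorem isOpen_forall_smul_mem {G M : Type*} [TopologicalSpace G] [Group G] [TopologicalSpace M]
    [MulAction G M] [ContinuousSMul G M] {K : Set G} (hK : IsCompact K) {U : Set M}
    (hU : IsOpen U) : IsOpen {x : M | ∀ k ∈ K, k • x ∈ U} := by
  rw [isOpen_iff_mem_nhds]
  intro x hx
  refine hK.eventually_forall_of_forall_eventually fun k hk => ?_
  have hc : Continuous fun p : M × G => p.2 • p.1 := by fun_prop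
  exact hc.continuousAt.eventually_mem (hU.mem_nhds (hx k hk))

/-- Bochner's linearization theorem: around a point with compact isotropy group, the isotropy
group acts linearly in a suitable chart. -/
theorem exists_linearizing_chart (EG : Type*) [NormedAddCommGroup EG] [NormedSpace ℝ EG]
    [ChartedSpace EG G] [LieGroup 𝓘(ℝ, EG) ∞ G] [ContMDiffSMul 𝓘(ℝ, EG) 𝓘(ℝ, E) ∞ G M] (m : M)
    (hK : IsCompact (MulAction.stabilizer G m : Set G)) :
    ∃ κ ∈ IsManifold.maximalAtlas 𝓘(ℝ, E) ∞ M, m ∈ κ.source ∧ κ m = 0 ∧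
      ∃ ρ : MulAction.stabilizer G m →* (E →L[ℝ] E), Continuous ρ ∧
        ∀ k : MulAction.stabilizer G m, ∀ x ∈ κ.source,
          (k : G) • x ∈ κ.source ∧ κ ((k : G) • x) = ρ k (κ x) := by
  have : IsTopologicalGroup G := topologicalGroup_of_lieGroup 𝓘(ℝ, EG) ∞
  have : ContinuousSMul G M := 
    ContMDiffSMul.continuousSMul (I := 𝓘(ℝ, EG)) (I' := 𝓘(ℝ, E)) ∞
  have : CompactSpace (MulAction.stabilizer G m) := isCompact_iff_compactSpace.1 hK
  have hstab : ∀ k : MulAction.stabilizer G m, (k : G) • m = m := fun k => k.2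
  set ψ : OpenPartialHomeomorph M E := chartAt E m with hψ
  have hψA : ψ ∈ IsManifold.maximalAtlas 𝓘(ℝ, E) ∞ M := IsManifold.chart_mem_maximalAtlas m
  have hmψ : m ∈ ψ.source := mem_chart_source E m
  have hψm : ψ m ∈ ψ.target := ψ.map_source hmψ
  have hψs : ψ.symm (ψ m) = m := ψ.left_inv hmψ
  -- the action in the chart
  set a : G × E → E := fun p => ψ (p.1 • ψ.symm p.2) with ha
  set Ωa : Set (G × E) := (Set.univ ×ˢ ψ.target) ∩ (fun p => p.1 • ψ.symm p.2) ⁻¹' ψ.source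
    with hΩa
  have hact : ContMDiffOn (𝓘(ℝ, EG).prod 𝓘(ℝ, E)) 𝓘(ℝ, E) ∞
      (fun p : G × E => p.1 • ψ.symm p.2) (Set.univ ×ˢ ψ.target) := by
    refine ContMDiffOn.smul contMDiff_fst.contMDiffOn ?_
    exact (contMDiffOn_symm_of_mem_maximalAtlas hψA).comp contMDiff_snd.contMDiffOn
      fun p hp => hp.2
  have hΩao : IsOpen Ωa :=
    hact.continuousOn.isOpen_inter_preimage (isOpen_univ.prod ψ.open_target) ψ.open_source
  have haΩ : ContMDiffOn (𝓘(ℝ, EG).prod 𝓘(ℝ, E)) 𝓘(ℝ, E) ∞ a Ωa :=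
    (contMDiffOn_of_mem_maximalAtlas hψA).comp (hact.mono Set.inter_subset_left) fun p hp => hp.2
  have hkΩ : ∀ k : MulAction.stabilizer G m, ((k : G), ψ m) ∈ Ωa := fun k => by
    refine ⟨⟨trivial, hψm⟩, ?_⟩
    change (k : G) • ψ.symm (ψ m) ∈ ψ.source
    rw [hψs, hstab]; exact hmψ
  set D : G → (E →L[ℝ] E) := fun g => fderiv ℝ (fun w => a (g, w)) (ψ m) with hD
  have haD : ∀ k : MulAction.stabilizer G m, HasFDerivAt (fun w => a ((k : G), w)) (D k) (ψ m) := by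
    intro k
    have h1 := haΩ.contMDiffAt (hΩao.mem_nhds (hkΩ k))
    have h2 : ContMDiffAt 𝓘(ℝ, E) 𝓘(ℝ, E) ∞ (fun w => a ((k : G), w)) (ψ m) :=
      h1.comp (ψ m) (contMDiffAt_const.prodMk contMDiffAt_id)
    exact (h2.contDiffAt.differentiableAt (by simp)).hasFDerivAt
  have ha0 : ∀ k : MulAction.stabilizer G m, a ((k : G), ψ m) = ψ m := fun k => by
    simp only [ha, hψs, hstab]
  have hleft : ∀ᶠ w in 𝓝 (ψ m), w ∈ ψ.target := ψ.open_target.mem_nhds hψm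
  have hD1 : D 1 = 1 := by
    have h1 : HasFDerivAt (fun w => a (1, w)) (ContinuousLinearMap.id ℝ E) (ψ m) := by
      refine (hasFDerivAt_id (ψ m)).congr_of_eventuallyEq ?_
      filter_upwards [hleft] with w hw
      simp [ha, ψ.right_inv hw]
    exact h1.fderiv
  have hDmul : ∀ k l : MulAction.stabilizer G m, D ((k : G) * l) = D k * D l := by
    intro k l
    have h1 : HasFDerivAt (fun w => a ((k : G), a ((l : G), w))) (D k ∘L D l) (ψ m) := by
      refine HasFDerivAt.comp (ψ m) (g := fun w => a ((k : G), w)) ?_ (haD l)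
      rw [ha0]; exact haD k
    have h2 : HasFDerivAt (fun w => a ((k : G) * l, w)) (D k ∘L D l) (ψ m) := by
      refine h1.congr_of_eventuallyEq ?_
      have hc : ContinuousAt (fun w => ((l : G), w)) (ψ m) := by fun_prop
      filter_upwards [hc.eventually_mem (hΩao.mem_nhds (hkΩ l))] with w hw
      simp only [ha]
      rw [ψ.left_inv hw.2, mul_smul]
    exact h2.fderiv
  set ρ : MulAction.stabilizer G m →* (E →L[ℝ] E) :=
    { toFun := fun k => D k, map_one' := hD1, map_mul' := hDmul } with hρ
  have hρk : ∀ k : MulAction.stabilizer G m, ρ k = D k := fun k => rfl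
  have hDs := contMDiffOn_partial_fderiv hΩao haΩ
  have hρc : Continuous ρ :=
    hDs.continuousOn.comp_continuous (f := fun k : MulAction.stabilizer G m => ((k : G), ψ m))
      (by fun_prop) hkΩ
  -- the averaged chart
  borelize ↥(MulAction.stabilizer G m)
  obtain ⟨μ, _, _⟩ := exists_probabilityMeasure_isMulLeftInvariant (MulAction.stabilizer G m)
  set avg : M → E := fun x => ∫ k : MulAction.stabilizer G m, ρ k (ψ ((k : G)⁻¹ • x) - ψ m) ∂μ
    with havg
  have hequiv : ∀ (k : MulAction.stabilizer G m) x, avg ((k : G) • x) = ρ k (avg x) := by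
    intro k x
    set L : E ≃L[ℝ] E := ContinuousLinearEquiv.equivOfInverse (ρ k) (ρ k⁻¹)
      (fun v => by rw [← mul_apply_eq_comp, ← map_mul]; simp)
      (fun v => by rw [← mul_apply_eq_comp, ← map_mul]; simp) with hL
    have hLk : ∀ v, ρ k v = L v := fun v => rfl
    rw [hLk, havg]
    simp only
    rw [← L.integral_comp_comm]
    have := MeasureTheory.integral_mul_left_eq_self (μ := μ)
      (fun u : MulAction.stabilizer G m => ρ u (ψ ((u : G)⁻¹ • (k : G) • x) - ψ m)) k
    rw [← this]
    congr 1
    ext1 u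
    rw [← hLk, map_mul]
    simp [mul_smul]
  -- smoothness of the averaged chart
  set V : Set M := {x | ∀ k ∈ (MulAction.stabilizer G m : Set G), k • x ∈ ψ.source} with hV
  have hVo : IsOpen V := isOpen_forall_smul_mem hK ψ.open_source
  have hmV : m ∈ V := fun k hk => by
    have : k • m = m := hk
    rw [this]; exact hmψ
  have hVψ : V ⊆ ψ.source := fun x hx => by simpa using hx 1 (Subgroup.one_mem _)
  set V' : Set E := ψ.target ∩ ψ.symm ⁻¹' V with hV'
  have hV'o : IsOpen V' := ψ.symm.isOpen_inter_preimage hVo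
  have hmV' : ψ m ∈ V' := ⟨hψm, by simpa [hψs] using hmV⟩
  set F : G × E → E := fun p => D p.1 (a (p.1⁻¹, p.2) - ψ m) with hF
  set Ω : Set (G × E) := ((fun p => (p.1, ψ m)) ⁻¹' Ωa) ∩ ((fun p => (p.1⁻¹, p.2)) ⁻¹' Ωa) with hΩ
  have hΩo : IsOpen Ω := by
    refine IsOpen.inter (hΩao.preimage ?_) (hΩao.preimage ?_) <;> fun_prop
  have hFs : ContMDiffOn (𝓘(ℝ, EG).prod 𝓘(ℝ, E)) 𝓘(ℝ, E) ∞ F Ω := by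
    refine ContMDiffOn.clm_apply (g := fun p : G × E => D p.1)
      (f := fun p : G × E => a (p.1⁻¹, p.2) - ψ m) ?_ ?_
    · have h1 : ContMDiff (𝓘(ℝ, EG).prod 𝓘(ℝ, E)) (𝓘(ℝ, EG).prod 𝓘(ℝ, E)) ∞
          (fun p : G × E => (p.1, ψ m)) := contMDiff_fst.prodMk contMDiff_const
      exact hDs.comp h1.contMDiffOn fun p hp => hp.1
    · have h1 : ContMDiff (𝓘(ℝ, EG).prod 𝓘(ℝ, E)) (𝓘(ℝ, EG).prod 𝓘(ℝ, E)) ∞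
          (fun p : G × E => (p.1⁻¹, p.2)) := by
        refine ContMDiff.prodMk ?_ contMDiff_snd
        exact (contMDiff_inv 𝓘(ℝ, EG) ∞).comp contMDiff_fst
      exact (haΩ.comp h1.contMDiffOn fun p hp => hp.2).sub contMDiffOn_const
  have hVΩ : ∀ k : MulAction.stabilizer G m, ∀ v ∈ V', ((k : G), v) ∈ Ω := by
    intro k v hv
    refine ⟨hkΩ k, ⟨trivial, hv.1⟩, ?_⟩
    exact hv.2 _ (Subgroup.inv_mem _ k.2)
  have hfun : ∀ v, avg (ψ.symm v) = ∫ k : MulAction.stabilizer G m, F ((k : G), v) ∂μ :=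
    fun v => rfl
  have hsm : ContDiffOn ℝ ∞ (fun v => avg (ψ.symm v)) V' :=
    contDiffOn_integral_of_compactSpace μ continuous_subtype_val hV'o hΩo hVΩ hFs
  have hder : HasFDerivAt (fun v => avg (ψ.symm v))
      ((ContinuousLinearEquiv.refl ℝ E : E ≃L[ℝ] E) : E →L[ℝ] E) (ψ m) := by
    -- Every integrand has derivative D k ∘ D k⁻¹ = 1 at the fixed point, so the average has
    -- derivative 1 and is again a chart near `m`.
    have : ∀ k : MulAction.stabilizer G m, fderiv ℝ (fun w => F ((k : G), w)) (ψ m) =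
        ContinuousLinearMap.id ℝ E := by
      intro k
      have h1 : HasFDerivAt (fun w => F ((k : G), w)) (D k ∘L D (k⁻¹ : MulAction.stabilizer G m))
          (ψ m) :=
        (D k).hasFDerivAt.comp (ψ m) ((haD k⁻¹).sub_const (ψ m))
      rw [h1.fderiv]
      have := hDmul k k⁻¹
      simp only [InvMemClass.coe_inv, mul_inv_cancel] at this
      rw [hD1] at this
      exact this.symm
    have hd := hasFDerivAt_integral_of_compactSpace μ continuous_subtype_val hV'o hΩo hVΩ hFs hmV'
    rw [MeasureTheory.integral_congr_ae (Filter.Eventually.of_forall this)] at hd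
    simp only [MeasureTheory.integral_const, MeasureTheory.probReal_univ, one_smul] at hd
    exact hd
  obtain ⟨e, hme, heV', hef, hes, hes', -⟩ :=
    exists_openPartialHomeomorph_of_contDiffOn (by simp) hV'o hsm hmV' _ hder
  set κ₀ := ψ ≫ₕ e with hκ₀
  have hκ₀A := trans_mem_maximalAtlas hψA hes hes'
  have hκ₀s : κ₀.source = ψ.source ∩ ψ ⁻¹' e.source := ψ.trans_source e
  have hκ₀x : ∀ x ∈ κ₀.source, κ₀ x = avg x := by
    intro x hx
    rw [hκ₀s] at hx
    change e (ψ x) = avg x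
    rw [hef, ψ.left_inv hx.1]
  -- The largest subset of the chart domain that is invariant under the isotropy group.
  set O : Set M := {x | ∀ k ∈ (MulAction.stabilizer G m : Set G), k • x ∈ κ₀.source} with hO
  have hOo : IsOpen O := isOpen_forall_smul_mem hK κ₀.open_source
  have hOκ : O ⊆ κ₀.source := fun x hx => by simpa using hx 1 (Subgroup.one_mem _)
  have hmκ₀ : m ∈ κ₀.source := by
    rw [hκ₀s]; exact ⟨hmψ, hme⟩
  have hmO : m ∈ O := fun k hk => by
    have : k • m = m := hk
    rw [this]; exact hmκ₀
  have hsrc : (κ₀.restr O).source = O := by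
    rw [OpenPartialHomeomorph.restr_source' _ _ hOo, Set.inter_eq_right]
    exact hOκ
  refine ⟨κ₀.restr O, restr_mem_contDiff_maximalAtlas hκ₀A hOo, ?_, ?_, ρ, hρc, ?_⟩
  · rw [hsrc]; exact hmO
  · change κ₀ m = 0
    rw [hκ₀x m hmκ₀, havg]
    have : ∀ k : MulAction.stabilizer G m, (k : G)⁻¹ • m = m := fun k => by
      have := hstab k⁻¹
      simpa using this
    simp [this]
  · intro k x hx
    rw [hsrc] at hx ⊢
    have hkx : (k : G) • x ∈ O := fun l hl => by
      rw [← mul_smul]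
      exact hx _ (Subgroup.mul_mem _ hl k.2)
    refine ⟨hkx, ?_⟩
    change κ₀ ((k : G) • x) = ρ k (κ₀ x)
    rw [hκ₀x _ (hOκ hkx), hκ₀x _ (hOκ hx), hequiv]

end Linearization

/-! ### The orbit map in coordinates -/

section OrbitMap

variable {EG : Type*} [NormedAddCommGroup EG] [NormedSpace ℝ EG]
  {G : Type*} [TopologicalSpace G] [ChartedSpace EG G] [Group G] [LieGroup 𝓘(ℝ, EG) ∞ G]
  {E : Type*} [NormedAddCommGroup E] [NormedSpace ℝ E]
  {M : Type*} [TopologicalSpace M] [ChartedSpace E M] [IsManifold 𝓘(ℝ, E) ∞ M]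
  [MulAction G M] [ContMDiffSMul 𝓘(ℝ, EG) 𝓘(ℝ, E) ∞ G M]

/-- Every point has coordinate `0` in a suitable chart. -/
theorem exists_chart_eq_zero {E M : Type*} [NormedAddCommGroup E] [NormedSpace ℝ E]
    [TopologicalSpace M] [ChartedSpace E M] [IsManifold 𝓘(ℝ, E) ∞ M] (x : M) :
    ∃ κ ∈ IsManifold.maximalAtlas 𝓘(ℝ, E) ∞ M, x ∈ κ.source ∧ κ x = 0 := by
  refine ⟨chartAt E x ≫ₕ (Homeomorph.addRight (-(chartAt E x x))).toOpenPartialHomeomorph,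
    trans_mem_maximalAtlas (IsManifold.chart_mem_maximalAtlas x) ?_ ?_, ?_, ?_⟩
  · have : ContDiff ℝ ∞ fun v : E => v + -(chartAt E x x) := by fun_prop
    exact this.contDiffOn
  · have : ContDiff ℝ ∞ fun v : E => v + - -(chartAt E x x) := by fun_prop
    exact this.contDiffOn
  · simp
  · simp

/-- The orbit map of the point `x`, in the charts `l` and `κ`. -/
def orbitCoord (l : OpenPartialHomeomorph G EG) (κ : OpenPartialHomeomorph M E) (x : M) (ξ : EG) :
    E :=
  κ (l.symm ξ • x)

variable {l : OpenPartialHomeomorph G EG} {κ κ' : OpenPartialHomeomorph M E} {x : M}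

theorem contDiffAt_chart_smul (EG : Type*) [NormedAddCommGroup EG] [NormedSpace ℝ EG]
    [ChartedSpace EG G] [ContMDiffSMul 𝓘(ℝ, EG) 𝓘(ℝ, E) ∞ G M]
    (hκ : κ ∈ IsManifold.maximalAtlas 𝓘(ℝ, E) ∞ M)
    (hκ' : κ' ∈ IsManifold.maximalAtlas 𝓘(ℝ, E) ∞ M) (g : G) {v : E} (hv : v ∈ κ.target)
    (hgv : g • κ.symm v ∈ κ'.source) : ContDiffAt ℝ ∞ (fun w => κ' (g • κ.symm w)) v := by
  have h1 := contMDiffAt_symm_of_mem_maximalAtlas hκ hv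
  have h2 : ContMDiffAt 𝓘(ℝ, E) 𝓘(ℝ, E) ∞ (fun w => g • κ.symm w) v :=
    ((ContMDiffSMul.contMDiff_const_smul (I := 𝓘(ℝ, EG)) g).contMDiffAt).comp v h1
  exact ((contMDiffAt_of_mem_maximalAtlas hκ' hgv).comp v h2).contDiffAt

theorem contMDiffAt_orbit (hl : l ∈ IsManifold.maximalAtlas 𝓘(ℝ, EG) ∞ G) {ξ : EG}
    (hξ : ξ ∈ l.target) (x : M) :
    ContMDiffAt 𝓘(ℝ, EG) 𝓘(ℝ, E) ∞ (fun ξ => l.symm ξ • x) ξ :=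
  ContMDiffAt.smul (contMDiffAt_symm_of_mem_maximalAtlas hl hξ) contMDiffAt_const

theorem contDiffAt_orbitCoord (hl : l ∈ IsManifold.maximalAtlas 𝓘(ℝ, EG) ∞ G)
    (hκ : κ ∈ IsManifold.maximalAtlas 𝓘(ℝ, E) ∞ M) {ξ : EG} (hξ : ξ ∈ l.target)
    (hx : l.symm ξ • x ∈ κ.source) : ContDiffAt ℝ ∞ (orbitCoord l κ x) ξ :=
  ((contMDiffAt_of_mem_maximalAtlas hκ hx).comp ξ (contMDiffAt_orbit hl hξ x)).contDiffAt

theorem contDiffAt_chart_mul_mul (hl : l ∈ IsManifold.maximalAtlas 𝓘(ℝ, EG) ∞ G) (a b : G)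
    {ξ : EG} (hξ : ξ ∈ l.target) (h : a * l.symm ξ * b ∈ l.source) :
    ContDiffAt ℝ ∞ (fun θ => l (a * l.symm θ * b)) ξ := by
  have h1 := contMDiffAt_symm_of_mem_maximalAtlas hl hξ
  have h2 : ContMDiffAt 𝓘(ℝ, EG) 𝓘(ℝ, EG) ∞ (fun θ => a * l.symm θ * b) ξ :=
    (contMDiffAt_const.mul h1).mul contMDiffAt_const
  exact ((contMDiffAt_of_mem_maximalAtlas hl h).comp ξ h2).contDiffAt

/-- The rank of the orbit map is the same along an orbit. -/
theorem finrank_range_fderiv_orbitCoord_le [FiniteDimensional ℝ EG] [FiniteDimensional ℝ E]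
    (hl : l ∈ IsManifold.maximalAtlas 𝓘(ℝ, EG) ∞ G) (hl1 : (1 : G) ∈ l.source) (hl0 : l 1 = 0)
    (hκ : κ ∈ IsManifold.maximalAtlas 𝓘(ℝ, E) ∞ M)
    (hκ' : κ' ∈ IsManifold.maximalAtlas 𝓘(ℝ, E) ∞ M) (hx : x ∈ κ.source) (a : G) {ξ : EG}
    (hξ : ξ ∈ l.target) (hax : l.symm ξ • a • x ∈ κ'.source) :
    Module.finrank ℝ (fderiv ℝ (orbitCoord l κ' (a • x)) ξ : EG →ₗ[ℝ] E).range ≤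
      Module.finrank ℝ (fderiv ℝ (orbitCoord l κ x) 0 : EG →ₗ[ℝ] E).range := by
  have : IsTopologicalGroup G := topologicalGroup_of_lieGroup 𝓘(ℝ, EG) ∞
  have : ContinuousSMul G M :=
    ContMDiffSMul.continuousSMul (I := 𝓘(ℝ, EG)) (I' := 𝓘(ℝ, E)) ∞
  set g := l.symm ξ with hg
  have hl00 : l.symm 0 = 1 := by rw [← hl0, l.left_inv hl1]
  have h0t : (0 : EG) ∈ l.target := hl0 ▸ l.map_source hl1
  -- For h near g one has h a x = (g a) (a⁻¹ g⁻¹ h a) x. The orbit map of `a • x` near `ξ` is thus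
  -- that of `x` near 0, reparametrized by `τ` and followed by the translation by `g * a`.
  -- Composition does not raise the rank.
  set τ : EG → EG := fun θ => l (a⁻¹ * g⁻¹ * l.symm θ * a) with hτ
  have hone : a⁻¹ * g⁻¹ * l.symm ξ * a = 1 := by rw [← hg]; group
  have hτξ : τ ξ = 0 := by simp only [hτ, hone, hl0]
  have hτd := contDiffAt_chart_mul_mul hl (a⁻¹ * g⁻¹) a hξ (by rw [hone]; exact hl1)
  have hτ' : HasFDerivAt τ (fderiv ℝ τ ξ) ξ := (hτd.differentiableAt (by simp)).hasFDerivAt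
  have hAd : HasFDerivAt (orbitCoord l κ x) (fderiv ℝ (orbitCoord l κ x) 0) (τ ξ) := by
    rw [hτξ]
    exact ((contDiffAt_orbitCoord hl hκ h0t (by simpa [hl00])).differentiableAt
      (by simp)).hasFDerivAt
  have hcx : orbitCoord l κ x (τ ξ) = κ x := by simp [orbitCoord, hτξ, hl00]
  have hX : HasFDerivAt (fun w => κ' ((g * a) • κ.symm w))
      (fderiv ℝ (fun w => κ' ((g * a) • κ.symm w)) (κ x)) (orbitCoord l κ x (τ ξ)) := by
    rw [hcx]
    refine ((contDiffAt_chart_smul EG hκ hκ' (g * a) (κ.map_source hx)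
      ?_).differentiableAt (by simp)).hasFDerivAt
    rw [κ.left_inv hx, mul_smul]; exact hax
  have hcomp := hX.comp ξ (hAd.comp ξ hτ')
  have hcont : ContinuousAt (fun θ => a⁻¹ * g⁻¹ * l.symm θ * a) ξ :=
    (continuousAt_const.mul (l.continuousAt_symm hξ)).mul continuousAt_const
  have hev : orbitCoord l κ' (a • x) =ᶠ[𝓝 ξ]
      (fun w => κ' ((g * a) • κ.symm w)) ∘ (orbitCoord l κ x ∘ τ) := by
    have e1 : ∀ᶠ θ in 𝓝 ξ, a⁻¹ * g⁻¹ * l.symm θ * a ∈ l.source := by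
      apply hcont.eventually_mem
      rw [hone]; exact l.open_source.mem_nhds hl1
    have e2 : ∀ᶠ θ in 𝓝 ξ, (a⁻¹ * g⁻¹ * l.symm θ * a) • x ∈ κ.source := by
      have : ContinuousAt (fun θ => (a⁻¹ * g⁻¹ * l.symm θ * a) • x) ξ :=
        hcont.smul continuousAt_const
      apply this.eventually_mem
      rw [hone, one_smul]; exact κ.open_source.mem_nhds hx
    filter_upwards [e1, e2] with θ h1 h2
    simp only [orbitCoord, Function.comp_apply, hτ]
    rw [l.left_inv h1, κ.left_inv h2, ← mul_smul, ← mul_smul]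
    congr 2
    group
  rw [(hcomp.congr_of_eventuallyEq hev).fderiv]
  set L := fderiv ℝ (orbitCoord l κ x) 0
  set Y := fderiv ℝ (fun w => κ' ((g * a) • κ.symm w)) (κ x)
  set R := fderiv ℝ τ ξ
  have hle : ((Y ∘L (L ∘L R) : EG →L[ℝ] E) : EG →ₗ[ℝ] E).range ≤
      ((L : EG →ₗ[ℝ] E).range).map (Y : E →ₗ[ℝ] E) := by
    rintro _ ⟨v, rfl⟩
    exact ⟨L (R v), ⟨R v, rfl⟩, rfl⟩
  exact (Submodule.finrank_mono hle).trans (Submodule.finrank_map_le _ _)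

/-- The tangent space of the orbit is invariant under the isotropy representation. -/
theorem map_mem_range_fderiv_orbitCoord
    (hl : l ∈ IsManifold.maximalAtlas 𝓘(ℝ, EG) ∞ G) (hl1 : (1 : G) ∈ l.source) (hl0 : l 1 = 0)
    (hκ : κ ∈ IsManifold.maximalAtlas 𝓘(ℝ, E) ∞ M) (hx : x ∈ κ.source)
    {k : G} (hk : k • x = x) {L : E →L[ℝ] E} (hL : ∀ y ∈ κ.source, κ (k • y) = L (κ y))
    {v : E} (hv : v ∈ (fderiv ℝ (orbitCoord l κ x) 0 : EG →ₗ[ℝ] E).range) :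
    L v ∈ (fderiv ℝ (orbitCoord l κ x) 0 : EG →ₗ[ℝ] E).range := by
  have : IsTopologicalGroup G := topologicalGroup_of_lieGroup 𝓘(ℝ, EG) ∞
  have : ContinuousSMul G M :=
    ContMDiffSMul.continuousSMul (I := 𝓘(ℝ, EG)) (I' := 𝓘(ℝ, E)) ∞
  obtain ⟨ξ, rfl⟩ := hv
  have hl00 : l.symm 0 = 1 := by rw [← hl0, l.left_inv hl1]
  have h0t : (0 : EG) ∈ l.target := hl0 ▸ l.map_source hl1
  have hone : k * l.symm 0 * k⁻¹ = 1 := by rw [hl00]; group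
  -- Since k x = x, one has k g x = (k g k⁻¹) x, so the action of `k` on the orbit is conjugation
  -- upstairs.
  set τ : EG → EG := fun θ => l (k * l.symm θ * k⁻¹) with hτ
  have hτ0 : τ 0 = 0 := by simp only [hτ, hone, hl0]
  have hτ' : HasFDerivAt τ (fderiv ℝ τ 0) 0 :=
    ((contDiffAt_chart_mul_mul hl k k⁻¹ h0t (by rw [hone]; exact hl1)).differentiableAt
      (by simp)).hasFDerivAt
  have hA : HasFDerivAt (orbitCoord l κ x) (fderiv ℝ (orbitCoord l κ x) 0) 0 :=
    ((contDiffAt_orbitCoord hl hκ h0t (by simpa [hl00])).differentiableAt (by simp)).hasFDerivAt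
  have h1 := L.hasFDerivAt.comp 0 hA
  have h2 := (show HasFDerivAt (orbitCoord l κ x) (fderiv ℝ (orbitCoord l κ x) 0) (τ 0) by
    rwa [hτ0]).comp 0 hτ'
  have hcont : ContinuousAt (fun θ => k * l.symm θ * k⁻¹) 0 :=
    (continuousAt_const.mul (l.continuousAt_symm h0t)).mul continuousAt_const
  have hev : L ∘ orbitCoord l κ x =ᶠ[𝓝 0] orbitCoord l κ x ∘ τ := by
    have e1 : ∀ᶠ θ in 𝓝 (0 : EG), k * l.symm θ * k⁻¹ ∈ l.source := by
      apply hcont.eventually_mem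
      rw [hone]; exact l.open_source.mem_nhds hl1
    have e2 : ∀ᶠ θ in 𝓝 (0 : EG), l.symm θ • x ∈ κ.source := by
      have : ContinuousAt (fun θ => l.symm θ • x) 0 :=
        (l.continuousAt_symm h0t).smul continuousAt_const
      apply this.eventually_mem
      rw [hl00, one_smul]; exact κ.open_source.mem_nhds hx
    filter_upwards [e1, e2] with θ h1 h2
    simp only [orbitCoord, Function.comp_apply, hτ]
    rw [l.left_inv h1, ← hL _ h2]
    simp only [mul_smul]
    rw [inv_smul_eq_iff.2 hk.symm]
  have h3 := h1.unique (h2.congr_of_eventuallyEq hev)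
  exact ⟨fderiv ℝ τ 0 ξ, (DFunLike.congr_fun h3 ξ).symm⟩

/-- Supplies `B` for the constant rank theorem. The normalization `B ∘L P = B` makes `B` see only
the component along the range of `A`. -/
theorem exists_section_of_projection {V W : Type*} [NormedAddCommGroup V] [NormedSpace ℝ V]
    [FiniteDimensional ℝ V] [NormedAddCommGroup W] [NormedSpace ℝ W] [FiniteDimensional ℝ W]
    (A : V →L[ℝ] W) (P : W →L[ℝ] W) (hP : ∀ w, P w ∈ (A : V →ₗ[ℝ] W).range)
    (hPv : ∀ w ∈ (A : V →ₗ[ℝ] W).range, P w = w) :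
    ∃ B : W →L[ℝ] V, A ∘L B = P ∧ B ∘L P = B := by
  obtain ⟨s, hs⟩ := LinearMap.exists_rightInverse_of_surjective
    (A : V →ₗ[ℝ] W).rangeRestrict (LinearMap.range_rangeRestrict _)
  set B : W →ₗ[ℝ] V := s ∘ₗ (P : W →ₗ[ℝ] W).codRestrict (A : V →ₗ[ℝ] W).range hP with hB
  refine ⟨LinearMap.toContinuousLinearMap B, ?_, ?_⟩
  · ext w
    have := congrArg Subtype.val (DFunLike.congr_fun hs ⟨P w, hP w⟩)
    exact this
  · ext w
    change B (P w) = B w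
    simp only [hB, LinearMap.comp_apply]
    congr 1
    ext
    exact hPv _ (hP w)

/-- The structure of the orbit map near `1`: the orbit is locally swept out by a section of its
derivative, and the isotropy group is locally swept out by curves. -/
theorem orbit_local_structure [FiniteDimensional ℝ EG] [FiniteDimensional ℝ E]
    (hl : l ∈ IsManifold.maximalAtlas 𝓘(ℝ, EG) ∞ G) (hl1 : (1 : G) ∈ l.source) (hl0 : l 1 = 0)
    (hκ : κ ∈ IsManifold.maximalAtlas 𝓘(ℝ, E) ∞ M) (hx : x ∈ κ.source) (hκ0 : κ x = 0)
    {P : E →L[ℝ] E} {B : E →L[ℝ] EG}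
    (hPv : ∀ w ∈ (fderiv ℝ (orbitCoord l κ x) 0 : EG →ₗ[ℝ] E).range, P w = w)
    (hAB : fderiv ℝ (orbitCoord l κ x) 0 ∘L B = P) (hBP : B ∘L P = B) :
    (∀ ε > 0, ∀ᶠ g in 𝓝 (1 : G), ∃ v, P v = v ∧ ‖v‖ < ε ∧ B v ∈ l.target ∧
      g • x = l.symm (B v) • x) ∧
    (∀ W ∈ 𝓝 (0 : EG), ∀ᶠ g in 𝓝 (1 : G), g • x = x → ∃ c : ℝ → EG, c 0 = 0 ∧
      l.symm (c 1) = g ∧ ∀ t ∈ Set.Icc (0 : ℝ) 1, c t ∈ W ∧ c t ∈ l.target ∧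
        DifferentiableAt ℝ c t ∧ ∀ᶠ s in 𝓝 t, l.symm (c s) • x = x) ∧
    (∀ ξ, fderiv ℝ (orbitCoord l κ x) 0 ξ = 0 → ∃ c : ℝ → EG, c 0 = 0 ∧ HasDerivAt c ξ 0 ∧
      ∀ᶠ t in 𝓝 0, l.symm (c t) • x = x) := by
  have : IsTopologicalGroup G := topologicalGroup_of_lieGroup 𝓘(ℝ, EG) ∞
  have : ContinuousSMul G M :=
    ContMDiffSMul.continuousSMul (I := 𝓘(ℝ, EG)) (I' := 𝓘(ℝ, E)) ∞
  have hl00 : l.symm 0 = 1 := by rw [← hl0, l.left_inv hl1]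
  have h0t : (0 : EG) ∈ l.target := hl0 ▸ l.map_source hl1
  set A := fderiv ℝ (orbitCoord l κ x) 0 with hAdef
  set U : Set EG := l.target ∩ (fun ξ => l.symm ξ • x) ⁻¹' κ.source with hU
  have hUo : IsOpen U := by
    refine ContinuousOn.isOpen_inter_preimage (fun ξ hξ => ?_) l.open_target κ.open_source
    exact (contMDiffAt_orbit (E := E) hl hξ x).continuousAt.continuousWithinAt
  have h0U : (0 : EG) ∈ U := ⟨h0t, by simpa [hl00]⟩
  have hh : ContDiffOn ℝ 1 (orbitCoord l κ x) U := fun ξ hξ =>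
    ((contDiffAt_orbitCoord hl hκ hξ.1 hξ.2).of_le (by exact_mod_cast le_top)).contDiffWithinAt
  have hh0 : orbitCoord l κ x 0 = 0 := by simp [orbitCoord, hl00, hκ0]
  have hA : HasFDerivAt (orbitCoord l κ x) A 0 :=
    ((hh.contDiffAt (hUo.mem_nhds h0U)).differentiableAt one_ne_zero).hasFDerivAt
  have hrank : ∀ ξ ∈ U, Module.finrank ℝ (fderiv ℝ (orbitCoord l κ x) ξ : EG →ₗ[ℝ] E).range ≤
      Module.finrank ℝ (A : EG →ₗ[ℝ] E).range := by
    intro ξ hξ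
    have := finrank_range_fderiv_orbitCoord_le hl hl1 hl0 hκ hκ hx 1 hξ.1
      (by rw [one_smul]; exact hξ.2)
    rwa [one_smul] at this
  have hPA : P ∘L A = A := by
    ext v
    exact hPv _ ⟨v, rfl⟩
  have hAB' : ∀ w, A (B w) = P w := DFunLike.congr_fun hAB
  have hPA' : ∀ v, P (A v) = A v := DFunLike.congr_fun hPA
  have hBP' : ∀ w, B (P w) = B w := DFunLike.congr_fun hBP
  obtain ⟨e, r, hr, h0e, heU, hef, het, hes, hed, hee⟩ :=
    exists_straightening hUo h0U hh hh0 hA hrank hPA hAB hBP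
  have he0 : e 0 = 0 := by simp [hef, hh0]
  have hes0 : e.symm 0 = 0 := by
    have := e.left_inv h0e; rwa [he0] at this
  have h0et : (0 : EG) ∈ e.target := he0 ▸ e.map_source h0e
  -- group elements close to `1` in coordinates
  have hlnear : ∀ {p : EG → Prop}, (∀ᶠ ξ in 𝓝 0, p ξ) →
      ∀ᶠ g in 𝓝 (1 : G), g ∈ l.source ∧ p (l g) := by
    intro p hp
    have hc := (l.continuousAt hl1).tendsto
    rw [hl0] at hc
    exact (l.open_source.mem_nhds hl1 |> fun h => (Filter.eventually_mem_set.2 h)).and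
      (hc.eventually hp)
  have hec : ContinuousAt e 0 := e.continuousAt h0e
  have hesc : ContinuousAt e.symm 0 := e.continuousAt_symm h0et
  have heinj : ∀ ξ ∈ U, orbitCoord l κ x ξ = 0 → l.symm ξ • x = x := by
    intro ξ hξ h0
    exact κ.injOn hξ.2 hx (by rw [hκ0]; exact h0)
  -- In the straightened coordinates the isotropy group near 1 is the kernel of `A`. This gives the
  -- second and third claims.
  have hkerh : ∀ η ∈ e.target, A η = 0 → orbitCoord l κ x (e.symm η) = 0 := by
    intro η hη hAη
    rw [hee η hη, hAη, map_zero, hes0, hh0]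
  refine ⟨fun ε hε => ?_, fun W hW => ?_, fun ξ hξ => ?_⟩
  -- Sliding `ξ` along its fibre to `e.symm (B (A (e ξ)))` does not change the orbit point and lands
  -- in the range of `B`.
  · have hret : Filter.Tendsto (fun ξ => A (e.symm (B (A (e ξ))))) (𝓝 0) (𝓝 0) := by
      have h1 : ContinuousAt (fun ξ => B (A (e ξ))) 0 := by fun_prop
      have h2 : ContinuousAt (fun ξ => e.symm (B (A (e ξ)))) 0 := by
        refine ContinuousAt.comp (g := e.symm) ?_ h1
        simpa [he0] using hesc
      have h3 : ContinuousAt (fun ξ => A (e.symm (B (A (e ξ))))) 0 := by fun_prop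
      have := h3.tendsto
      simpa [he0, hes0] using this
    have hev : ∀ᶠ ξ in 𝓝 (0 : EG), ξ ∈ e.source ∧ ‖A (e.symm (B (A (e ξ))))‖ < ε :=
      (Filter.eventually_mem_set.2 (e.open_source.mem_nhds h0e)).and
        (hret.norm.eventually_lt_const (by simpa using hε))
    filter_upwards [hlnear hev] with g ⟨hgs, hge, hgε⟩
    have hgt := e.map_source hge
    have hmem : B (A (e (l g))) ∈ e.target := by
      rw [het] at hgt ⊢
      refine ⟨?_, ?_⟩
      · rw [hAB', hPA']; exact hgt.1
      · rw [hAB', hPA', sub_self, norm_zero]; exact hr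
    set ξ' := e.symm (B (A (e (l g)))) with hξ'
    have h1 : e ξ' = B (A (e (l g))) := e.right_inv hmem
    have h2 : B (A ξ') = ξ' := by
      have h3 := congrArg A h1
      rw [hef] at h3 h1
      simp only [map_add, map_sub, hAB', hPA'] at h3
      have hPP : ∀ w, P (P w) = P w := fun w => by
        rw [← hAB' w, hPA']
      rw [hPP, sub_self, add_zero] at h3
      have h4 := congrArg B h3
      rw [hBP'] at h4
      rw [hBP', ← h4] at h1
      have := add_eq_left.1 h1
      exact (sub_eq_zero.1 this).symm
    have hξ'U : ξ' ∈ U := heU (e.map_target hmem)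
    refine ⟨A ξ', hPA' _, hgε, by rw [h2]; exact hξ'U.1, ?_⟩
    rw [h2]
    have h5 := hee _ hgt
    rw [e.left_inv hge] at h5
    have hgU := heU hge
    have h6 := κ.injOn hgU.2 hξ'U.2 h5
    simpa only [l.left_inv hgs] using h6
  · have hev : ∀ᶠ ξ in 𝓝 (0 : EG), ξ ∈ e.source ∧ ∀ t ∈ Set.Icc (0 : ℝ) 1, e.symm (t • e ξ) ∈ W := by
      refine (Filter.eventually_mem_set.2 (e.open_source.mem_nhds h0e)).and ?_
      refine isCompact_Icc.eventually_forall_of_forall_eventually fun t _ => ?_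
      have h1 : ContinuousAt (fun p : EG × ℝ => p.2 • e p.1) (0, t) :=
        continuousAt_snd.smul (hec.comp_of_eq continuousAt_fst rfl)
      have h2 : ContinuousAt (fun p : EG × ℝ => e.symm (p.2 • e p.1)) (0, t) := by
        refine ContinuousAt.comp (g := e.symm) ?_ h1
        simpa [he0] using hesc
      apply h2.eventually_mem
      simpa [he0, hes0] using hW
    filter_upwards [hlnear hev] with g ⟨hgs, hge, hgW⟩ hgx
    have hgt := e.map_source hge
    have hgU := heU hge
    have hg0 : orbitCoord l κ x (l g) = 0 := by
      simp [orbitCoord, l.left_inv hgs, hgx, hκ0]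
    -- For `g` in the isotropy group, `e (l g)` lies in the kernel of `A`. The radial segment to it
    -- stays in the kernel and gives a curve in the isotropy group.
    have hAe : A (e (l g)) = 0 := by
      have := congrArg A (hef (l g))
      simpa [hg0, hAB', hPA'] using this
    have htm : ∀ t ∈ Set.Icc (0 : ℝ) 1, t • e (l g) ∈ e.target := by
      intro t ht
      rw [het] at hgt ⊢
      refine ⟨by simp [hAe, hr], ?_⟩
      simp only [map_smul, hAe, map_zero, smul_zero, sub_zero, norm_smul]
      have h1 := hgt.2
      rw [hAe, map_zero, sub_zero] at h1
      calc ‖t‖ * ‖e (l g)‖ ≤ 1 * ‖e (l g)‖ := by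
            gcongr; rw [Real.norm_of_nonneg ht.1]; exact ht.2
        _ < r := by rwa [one_mul]
    refine ⟨fun t => e.symm (t • e (l g)), by simp [hes0], ?_, fun t ht => ⟨hgW t ht, ?_, ?_, ?_⟩⟩
    · simp [e.left_inv hge, l.left_inv hgs]
    · exact (heU (e.map_target (htm t ht))).1
    · have h1 : DifferentiableAt ℝ e.symm (t • e (l g)) :=
        (hes.contDiffAt (e.open_target.mem_nhds (htm t ht))).differentiableAt one_ne_zero
      exact h1.comp t (by fun_prop)
    · have hc : ContinuousAt (fun s : ℝ => s • e (l g)) t := by fun_prop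
      filter_upwards [hc.eventually_mem (e.open_target.mem_nhds (htm t ht))] with s hs
      exact heinj _ (heU (e.map_target hs)) (hkerh _ hs (by simp [hAe]))
  -- The curve has velocity `ξ` because `e.symm` has derivative 1 at 0.
  · refine ⟨fun t => e.symm (t • ξ), by simp [hes0], ?_, ?_⟩
    · have h1 : HasDerivAt (fun t : ℝ => t • ξ) ξ 0 := by
        simpa using (hasDerivAt_id (0 : ℝ)).smul_const ξ
      have := (show HasFDerivAt e.symm (ContinuousLinearMap.id ℝ EG) ((0 : ℝ) • ξ) by
        rwa [zero_smul]).comp_hasDerivAt (0 : ℝ) h1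
      exact this
    · have hc : ContinuousAt (fun s : ℝ => s • ξ) 0 := by fun_prop
      filter_upwards [hc.eventually_mem (e.open_target.mem_nhds (by simpa using h0et))] with s hs
      exact heinj _ (heU (e.map_target hs)) (hkerh _ hs (by simp [hξ]))

end OrbitMap

/-! ### Conjugate isotropy groups contained in each other are equal -/

/-- An injective continuous endomorphism of a compact group with open identity component is
surjective if its range is open. -/
theorem surjective_of_injective_of_isOpen_range {K : Type*} [Group K] [TopologicalSpace K]
    [IsTopologicalGroup K] [CompactSpace K] [T2Space K] (hK : connectedComponent (1 : K) ∈ 𝓝 1)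
    (α : K →* K) (hα : Continuous α) (hinj : Function.Injective α)
    (hrange : (α.range : Set K) ∈ 𝓝 1) : Function.Surjective α := by
  set N := Subgroup.connectedComponentOfOne K with hN
  have hNc : (N : Set K) = connectedComponent (1 : K) := rfl
  have hNo : IsOpen (N : Set K) := Subgroup.isOpen_of_mem_nhds N (g := 1) (by rwa [hNc])
  have hRo : IsOpen (α.range : Set K) := Subgroup.isOpen_of_mem_nhds α.range (g := 1) hrange
  have hRc : IsClosed (α.range : Set K) := Subgroup.isClosed_of_isOpen _ hRo
  -- An open subgroup is closed, so it contains the identity component `N`.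
  have hNR : (N : Set K) ⊆ α.range :=
    IsClopen.connectedComponent_subset ⟨hRc, hRo⟩ (Subgroup.one_mem _)
  have h1 : ∀ k, k ∈ N → α k ∈ N := by
    intro k hk
    have := hα.image_connectedComponent_subset 1 ⟨k, hk, rfl⟩
    rwa [map_one] at this
  -- By compactness `α` is an embedding. It maps the preimage of `N` homeomorphically onto `N`, so
  -- this preimage is connected and contained in `N`.
  have hpre : IsPreconnected (α ⁻¹' (N : Set K)) := by
    have hind : Topology.IsInducing α :=
      (hα.isClosedEmbedding hinj).isInducing
    rw [← hind.isPreconnected_image, Set.image_preimage_eq_inter_range]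
    have : (N : Set K) ∩ Set.range α = N := Set.inter_eq_left.2 fun x hx => by
      obtain ⟨y, hy⟩ := hNR hx
      exact ⟨y, hy⟩
    rw [this]
    exact isPreconnected_connectedComponent
  have h2 : ∀ k, α k ∈ N → k ∈ N := by
    intro k hk
    exact hpre.subset_connectedComponent (x := 1)
      (by rw [Set.mem_preimage, map_one]; exact N.one_mem) hk
  have hfin : Finite (K ⧸ N) := Subgroup.quotient_finite_of_isOpen N hNo
  -- The induced map on the finite set of components is injective, hence surjective. What remains of
  -- an element lies in `N`, which is in the range.
  set f : K ⧸ N → K ⧸ N := Quotient.map' α (fun a b hab => by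
    rw [QuotientGroup.leftRel_apply] at hab ⊢
    rw [← map_inv, ← map_mul]
    exact h1 _ hab) with hf
  have hfk : ∀ k : K, f (k : K ⧸ N) = ((α k : K) : K ⧸ N) := fun k => rfl
  have hfinj : Function.Injective f := by
    intro a b hab
    obtain ⟨a, rfl⟩ := QuotientGroup.mk_surjective a
    obtain ⟨b, rfl⟩ := QuotientGroup.mk_surjective b
    rw [hfk, hfk, QuotientGroup.eq] at hab
    rw [QuotientGroup.eq]
    refine h2 _ ?_
    rwa [map_mul, map_inv]
  have hfsurj := Finite.injective_iff_surjective.1 hfinj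
  intro k
  obtain ⟨a, ha⟩ := hfsurj (k : K ⧸ N)
  obtain ⟨a, rfl⟩ := QuotientGroup.mk_surjective a
  rw [hfk, QuotientGroup.eq] at ha
  obtain ⟨b, hb⟩ := hNR ha
  exact ⟨a * b, by rw [map_mul, hb, mul_inv_cancel_left]⟩

section Isotropy

variable {EG : Type*} [NormedAddCommGroup EG] [NormedSpace ℝ EG] [FiniteDimensional ℝ EG]
  {G : Type*} [TopologicalSpace G] [ChartedSpace EG G] [Group G] [LieGroup 𝓘(ℝ, EG) ∞ G]
  {E : Type*} [NormedAddCommGroup E] [NormedSpace ℝ E] [FiniteDimensional ℝ E]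
  {M : Type*} [TopologicalSpace M] [ChartedSpace E M] [IsManifold 𝓘(ℝ, E) ∞ M]
  [MulAction G M] [ContMDiffSMul 𝓘(ℝ, EG) 𝓘(ℝ, E) ∞ G M]
  {l : OpenPartialHomeomorph G EG} {κ κ' : OpenPartialHomeomorph M E} {x y : M}

/-- Any projection onto the tangent space of the orbit serves here. An equivariant one is needed
only for slices. -/
theorem isotropy_local_structure
    (hl : l ∈ IsManifold.maximalAtlas 𝓘(ℝ, EG) ∞ G) (hl1 : (1 : G) ∈ l.source) (hl0 : l 1 = 0)
    (hκ : κ ∈ IsManifold.maximalAtlas 𝓘(ℝ, E) ∞ M) (hx : x ∈ κ.source) (hκ0 : κ x = 0) :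
    (∀ W ∈ 𝓝 (0 : EG), ∀ᶠ g in 𝓝 (1 : G), g • x = x → ∃ c : ℝ → EG, c 0 = 0 ∧
      l.symm (c 1) = g ∧ ∀ t ∈ Set.Icc (0 : ℝ) 1, c t ∈ W ∧ c t ∈ l.target ∧
        DifferentiableAt ℝ c t ∧ ∀ᶠ s in 𝓝 t, l.symm (c s) • x = x) ∧
    (∀ ξ, fderiv ℝ (orbitCoord l κ x) 0 ξ = 0 → ∃ c : ℝ → EG, c 0 = 0 ∧ HasDerivAt c ξ 0 ∧
      ∀ᶠ t in 𝓝 0, l.symm (c t) • x = x) := by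
  set A := fderiv ℝ (orbitCoord l κ x) 0 with hA
  obtain ⟨p, hp⟩ := Submodule.ClosedComplemented.of_finiteDimensional (𝕜 := ℝ)
    (A : EG →ₗ[ℝ] E).range
  set P : E →L[ℝ] E := (A : EG →ₗ[ℝ] E).range.subtypeL ∘L p with hP
  have hPv : ∀ v ∈ (A : EG →ₗ[ℝ] E).range, P v = v := fun v hv => by
    simpa [hP] using congrArg Subtype.val (hp ⟨v, hv⟩)
  obtain ⟨B, hAB, hBP⟩ := exists_section_of_projection A P (fun w => (p w).2) hPv
  exact (orbit_local_structure hl hl1 hl0 hκ hx hκ0 hPv hAB hBP).2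

/-- The Lie algebra of the isotropy group of `x` is determined monotonically by that group. -/
theorem fderiv_orbitCoord_eq_zero_of_stabilizer_le
    (hl : l ∈ IsManifold.maximalAtlas 𝓘(ℝ, EG) ∞ G) (hl1 : (1 : G) ∈ l.source) (hl0 : l 1 = 0)
    (hκ : κ ∈ IsManifold.maximalAtlas 𝓘(ℝ, E) ∞ M) (hx : x ∈ κ.source) (hκx : κ x = 0)
    (hκ' : κ' ∈ IsManifold.maximalAtlas 𝓘(ℝ, E) ∞ M) (hy : y ∈ κ'.source)
    (hle : MulAction.stabilizer G x ≤ MulAction.stabilizer G y) {ξ : EG}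
    (hξ : fderiv ℝ (orbitCoord l κ x) 0 ξ = 0) : fderiv ℝ (orbitCoord l κ' y) 0 ξ = 0 := by
  -- A curve in the isotropy group of `x` with velocity `ξ` also fixes `y`, so the orbit map of `y`
  -- is constant along it.
  obtain ⟨c, hc0, hc, hcx⟩ := (isotropy_local_structure hl hl1 hl0 hκ hx hκx).2 ξ hξ
  have hl00 : l.symm 0 = 1 := by rw [← hl0, l.left_inv hl1]
  have h0t : (0 : EG) ∈ l.target := hl0 ▸ l.map_source hl1
  have hA : HasFDerivAt (orbitCoord l κ' y) (fderiv ℝ (orbitCoord l κ' y) 0) (c 0) := by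
    rw [hc0]
    exact ((contDiffAt_orbitCoord hl hκ' h0t (by simpa [hl00])).differentiableAt
      (by simp)).hasFDerivAt
  have h1 := hA.comp_hasDerivAt 0 hc
  have h2 : HasDerivAt (orbitCoord l κ' y ∘ c) 0 0 := by
    refine (hasDerivAt_const (0 : ℝ) (κ' y)).congr_of_eventuallyEq ?_
    filter_upwards [hcx] with t ht
    have : l.symm (c t) • y = y := hle ht
    simp [orbitCoord, this]
  exact h1.unique h2

/-- Inclusion of Lie algebras gives inclusion of the groups near 1. An element of the isotropy group
of `x` near 1 is joined to 1 by a curve in that group. Translated back to 1, the velocity of the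
curve lies in the kernel at `x`, hence in that at `y`, so the curve moves `y` with velocity 0. -/
theorem eventually_smul_eq_of_stabilizer_le_of_finrank
    (hl : l ∈ IsManifold.maximalAtlas 𝓘(ℝ, EG) ∞ G) (hl1 : (1 : G) ∈ l.source) (hl0 : l 1 = 0)
    (hκ : κ ∈ IsManifold.maximalAtlas 𝓘(ℝ, E) ∞ M) (hx : x ∈ κ.source) (hκx : κ x = 0)
    (hκ' : κ' ∈ IsManifold.maximalAtlas 𝓘(ℝ, E) ∞ M) (hy : y ∈ κ'.source)
    (hker : ∀ ξ, fderiv ℝ (orbitCoord l κ x) 0 ξ = 0 → fderiv ℝ (orbitCoord l κ' y) 0 ξ = 0) :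
    ∀ᶠ g in 𝓝 (1 : G), g • x = x → g • y = y := by
  have : IsTopologicalGroup G := topologicalGroup_of_lieGroup 𝓘(ℝ, EG) ∞
  have : ContinuousSMul G M :=
    ContMDiffSMul.continuousSMul (I := 𝓘(ℝ, EG)) (I' := 𝓘(ℝ, E)) ∞
  have hl00 : l.symm 0 = 1 := by rw [← hl0, l.left_inv hl1]
  have h0t : (0 : EG) ∈ l.target := hl0 ▸ l.map_source hl1
  have hW : ∀ᶠ ξ in 𝓝 (0 : EG), l.symm ξ • y ∈ κ'.source := by
    have : ContinuousAt (fun θ => l.symm θ • y) 0 :=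
      (l.continuousAt_symm h0t).smul continuousAt_const
    apply this.eventually_mem
    rw [hl00, one_smul]; exact κ'.open_source.mem_nhds hy
  have hAx : HasFDerivAt (orbitCoord l κ x) (fderiv ℝ (orbitCoord l κ x) 0) 0 :=
    ((contDiffAt_orbitCoord hl hκ h0t (by simpa [hl00])).differentiableAt (by simp)).hasFDerivAt
  have hAy : HasFDerivAt (orbitCoord l κ' y) (fderiv ℝ (orbitCoord l κ' y) 0) 0 :=
    ((contDiffAt_orbitCoord hl hκ' h0t (by simpa [hl00])).differentiableAt (by simp)).hasFDerivAt
  have hy0 : orbitCoord l κ' y 0 = κ' y := by simp [orbitCoord, hl00]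
  filter_upwards [(isotropy_local_structure hl hl1 hl0 hκ hx hκx).1 _ hW] with g hg hgx
  obtain ⟨c, hc0, hc1, hc⟩ := hg hgx
  have hder : ∀ t ∈ Set.Icc (0 : ℝ) 1, HasDerivAt (fun s => orbitCoord l κ' y (c s)) 0 t := by
    intro t ht
    obtain ⟨hcW, hct, hcd, hcx⟩ := hc t ht
    have hcW : l.symm (c t) • y ∈ κ'.source := hcW
    set g₀ := l.symm (c t) with hg₀
    -- Left translation by `g₀⁻¹` brings the curve back to 1 at time `t`. The factor 1 fits
    -- `contDiffAt_chart_mul_mul`.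
    have hone : g₀⁻¹ * l.symm (c t) * 1 = 1 := by rw [← hg₀]; group
    have hτd : HasFDerivAt (fun θ => l (g₀⁻¹ * l.symm θ * 1)) _ (c t) :=
      ((contDiffAt_chart_mul_mul hl g₀⁻¹ 1 hct (by rw [hone]; exact hl1)).differentiableAt
        (by simp)).hasFDerivAt
    have hd := hτd.comp_hasDerivAt t hcd.hasDerivAt
    set d : ℝ → EG := (fun θ => l (g₀⁻¹ * l.symm θ * 1)) ∘ c with hddef
    set θ := (fderiv ℝ (fun θ => l (g₀⁻¹ * l.symm θ * 1)) (c t)) (deriv c t) with hθ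
    have hdt : d t = 0 := by simp only [hddef, Function.comp_apply, hone, hl0]
    have hcont : ContinuousAt (fun s => g₀⁻¹ * l.symm (c s) * 1) t :=
      (continuousAt_const.mul ((l.continuousAt_symm hct).comp hcd.continuousAt)).mul
        continuousAt_const
    have hsrc : ∀ᶠ s in 𝓝 t, g₀⁻¹ * l.symm (c s) * 1 ∈ l.source := by
      apply hcont.eventually_mem
      rw [hone]; exact l.open_source.mem_nhds hl1
    have hg₀x : g₀ • x = x := hcx.self_of_nhds
    have hAθ : fderiv ℝ (orbitCoord l κ x) 0 θ = 0 := by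
      have h1 : HasDerivAt (orbitCoord l κ x ∘ d) (fderiv ℝ (orbitCoord l κ x) 0 θ) t :=
        (show HasFDerivAt _ _ (d t) by rwa [hdt]).comp_hasDerivAt t hd
      refine h1.unique ((hasDerivAt_const t (κ x)).congr_of_eventuallyEq ?_)
      filter_upwards [hsrc, hcx] with s hs hsx
      simp only [hddef, orbitCoord, Function.comp_apply, l.left_inv hs, mul_smul, one_smul, hsx]
      rw [inv_smul_eq_iff.2 hg₀x.symm]
    have hf := (show HasFDerivAt _ _ (d t) by rw [hdt]; exact hAy).comp_hasDerivAt t hd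
    rw [hker θ hAθ] at hf
    have hX : HasFDerivAt (fun w => κ' (g₀ • κ'.symm w))
        (fderiv ℝ (fun w => κ' (g₀ • κ'.symm w)) (κ' y)) ((orbitCoord l κ' y ∘ d) t) := by
      rw [Function.comp_apply, hdt, hy0]
      refine ((contDiffAt_chart_smul EG hκ' hκ' g₀ (κ'.map_source hy) ?_).differentiableAt
        (by simp)).hasFDerivAt
      rwa [κ'.left_inv hy]
    have h3 := hX.comp_hasDerivAt t hf
    rw [map_zero] at h3
    refine h3.congr_of_eventuallyEq ?_
    have hys : ∀ᶠ s in 𝓝 t, (g₀⁻¹ * l.symm (c s) * 1) • y ∈ κ'.source := by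
      have : ContinuousAt (fun s => (g₀⁻¹ * l.symm (c s) * 1) • y) t :=
        hcont.smul continuousAt_const
      apply this.eventually_mem
      rw [hone, one_smul]; exact κ'.open_source.mem_nhds hy
    filter_upwards [hsrc, hys] with s hs hsy
    simp only [hddef, orbitCoord, Function.comp_apply, l.left_inv hs]
    rw [κ'.left_inv hsy, ← mul_smul]
    congr 2
    group
  have hconst := constant_of_has_deriv_right_zero (a := 0) (b := 1)
    (f := fun s => orbitCoord l κ' y (c s))
    (fun t ht => (hder t ht).continuousAt.continuousWithinAt)
    (fun t ht => (hder t ⟨ht.1, ht.2.le⟩).hasDerivWithinAt) 1 ⟨zero_le_one, le_rfl⟩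
  simp only [hc0, hy0] at hconst
  rw [orbitCoord, hc1] at hconst
  have h1s : g • y ∈ κ'.source := by
    have := (hc 1 ⟨zero_le_one, le_rfl⟩).1
    rwa [hc1] at this
  exact κ'.injOn h1s hy hconst

end Isotropy

/-- Elements of the isotropy group near 1 are joined to 1 by curves inside it. This local fact
replaces the theorem that a closed subgroup is a Lie group. -/
theorem connectedComponent_stabilizer_mem_nhds (EG : Type*) [NormedAddCommGroup EG] [NormedSpace ℝ EG]
    [FiniteDimensional ℝ EG]
    {G : Type*} [TopologicalSpace G] [ChartedSpace EG G] [Group G] [LieGroup 𝓘(ℝ, EG) ∞ G]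
    (E : Type*) [NormedAddCommGroup E] [NormedSpace ℝ E] [FiniteDimensional ℝ E]
    {M : Type*} [TopologicalSpace M] [ChartedSpace E M] [IsManifold 𝓘(ℝ, E) ∞ M]
    [MulAction G M] [ContMDiffSMul 𝓘(ℝ, EG) 𝓘(ℝ, E) ∞ G M] (x : M) :
    connectedComponent (1 : MulAction.stabilizer G x) ∈ 𝓝 1 := by
  obtain ⟨l, hl, hl1, hl0⟩ := exists_chart_eq_zero (E := EG) (1 : G)
  obtain ⟨κ, hκ, hx, hκ0⟩ := exists_chart_eq_zero (E := E) x
  have h := (isotropy_local_structure hl hl1 hl0 hκ hx hκ0).1 Set.univ Filter.univ_mem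
  have hv : Filter.Tendsto (Subtype.val : MulAction.stabilizer G x → G) (𝓝 1) (𝓝 1) :=
    continuous_subtype_val.continuousAt
  have hl00 : l.symm 0 = 1 := by rw [← hl0, l.left_inv hl1]
  filter_upwards [hv.eventually h] with k hk
  obtain ⟨c, hc0, hc1, hc⟩ := hk k.2
  set S : Set (MulAction.stabilizer G x) :=
    Subtype.val ⁻¹' ((fun t => l.symm (c t)) '' Set.Icc (0 : ℝ) 1) with hS
  have hSpre : IsPreconnected S := by
    have himage : (Subtype.val : MulAction.stabilizer G x → G) '' S =
        (fun t => l.symm (c t)) '' Set.Icc (0 : ℝ) 1 := by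
      apply Set.image_preimage_eq_of_subset
      rintro _ ⟨t, ht, rfl⟩
      exact ⟨⟨_, (hc t ht).2.2.2.self_of_nhds⟩, rfl⟩
    refine Topology.IsInducing.subtypeVal.isPreconnected_image.1 (himage ▸ ?_)
    refine isPreconnected_Icc.image _ fun t ht => ?_
    obtain ⟨-, hct, hcd, -⟩ := hc t ht
    exact ((l.continuousAt_symm hct).comp hcd.continuousAt).continuousWithinAt
  refine hSpre.subset_connectedComponent (x := 1) ?_ ?_
  · exact ⟨0, ⟨le_rfl, zero_le_one⟩, by simp [hc0, hl00]⟩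
  · exact ⟨1, ⟨zero_le_one, le_rfl⟩, hc1⟩

/-- If the isotropy group of `y` is contained in that of `x` and conjugate to it, then they are
equal. -/
theorem stabilizer_eq_of_le_of_conj (EG : Type*) [NormedAddCommGroup EG] [NormedSpace ℝ EG]
    [FiniteDimensional ℝ EG]
    {G : Type*} [TopologicalSpace G] [ChartedSpace EG G] [Group G] [LieGroup 𝓘(ℝ, EG) ∞ G]
    (E : Type*) [NormedAddCommGroup E] [NormedSpace ℝ E] [FiniteDimensional ℝ E]
    {M : Type*} [TopologicalSpace M] [ChartedSpace E M] [IsManifold 𝓘(ℝ, E) ∞ M]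
    [MulAction G M] [ContMDiffSMul 𝓘(ℝ, EG) 𝓘(ℝ, E) ∞ G M]
    [T2Space G] {x y : M}
    (hK : IsCompact (MulAction.stabilizer G x : Set G))
    (hle : MulAction.stabilizer G y ≤ MulAction.stabilizer G x) {a : G}
    (ha : MulAction.stabilizer G y = MulAction.stabilizer G (a • x)) :
    MulAction.stabilizer G y = MulAction.stabilizer G x := by
  have : IsTopologicalGroup G := topologicalGroup_of_lieGroup 𝓘(ℝ, EG) ∞
  have : CompactSpace (MulAction.stabilizer G x) := isCompact_iff_compactSpace.1 hK
  obtain ⟨l, hl, hl1, hl0⟩ := exists_chart_eq_zero (E := EG) (1 : G)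
  obtain ⟨κ, hκ, hx, hκx⟩ := exists_chart_eq_zero (E := E) x
  obtain ⟨κy, hκy, hy, hκy0⟩ := exists_chart_eq_zero (E := E) y
  obtain ⟨κa, hκa, hax, hκa0⟩ := exists_chart_eq_zero (E := E) (a • x)
  have hl00 : l.symm 0 = 1 := by rw [← hl0, l.left_inv hl1]
  have h0t : (0 : EG) ∈ l.target := hl0 ▸ l.map_source hl1
  set Ax := fderiv ℝ (orbitCoord l κ x) 0
  set Ay := fderiv ℝ (orbitCoord l κy y) 0
  set Aa := fderiv ℝ (orbitCoord l κa (a • x)) 0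
  -- The Lie algebras are nested as `Aa`, `Ay`, `Ax`. Orbit maps along one orbit satisfy rank Aa ≤
  -- rank Ax, which reverses the dimension inequality and forces equality.
  have h1 : (Aa : EG →ₗ[ℝ] E).ker ≤ (Ay : EG →ₗ[ℝ] E).ker := fun ξ hξ =>
    fderiv_orbitCoord_eq_zero_of_stabilizer_le hl hl1 hl0 hκa hax hκa0 hκy hy ha.ge hξ
  have h2 : (Ay : EG →ₗ[ℝ] E).ker ≤ (Ax : EG →ₗ[ℝ] E).ker := fun ξ hξ =>
    fderiv_orbitCoord_eq_zero_of_stabilizer_le hl hl1 hl0 hκy hy hκy0 hκ hx hle hξ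
  have hrank : Module.finrank ℝ (Aa : EG →ₗ[ℝ] E).range ≤
      Module.finrank ℝ (Ax : EG →ₗ[ℝ] E).range :=
    finrank_range_fderiv_orbitCoord_le hl hl1 hl0 hκ hκa hx a h0t (by rwa [hl00, one_smul])
  have e1 := LinearMap.finrank_range_add_finrank_ker (Aa : EG →ₗ[ℝ] E)
  have e2 := LinearMap.finrank_range_add_finrank_ker (Ax : EG →ₗ[ℝ] E)
  have e3 := Submodule.finrank_mono h1
  have hker : (Ay : EG →ₗ[ℝ] E).ker = (Ax : EG →ₗ[ℝ] E).ker :=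
    Submodule.eq_of_le_of_finrank_le h2 (by omega)
  have hev := eventually_smul_eq_of_stabilizer_le_of_finrank hl hl1 hl0 hκ hx hκx hκy hy
    (fun ξ hξ => hker.ge hξ)
  -- conjugation by `a` as an endomorphism of the isotropy group of `x`
  have hconj : ∀ g : G, a * g * a⁻¹ ∈ MulAction.stabilizer G y ↔
      g ∈ MulAction.stabilizer G x := by
    intro g
    rw [ha, MulAction.mem_stabilizer_iff, MulAction.mem_stabilizer_iff]
    simp [mul_smul]
  set α : MulAction.stabilizer G x →* MulAction.stabilizer G x :=
    ((MulAut.conj a).toMonoidHom.comp (MulAction.stabilizer G x).subtype).codRestrict _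
      (fun k => hle ((hconj k).2 k.2)) with hα
  have hαk : ∀ k, ((α k : MulAction.stabilizer G x) : G) = a * k * a⁻¹ := fun k => rfl
  have hαc : Continuous α := by
    refine Continuous.subtype_mk ?_ _
    change Continuous fun k : MulAction.stabilizer G x => a * (k : G) * a⁻¹
    fun_prop
  have hinj : Function.Injective α := by
    intro k k' h
    have := congrArg (fun k : MulAction.stabilizer G x => (k : G)) h
    simp only [hαk, mul_left_inj, mul_right_inj] at this
    exact Subtype.ext this
  have hmem : ∀ k : MulAction.stabilizer G x, (k : G) ∈ MulAction.stabilizer G y → k ∈ α.range := by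
    intro k hk
    have h : a * (a⁻¹ * k * a) * a⁻¹ = k := by group
    refine ⟨⟨a⁻¹ * k * a, (hconj _).1 (by rwa [h])⟩, Subtype.ext ?_⟩
    rw [hαk]; exact h
  -- The range of `α` is the isotropy group of `y`, which contains all elements of that of `x` near
  -- 1.
  have hrange : (α.range : Set (MulAction.stabilizer G x)) ∈ 𝓝 1 := by
    have hv : Filter.Tendsto (Subtype.val : MulAction.stabilizer G x → G) (𝓝 1) (𝓝 1) :=
      continuous_subtype_val.continuousAt
    filter_upwards [hv.eventually hev] with k hk
    exact hmem k (hk k.2)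
  have hsurj := surjective_of_injective_of_isOpen_range
    (connectedComponent_stabilizer_mem_nhds EG E x) α hαc hinj hrange
  refine le_antisymm hle fun k hk => ?_
  obtain ⟨k', hk'⟩ := hsurj ⟨k, hk⟩
  have := congrArg (fun k : MulAction.stabilizer G x => (k : G)) hk'
  simp only [hαk] at this
  rw [← this]
  exact (hconj _).2 k'.2

/-! ### Slices -/

/-- A slice at `m` for the action of `G`: a chart `φ` around `m`, in which the slice is the set of
the vectors `s` with `P s = 0` and `q s < δ`. The isotropy group of `m` acts linearly on
the slice, and the directions in the range of `P` are swept out by translations in `G`. -/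
structure LinearSlice (G : Type*) [Group G] [TopologicalSpace G]
    (E : Type*) [NormedAddCommGroup E] [NormedSpace ℝ E]
    {M : Type*} [TopologicalSpace M] [ChartedSpace E M] [MulAction G M] (m : M) where
  /-- the chart -/
  φ : OpenPartialHomeomorph M E
  /-- the isotropy representation -/
  ρ : MulAction.stabilizer G m →* (E →L[ℝ] E)
  /-- the equivariant projection onto the orbit directions -/
  P : E →L[ℝ] E
  /-- the projection onto the fixed vectors -/
  Q : E →L[ℝ] E
  /-- an invariant quadratic form -/
  q : E → ℝ
  /-- the radius of the slice -/
  δ : ℝ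
  mem_atlas : φ ∈ IsManifold.maximalAtlas 𝓘(ℝ, E) ∞ M
  mem_source : m ∈ φ.source
  map_self : φ m = 0
  δ_pos : 0 < δ
  target_eq : φ.target = {e | q (e - P e) < δ ∧ q (P e) < δ}
  P_P : ∀ v, P (P v) = P v
  ρ_P : ∀ k v, ρ k (P v) = P (ρ k v)
  ρ_Q : ∀ k v, ρ k (Q v) = Q v
  Q_ρ : ∀ k v, Q (ρ k v) = Q v
  Q_eq : ∀ v, (∀ k, ρ k v = v) → Q v = v
  Q_P : ∀ v, Q (P v) = P (Q v)
  comp_Q : ∀ L : E →L[ℝ] ℝ, (∀ k v, L (ρ k v) = L v) → ∀ v, L (Q v) = L v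
  contDiff_q : ContDiff ℝ ∞ q
  q_zero : q 0 = 0
  q_ρ : ∀ k v, q (ρ k v) = q v
  le_q : ∃ c > 0, ∀ v, c * ‖v‖ ^ 2 ≤ q v
  smul_symm : ∀ (k : MulAction.stabilizer G m) (s : E), P s = 0 → q s < δ →
    (k : G) • φ.symm s = φ.symm (ρ k s)
  mem_of_smul_eq : ∀ (g : G) (s s' : E), P s = 0 → q s < δ → P s' = 0 → q s' < δ →
    g • φ.symm s = φ.symm s' → g • m = m
  -- One `g` serves all `e'` with the same component `P e`, so whole curves in slice directions are
  -- translated by a single group element.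
  exists_smul : ∀ e ∈ φ.target, ∃ g : G, ∀ e' ∈ φ.target, P e' = P e →
    φ.symm e' = g • φ.symm (e' - P e)

section SliceTheorem

open scoped Pointwise

/-- Properness makes (g, x) ↦ (g • x, x) a closed map. The image of the pairs with g ∉ U is closed
and misses (m, m). -/
theorem exists_nhds_forall_smul_mem {G M : Type*} [Group G] [TopologicalSpace G]
    [TopologicalSpace M] [MulAction G M] [ProperSMul G M] {m : M} {U : Set G} (hU : IsOpen U)
    (hmU : ∀ g : G, g • m = m → g ∈ U) :
    ∃ D ∈ 𝓝 m, ∀ x ∈ D, ∀ g : G, g • x ∈ D → g ∈ U := by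
  have hcl := (ProperSMul.isProperMap_smul_pair (G := G) (X := M)).isClosedMap
    (Uᶜ ×ˢ Set.univ) (hU.isClosed_compl.prod isClosed_univ)
  have hmem : ((fun gx : G × M => (gx.1 • gx.2, gx.2)) '' (Uᶜ ×ˢ Set.univ))ᶜ ∈ 𝓝 (m, m) := by
    refine hcl.isOpen_compl.mem_nhds ?_
    rintro ⟨⟨g, x⟩, ⟨hg, -⟩, heq⟩
    simp only [Prod.mk.injEq] at heq
    obtain ⟨h1, rfl⟩ := heq
    exact hg (hmU g h1)
  rw [nhds_prod_eq] at hmem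
  obtain ⟨D, hD, hDD⟩ := Filter.mem_prod_self_iff.1 hmem
  refine ⟨D, hD, fun x hx g hgx => ?_⟩
  by_contra hg
  exact hDD (show (g • x, x) ∈ D ×ˢ D from ⟨hgx, hx⟩) ⟨(g, x), ⟨hg, trivial⟩, rfl⟩

/-- The slice theorem for proper actions. -/
theorem exists_linearSlice (EG : Type*) [NormedAddCommGroup EG] [NormedSpace ℝ EG]
    [FiniteDimensional ℝ EG]
    {G : Type*} [TopologicalSpace G] [ChartedSpace EG G] [Group G] [LieGroup 𝓘(ℝ, EG) ∞ G]
    (E : Type*) [NormedAddCommGroup E] [NormedSpace ℝ E] [FiniteDimensional ℝ E]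
    {M : Type*} [TopologicalSpace M] [ChartedSpace E M] [IsManifold 𝓘(ℝ, E) ∞ M]
    [MulAction G M] [ContMDiffSMul 𝓘(ℝ, EG) 𝓘(ℝ, E) ∞ G M] [ProperSMul G M] (m : M) :
    Nonempty (LinearSlice G E m) := by
  have : IsTopologicalGroup G := topologicalGroup_of_lieGroup 𝓘(ℝ, EG) ∞
  have hK := isCompact_stabilizer (G := G) m
  have : CompactSpace (MulAction.stabilizer G m) := isCompact_iff_compactSpace.1 hK
  obtain ⟨l, hl, hl1, hl0⟩ := exists_chart_eq_zero (E := EG) (1 : G)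
  obtain ⟨κ, hκ, hm, hκm, ρ, hρc, hρ⟩ := exists_linearizing_chart (E := E) EG m hK
  have hl00 : l.symm 0 = 1 := by rw [← hl0, l.left_inv hl1]
  have h0l : (0 : EG) ∈ l.target := hl0 ▸ l.map_source hl1
  have hκ00 : κ.symm 0 = m := by rw [← hκm, κ.left_inv hm]
  have h0κ : (0 : E) ∈ κ.target := hκm ▸ κ.map_source hm
  set A := fderiv ℝ (orbitCoord l κ m) 0 with hA
  obtain ⟨P, hPT, hPv, hρP⟩ := exists_equivariant_projection hρc (A : EG →ₗ[ℝ] E).range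
    (fun k v hv => map_mem_range_fderiv_orbitCoord hl hl1 hl0 hκ hm (k := (k : G)) k.2
      (fun y hy => (hρ k y hy).2) hv)
  obtain ⟨Q, hρQ, hQρ, hQfix, hQl, hQB⟩ := exists_projection_fixed hρc
  obtain ⟨q, hqs, hq0, hqρ, c, hc, hcq⟩ := exists_invariant_quadratic hρc
  obtain ⟨B, hAB, hBP⟩ := exists_section_of_projection A P hPT hPv
  have hAB' : ∀ w, A (B w) = P w := DFunLike.congr_fun hAB
  have hBP' : ∀ w, B (P w) = B w := DFunLike.congr_fun hBP
  have hPP : ∀ w, P (P w) = P w := fun w => hPv _ (hPT w)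
  have horb := (orbit_local_structure hl hl1 hl0 hκ hm hκm hPv hAB hBP).1
  -- the map sweeping out the tube
  set Θ : E → M := fun e => l.symm (B e) • κ.symm (e - P e) with hΘ
  set Ω₀ : Set E := {e | B e ∈ l.target} ∩ {e | e - P e ∈ κ.target} with hΩ₀
  have hΩ₀o : IsOpen Ω₀ :=
    (l.open_target.preimage B.continuous).inter
      (κ.open_target.preimage (by fun_prop : Continuous fun e => e - P e))
  have hΘs : ContMDiffOn 𝓘(ℝ, E) 𝓘(ℝ, E) ∞ Θ Ω₀ := by
    intro e he
    have h1 : ContMDiffAt 𝓘(ℝ, E) 𝓘(ℝ, EG) ∞ (fun e => l.symm (B e)) e :=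
      (contMDiffAt_symm_of_mem_maximalAtlas hl he.1).comp e B.contMDiff.contMDiffAt
    have h2 : ContMDiffAt 𝓘(ℝ, E) 𝓘(ℝ, E) ∞ (fun e => κ.symm (e - P e)) e := by
      refine (contMDiffAt_symm_of_mem_maximalAtlas hκ he.2).comp e ?_
      exact (by fun_prop : ContDiff ℝ ∞ fun e => e - P e).contMDiff.contMDiffAt
    exact (h1.smul h2).contMDiffWithinAt
  set Ω : Set E := Ω₀ ∩ Θ ⁻¹' κ.source with hΩ
  have hΩo : IsOpen Ω := hΘs.continuousOn.isOpen_inter_preimage hΩ₀o κ.open_source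
  have hΘ0 : Θ 0 = m := by simp [hΘ, hl00, hκ00]
  have h0Ω : (0 : E) ∈ Ω := ⟨⟨by simpa using h0l, by simpa using h0κ⟩, by
    rw [Set.mem_preimage, hΘ0]; exact hm⟩
  have hΘc : ContDiffOn ℝ ∞ (fun e => κ (Θ e)) Ω := by
    rw [← contMDiffOn_iff_contDiffOn]
    exact (contMDiffOn_of_mem_maximalAtlas hκ).comp (hΘs.mono Set.inter_subset_left)
      fun e he => he.2
  -- The partial derivatives of (ξ, v) ↦ l.symm ξ • κ.symm v in the chart are `A` and 1, so the
  -- derivative of the tube map is A B + (1 - P) = 1.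
  have hder : HasFDerivAt (fun e => κ (Θ e))
      ((ContinuousLinearEquiv.refl ℝ E : E ≃L[ℝ] E) : E →L[ℝ] E) 0 := by
    set h2 : EG × E → E := fun p => κ (l.symm p.1 • κ.symm p.2) with hh2
    have hd : DifferentiableAt ℝ h2 ((0 : EG), (0 : E)) := by
      have h1 : ContMDiffAt 𝓘(ℝ, EG × E) 𝓘(ℝ, EG) ∞ (fun p : EG × E => l.symm p.1) (0, 0) :=
        (contMDiffAt_symm_of_mem_maximalAtlas hl h0l).comp (0, 0)
          contDiff_fst.contMDiff.contMDiffAt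
      have h2 : ContMDiffAt 𝓘(ℝ, EG × E) 𝓘(ℝ, E) ∞ (fun p : EG × E => κ.symm p.2) (0, 0) :=
        (contMDiffAt_symm_of_mem_maximalAtlas hκ h0κ).comp (0, 0)
          contDiff_snd.contMDiff.contMDiffAt
      have h3 := h1.smul h2
      have h4 := (contMDiffAt_of_mem_maximalAtlas hκ (x := l.symm 0 • κ.symm 0)
        (by rw [hl00, hκ00, one_smul]; exact hm)).comp ((0 : EG), (0 : E)) h3
      exact h4.contDiffAt.differentiableAt (by simp)
    obtain ⟨D, hD⟩ := hd
    have hAd : HasFDerivAt (orbitCoord l κ m) A 0 :=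
      ((contDiffAt_orbitCoord hl hκ h0l (by simpa [hl00])).differentiableAt (by simp)).hasFDerivAt
    have hD1 : ∀ ξ, D (ξ, 0) = A ξ := by
      have h5 : HasFDerivAt (fun ξ : EG => h2 (ξ, 0)) (D ∘L (ContinuousLinearMap.inl ℝ EG E)) 0 :=
        HasFDerivAt.comp (g := h2) (0 : EG) hD (hasFDerivAt_prodMk_left (0 : EG) (0 : E))
      have h6 : HasFDerivAt (fun ξ : EG => h2 (ξ, 0)) A 0 := by
        refine hAd.congr_of_eventuallyEq (Filter.Eventually.of_forall fun ξ => ?_)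
        simp [hh2, orbitCoord, hκ00]
      intro ξ
      exact DFunLike.congr_fun (h5.unique h6) ξ
    have hD2 : ∀ v, D (0, v) = v := by
      have h5 : HasFDerivAt (fun v : E => h2 (0, v)) (D ∘L (ContinuousLinearMap.inr ℝ EG E)) 0 :=
        HasFDerivAt.comp (g := h2) (0 : E) hD (hasFDerivAt_prodMk_right (0 : EG) (0 : E))
      have h6 : HasFDerivAt (fun v : E => h2 (0, v)) (ContinuousLinearMap.id ℝ E) 0 := by
        refine (hasFDerivAt_id (0 : E)).congr_of_eventuallyEq ?_
        filter_upwards [κ.open_target.mem_nhds h0κ] with v hv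
        simp [hh2, hl00, κ.right_inv hv]
      intro v
      exact DFunLike.congr_fun (h5.unique h6) v
    have h7 : HasFDerivAt (fun e : E => (B e, e - P e))
        (B.prod (ContinuousLinearMap.id ℝ E - P)) 0 :=
      B.hasFDerivAt.prodMk ((hasFDerivAt_id (0 : E)).sub P.hasFDerivAt)
    have h8 : HasFDerivAt (fun e => κ (Θ e)) (D ∘L (B.prod (ContinuousLinearMap.id ℝ E - P))) 0 :=
      HasFDerivAt.comp (g := h2) (0 : E) (by simpa using hD) h7
    convert h8 using 1
    ext v
    have h9 : (B v, v - P v) = (B v, (0 : E)) + ((0 : EG), v - P v) := by simp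
    change v = D (B v, v - P v)
    rw [h9, map_add, hD1, hD2, hAB']
    abel
  obtain ⟨e₀, h0e₀, he₀Ω, he₀f, he₀s, he₀s', -⟩ :=
    exists_openPartialHomeomorph_of_contDiffOn (by simp) hΩo hΘc h0Ω _ hder
  set φ₀ := κ ≫ₕ e₀.symm with hφ₀
  have hφ₀A : φ₀ ∈ IsManifold.maximalAtlas 𝓘(ℝ, E) ∞ M := trans_mem_maximalAtlas hκ he₀s' he₀s
  have hφ₀t : φ₀.target = e₀.source := by
    rw [hφ₀, OpenPartialHomeomorph.trans_target]
    change e₀.source ∩ e₀ ⁻¹' κ.target = e₀.source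
    refine Set.inter_eq_left.2 fun e he => ?_
    rw [Set.mem_preimage, he₀f]
    exact κ.map_source (he₀Ω he).2
  have hφ₀s : ∀ e ∈ e₀.source, φ₀.symm e = Θ e := by
    intro e he
    change κ.symm (e₀ e) = Θ e
    rw [he₀f, κ.left_inv (he₀Ω he).2]
  have hinjΘ : ∀ e ∈ e₀.source, ∀ e' ∈ e₀.source, Θ e = Θ e' → e = e' := by
    intro e he e' he' h
    refine e₀.injOn he he' ?_
    rw [he₀f, he₀f, h]
  -- small tubes
  set Tb : ℝ → Set E := fun δ => {e | q (e - P e) < δ ∧ q (P e) < δ} with hTb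
  have hTbo : ∀ δ, IsOpen (Tb δ) := fun δ => by
    have hqc := hqs.continuous
    rw [hTb]
    simp only [Set.ofPred_and]
    refine IsOpen.inter (isOpen_lt ?_ continuous_const) (isOpen_lt ?_ continuous_const) <;> fun_prop
  have hsmall : ∀ W ∈ 𝓝 (0 : E), ∃ δ > 0, Tb δ ⊆ W := by
    intro W hW
    obtain ⟨r, hr, hrW⟩ := Metric.mem_nhds_iff.1 hW
    -- The bound c ‖v‖² ≤ q v turns this radius into norm less than r / 2 for each of the two
    -- components.
    refine ⟨c * (r / 2) ^ 2, by positivity, fun e he => hrW ?_⟩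
    have hlt : ∀ v, q v < c * (r / 2) ^ 2 → ‖v‖ < r / 2 := by
      intro v hv
      have h1 : c * ‖v‖ ^ 2 < c * (r / 2) ^ 2 := (hcq v).trans_lt hv
      have h2 := lt_of_mul_lt_mul_left h1 hc.le
      exact lt_of_pow_lt_pow_left₀ 2 (by positivity) h2
    rw [mem_ball_zero_iff]
    calc ‖e‖ = ‖(e - P e) + P e‖ := by rw [sub_add_cancel]
      _ ≤ _ := norm_add_le _ _
      _ < r := by linarith [hlt _ he.1, hlt _ he.2]
  have hmono : ∀ {a b : ℝ}, a ≤ b → Tb a ⊆ Tb b := fun hab e he =>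
    ⟨he.1.trans_le hab, he.2.trans_le hab⟩
  obtain ⟨δ₀, hδ₀, hδ₀s⟩ := hsmall _ (e₀.open_source.mem_nhds h0e₀)
  obtain ⟨r, hr, hrq⟩ : ∃ r > 0, ∀ v, ‖v‖ < r → q v < δ₀ := by
    have := (hqs.continuous.tendsto 0).eventually_lt_const (by rwa [hq0])
    obtain ⟨r, hr, h⟩ := Metric.eventually_nhds_iff.1 this
    exact ⟨r, hr, fun v hv => h (by simpa using hv)⟩
  -- Elements of `O` move `m` like some `l.symm (B v)` with `v` so small that `v` plus a slice
  -- vector stays where the tube map is injective. By properness, an element that carries a point of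
  -- `D` into `D` lies in `O` times the isotropy group.
  obtain ⟨O, hO, hOo, h1O⟩ := mem_nhds_iff.1 (horb r hr)
  obtain ⟨D, hD, hDg⟩ := exists_nhds_forall_smul_mem (m := m) 
    (U := O * (MulAction.stabilizer G m : Set G)) hOo.mul_right (fun g hg => ⟨1, h1O, g, hg, one_mul g⟩)
  have hDκ : κ.symm ⁻¹' D ∈ 𝓝 (0 : E) := by
    refine (κ.continuousAt_symm h0κ).preimage_mem_nhds ?_
    rwa [hκ00]
  obtain ⟨δ₁, hδ₁, hδ₁s⟩ := hsmall _ hDκ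
  set δ := min δ₀ δ₁ with hδ
  have hδpos : 0 < δ := lt_min hδ₀ hδ₁
  have hδe : Tb δ ⊆ e₀.source := (hmono (min_le_left _ _)).trans hδ₀s
  have hSt : ∀ s, P s = 0 → q s < δ → s ∈ Tb δ := fun s hPs hs =>
    ⟨by rwa [hPs, sub_zero], by rwa [hPs, hq0]⟩
  have hΘS : ∀ s, P s = 0 → Θ s = κ.symm s := fun s hs => by
    have : B s = 0 := by rw [← hBP', hs, map_zero]
    simp [hΘ, this, hl00, hs]
  have hSκ : ∀ s, P s = 0 → q s < δ → s ∈ κ.target := fun s hPs hs => by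
    simpa [hPs] using (he₀Ω (hδe (hSt s hPs hs))).1.2
  have hκsmul : ∀ (k : MulAction.stabilizer G m) s, s ∈ κ.target →
      (k : G) • κ.symm s = κ.symm (ρ k s) := by
    intro k s hs
    obtain ⟨h1, h2⟩ := hρ k _ (κ.map_target hs)
    rw [κ.right_inv hs] at h2
    rw [← h2, κ.left_inv h1]
  set O' : Set M := φ₀.source ∩ φ₀ ⁻¹' (Tb δ) with hO'
  have hO'o : IsOpen O' := φ₀.isOpen_inter_preimage (hTbo δ)
  set φ := φ₀.restr O' with hφ
  have hφt : φ.target = Tb δ := by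
    rw [hφ, OpenPartialHomeomorph.restr_target, hO'o.interior_eq, hφ₀t]
    ext e
    constructor
    · rintro ⟨he, -, h⟩
      rwa [Set.mem_preimage, φ₀.right_inv (hφ₀t ▸ he)] at h
    · intro he
      have h1 : e ∈ φ₀.target := hφ₀t ▸ hδe he
      refine ⟨hδe he, φ₀.map_target h1, ?_⟩
      rwa [Set.mem_preimage, φ₀.right_inv h1]
  have hφs : ∀ e ∈ Tb δ, φ.symm e = Θ e := fun e he => hφ₀s e (hδe he)
  have hφS : ∀ s, P s = 0 → q s < δ → φ.symm s = κ.symm s := fun s hPs hs => by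
    rw [hφs s (hSt s hPs hs), hΘS s hPs]
  have h0T : (0 : E) ∈ Tb δ := hSt 0 (map_zero _) (by rwa [hq0])
  have hφ0 : φ.symm 0 = m := by rw [hφs 0 h0T, hΘ0]
  have h0φ : (0 : E) ∈ φ.target := hφt ▸ h0T
  refine ⟨{
    φ := φ, ρ := ρ, P := P, Q := Q, q := q, δ := δ
    mem_atlas := restr_mem_contDiff_maximalAtlas hφ₀A hO'o
    mem_source := hφ0 ▸ φ.map_target h0φ
    map_self := by rw [← hφ0, φ.right_inv h0φ]
    δ_pos := hδpos
    target_eq := hφt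
    P_P := hPP
    ρ_P := hρP
    ρ_Q := hρQ
    Q_ρ := hQρ
    Q_eq := hQfix
    Q_P := hQB P hρP
    comp_Q := hQl
    contDiff_q := hqs
    q_zero := hq0
    q_ρ := hqρ
    le_q := ⟨c, hc, hcq⟩
    smul_symm := fun k s hPs hs => ?_
    mem_of_smul_eq := fun g s s' hPs hs hPs' hs' h => ?_
    exists_smul := fun e he => ⟨l.symm (B e), fun e' he' hPe => ?_⟩ }⟩
  · have h1 : P (ρ k s) = 0 := by rw [← hρP, hPs, map_zero]
    rw [hφS s hPs hs, hφS _ h1 (by rwa [hqρ]), hκsmul k s (hSκ s hPs hs)]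
  · rw [hφS s hPs hs, hφS s' hPs' hs'] at h
    have hsD : κ.symm s ∈ D := hδ₁s (hmono (min_le_right _ _) (hSt s hPs hs))
    have hsD' : κ.symm s' ∈ D := hδ₁s (hmono (min_le_right _ _) (hSt s' hPs' hs'))
    -- Up to the isotropy group, `o * k` is `l.symm (B v)`. So both sides are values of the tube
    -- map, at `v + ρ k₂ s` and at `s'`, and injectivity gives `v = 0`.
    obtain ⟨o, ho, k, hk, rfl⟩ := hDg _ hsD g (h ▸ hsD')
    obtain ⟨v, hPv', hvr, -, hov⟩ := hO ho
    have hkm : k • m = m := hk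
    set k₁ : G := (l.symm (B v))⁻¹ * o with hk₁
    have hk₁m : k₁ • m = m := by
      rw [hk₁, mul_smul, inv_smul_eq_iff]; exact hov
    set k₂ : MulAction.stabilizer G m := ⟨k₁ * k, by
      rw [MulAction.mem_stabilizer_iff, mul_smul, hkm, hk₁m]⟩ with hk₂
    have hok : o * k = l.symm (B v) * k₂ := by
      simp only [hk₂, hk₁]; group
    have h1 : P (ρ k₂ s) = 0 := by rw [← hρP, hPs, map_zero]
    have h2 : P (v + ρ k₂ s) = v := by rw [map_add, h1, hPv', add_zero]
    have h3 : B (v + ρ k₂ s) = B v := by rw [← hBP', h2]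
    have h4 : (o * k) • κ.symm s = Θ (v + ρ k₂ s) := by
      rw [hok, mul_smul, hκsmul k₂ s (hSκ s hPs hs)]
      simp only [hΘ]
      rw [h3, h2, add_sub_cancel_left]
    have h5 : v + ρ k₂ s ∈ e₀.source := by
      apply hδ₀s
      refine ⟨?_, ?_⟩
      · rw [h2, add_sub_cancel_left, hqρ]
        exact hs.trans_le (min_le_left _ _)
      · rw [h2]; exact hrq v hvr
    have h6 := hinjΘ _ h5 _ (hδe (hSt s' hPs' hs')) (by rw [← h4, h, hΘS s' hPs'])
    have h7 : v = 0 := by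
      have := congrArg P h6
      rwa [h2, hPs'] at this
    have hov' : o • m = m := by
      rw [hov, h7, map_zero, hl00, one_smul]
    rw [mul_smul, hkm, hov']
  · have he1 : e ∈ Tb δ := hφt ▸ he
    have he2 : e' ∈ Tb δ := hφt ▸ he'
    have h1 : P (e' - P e) = 0 := by rw [map_sub, hPP, hPe, sub_self]
    have h2 : q (e' - P e) < δ := by rw [← hPe]; exact he2.1
    rw [hφs e' he2, hφS _ h1 h2]
    simp only [hΘ]
    rw [hPe, ← hBP' e', hPe, hBP']

end SliceTheorem

/-! ### Orbit types in a slice chart -/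

namespace LinearSlice

variable {G : Type*} [Group G] [TopologicalSpace G]
  {E : Type*} [NormedAddCommGroup E] [NormedSpace ℝ E]
  {M : Type*} [TopologicalSpace M] [ChartedSpace E M] [MulAction G M] {m : M}
  (S : LinearSlice G E m)

/-- The slice, as a subset of the model space. -/
def slice : Set E := {s | S.P s = 0 ∧ S.q s < S.δ}

/-- The union of the orbits that meet the slice. -/
def tube : Set M := {x | ∃ (g : G), ∃ s ∈ S.slice, x = g • S.φ.symm s}

/-- The linear subspace that the orbit type of `m` corresponds to in the slice chart. -/
def typeSubmodule : Submodule ℝ E :=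
  ((S.Q - ContinuousLinearMap.id ℝ E) ∘L (ContinuousLinearMap.id ℝ E - S.P) : E →ₗ[ℝ] E).ker

theorem mem_typeSubmodule {e : E} : e ∈ S.typeSubmodule ↔ S.Q (e - S.P e) = e - S.P e := by
  rw [typeSubmodule, LinearMap.mem_ker]
  exact sub_eq_zero

theorem mem_target {e : E} : e ∈ S.φ.target ↔ S.q (e - S.P e) < S.δ ∧ S.q (S.P e) < S.δ := by
  rw [S.target_eq]; rfl

theorem slice_subset_target : S.slice ⊆ S.φ.target := fun s hs => by
  rw [mem_target, hs.1, sub_zero, S.q_zero]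
  exact ⟨hs.2, S.δ_pos⟩

theorem sub_mem_slice {e : E} (he : e ∈ S.φ.target) : e - S.P e ∈ S.slice :=
  ⟨by rw [map_sub, S.P_P, sub_self], (S.mem_target.1 he).1⟩

theorem zero_mem_slice : (0 : E) ∈ S.slice := ⟨map_zero _, by rw [S.q_zero]; exact S.δ_pos⟩

theorem symm_zero : S.φ.symm 0 = m := by rw [← S.map_self, S.φ.left_inv S.mem_source]

theorem ρ_mem_slice (k : MulAction.stabilizer G m) {s : E} (hs : s ∈ S.slice) :
    S.ρ k s ∈ S.slice :=
  ⟨by rw [← S.ρ_P, hs.1, map_zero], by rw [S.q_ρ]; exact hs.2⟩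

theorem exists_smul_slice {e : E} (he : e ∈ S.φ.target) :
    ∃ g : G, S.φ.symm e = g • S.φ.symm (e - S.P e) := by
  obtain ⟨g, hg⟩ := S.exists_smul e he
  exact ⟨g, hg e he rfl⟩

theorem smul_mem_tube {x : M} (g : G) (hx : x ∈ S.tube) : g • x ∈ S.tube := by
  obtain ⟨a, s, hs, rfl⟩ := hx
  exact ⟨g * a, s, hs, (mul_smul _ _ _).symm⟩

theorem smul_mem_tube_iff {x : M} (g : G) : g • x ∈ S.tube ↔ x ∈ S.tube :=
  ⟨fun h => by simpa using S.smul_mem_tube g⁻¹ h, S.smul_mem_tube g⟩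

/-- Two representations of a point of the tube differ by the isotropy group. -/
theorem exists_of_smul_eq_smul {g g' : G} {s s' : E} (hs : s ∈ S.slice) (hs' : s' ∈ S.slice)
    (h : g • S.φ.symm s = g' • S.φ.symm s') :
    ∃ k : MulAction.stabilizer G m, S.ρ k s = s' ∧ g = g' * k := by
  have h1 : (g'⁻¹ * g) • S.φ.symm s = S.φ.symm s' := by
    rw [mul_smul, h, inv_smul_smul]
  set k : MulAction.stabilizer G m :=
    ⟨g'⁻¹ * g, S.mem_of_smul_eq _ s s' hs.1 hs.2 hs'.1 hs'.2 h1⟩ with hk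
  refine ⟨k, ?_, by simp [hk]⟩
  have h2 := S.smul_symm k s hs.1 hs.2
  refine S.φ.symm.injOn (S.slice_subset_target (S.ρ_mem_slice k hs))
    (S.slice_subset_target hs') ?_
  rw [← h2, ← h1]

theorem ρ_eq_of_Q_eq {s : E} (hs : S.Q s = s) (k : MulAction.stabilizer G m) : S.ρ k s = s := by
  rw [← hs, S.ρ_Q]

theorem stabilizer_le {s : E} (hs : s ∈ S.slice) :
    MulAction.stabilizer G (S.φ.symm s) ≤ MulAction.stabilizer G m := fun g hg =>
  S.mem_of_smul_eq g s s hs.1 hs.2 hs.1 hs.2 hg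

theorem stabilizer_eq_iff {s : E} (hs : s ∈ S.slice) :
    MulAction.stabilizer G (S.φ.symm s) = MulAction.stabilizer G m ↔ S.Q s = s := by
  constructor
  · intro h
    refine S.Q_eq s fun k => ?_
    have h1 : (k : G) • S.φ.symm s = S.φ.symm s := by
      have : (k : G) ∈ MulAction.stabilizer G (S.φ.symm s) := by
        rw [h]; exact k.2
      exact this
    rw [S.smul_symm k s hs.1 hs.2] at h1
    exact S.φ.symm.injOn (S.slice_subset_target (S.ρ_mem_slice k hs))
      (S.slice_subset_target hs) h1
  · intro h
    refine le_antisymm (S.stabilizer_le hs) fun k hk => ?_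
    have h1 := S.smul_symm ⟨k, hk⟩ s hs.1 hs.2
    rw [S.ρ_eq_of_Q_eq h] at h1
    exact h1

end LinearSlice

section OrbitType

variable {G : Type*} [Group G] {M : Type*} [MulAction G M] {H : Subgroup G} {m x : M}

theorem smul_mem_orbitType (g : G) (hx : x ∈ orbitType M H) : g • x ∈ orbitType M H := by
  obtain ⟨a, ha⟩ := hx
  refine ⟨g * a, ?_⟩
  rw [MulAction.stabilizer_smul_eq_stabilizer_map_conj, ha, Subgroup.map_map]
  congr 1
  ext h
  simp [mul_assoc]

theorem smul_mem_orbitType_iff (g : G) : g • x ∈ orbitType M H ↔ x ∈ orbitType M H :=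
  ⟨fun h => by simpa using smul_mem_orbitType g⁻¹ h, smul_mem_orbitType g⟩

theorem exists_stabilizer_eq_smul (hm : m ∈ orbitType M H) (hx : x ∈ orbitType M H) :
    ∃ a : G, MulAction.stabilizer G x = MulAction.stabilizer G (a • m) := by
  obtain ⟨a, ha⟩ := hm
  obtain ⟨b, hb⟩ := hx
  refine ⟨b * a⁻¹, ?_⟩
  rw [MulAction.stabilizer_smul_eq_stabilizer_map_conj, ha, hb, Subgroup.map_map]
  congr 1
  ext h
  simp [mul_assoc]

end OrbitType

section OrbitTypeChart

variable {G : Type*} [TopologicalSpace G] [Group G] [T2Space G]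
  {E : Type*} [NormedAddCommGroup E] [NormedSpace ℝ E] [FiniteDimensional ℝ E]
  {M : Type*} [TopologicalSpace M] [ChartedSpace E M] [IsManifold 𝓘(ℝ, E) ∞ M]
  [MulAction G M] [ProperSMul G M] {H : Subgroup G} {m : M}

/-- The isotropy group of a slice point lies in that of `m`. If it is also conjugate to it, the two
are equal, and equality means that the point is fixed. -/
theorem LinearSlice.smul_symm_mem_orbitType_iff (EG : Type*) [NormedAddCommGroup EG]
    [NormedSpace ℝ EG] [FiniteDimensional ℝ EG] [ChartedSpace EG G] [LieGroup 𝓘(ℝ, EG) ∞ G]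
    [ContMDiffSMul 𝓘(ℝ, EG) 𝓘(ℝ, E) ∞ G M]
    (S : LinearSlice G E m) (hm : m ∈ orbitType M H) (g : G) {s : E} (hs : s ∈ S.slice) :
    g • S.φ.symm s ∈ orbitType M H ↔ S.Q s = s := by
  rw [smul_mem_orbitType_iff, ← S.stabilizer_eq_iff hs]
  constructor
  · intro h
    obtain ⟨a, ha⟩ := exists_stabilizer_eq_smul hm h
    exact stabilizer_eq_of_le_of_conj EG E (isCompact_stabilizer m) (S.stabilizer_le hs) ha
  · intro h
    obtain ⟨a, ha⟩ := hm
    exact ⟨a, h.trans ha⟩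

theorem LinearSlice.symm_mem_orbitType_iff (EG : Type*) [NormedAddCommGroup EG]
    [NormedSpace ℝ EG] [FiniteDimensional ℝ EG] [ChartedSpace EG G] [LieGroup 𝓘(ℝ, EG) ∞ G]
    [ContMDiffSMul 𝓘(ℝ, EG) 𝓘(ℝ, E) ∞ G M]
    (S : LinearSlice G E m) (hm : m ∈ orbitType M H) {e : E} (he : e ∈ S.φ.target) :
    S.φ.symm e ∈ orbitType M H ↔ e ∈ S.typeSubmodule := by
  obtain ⟨g, hg⟩ := S.exists_smul_slice he
  rw [hg, S.smul_symm_mem_orbitType_iff EG hm g (S.sub_mem_slice he), S.mem_typeSubmodule]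

/-- Around each of its points, an orbit type is a linear subspace in a suitable chart, and
its intersection with the domain of the chart is connected. -/
theorem exists_chart_orbitType (EG : Type*) [NormedAddCommGroup EG]
    [NormedSpace ℝ EG] [FiniteDimensional ℝ EG] [ChartedSpace EG G] [LieGroup 𝓘(ℝ, EG) ∞ G]
    [ContMDiffSMul 𝓘(ℝ, EG) 𝓘(ℝ, E) ∞ G M] (hm : m ∈ orbitType M H) :
    ∃ φ ∈ IsManifold.maximalAtlas 𝓘(ℝ, E) ∞ M, m ∈ φ.source ∧ ∃ F : Submodule ℝ E,
      (∀ e ∈ φ.target, φ.symm e ∈ orbitType M H ↔ e ∈ F) ∧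
      IsPreconnected (φ.source ∩ orbitType M H) := by
  obtain ⟨S⟩ := exists_linearSlice EG (G := G) E m
  have h0 : (0 : E) ∈ S.φ.target := S.slice_subset_target S.zero_mem_slice
  -- Over a ball the orbit type corresponds to a convex set, hence is connected. This makes
  -- components open in the orbit type.
  obtain ⟨r, hr, hrt⟩ := Metric.mem_nhds_iff.1 (S.φ.open_target.mem_nhds h0)
  set O : Set M := S.φ.source ∩ S.φ ⁻¹' (Metric.ball 0 r) with hO
  have hOo : IsOpen O := S.φ.isOpen_inter_preimage Metric.isOpen_ball
  have hsrc : (S.φ.restr O).source = O := by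
    rw [OpenPartialHomeomorph.restr_source' _ _ hOo, Set.inter_eq_right]
    exact Set.inter_subset_left
  have htgt : ∀ e ∈ (S.φ.restr O).target, e ∈ S.φ.target := by
    intro e he
    rw [OpenPartialHomeomorph.restr_target] at he
    exact he.1
  refine ⟨S.φ.restr O, restr_mem_contDiff_maximalAtlas S.mem_atlas hOo, ?_, S.typeSubmodule,
    fun e he => S.symm_mem_orbitType_iff EG hm (htgt e he), ?_⟩
  · rw [hsrc]
    exact ⟨S.mem_source, by rw [Set.mem_preimage, S.map_self]; exact Metric.mem_ball_self hr⟩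
  · have himage : O ∩ orbitType M H =
        S.φ.symm '' (Metric.ball 0 r ∩ (S.typeSubmodule : Set E)) := by
      ext x
      constructor
      · rintro ⟨⟨hx, hxr⟩, hxH⟩
        refine ⟨S.φ x, ⟨hxr, ?_⟩, S.φ.left_inv hx⟩
        rw [← S.φ.left_inv hx, S.symm_mem_orbitType_iff EG hm (S.φ.map_source hx)] at hxH
        exact hxH
      · rintro ⟨e, ⟨her, heF⟩, rfl⟩
        have het := hrt her
        refine ⟨⟨S.φ.map_target het, ?_⟩, (S.symm_mem_orbitType_iff EG hm het).2 heF⟩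
        rwa [Set.mem_preimage, S.φ.right_inv het]
    rw [hsrc, himage]
    refine IsPreconnected.image ?_ _ (S.φ.continuousOn_symm.mono fun e he => hrt he.1)
    exact ((convex_ball 0 r).inter S.typeSubmodule.convex).isPreconnected

/-- A connected component of an orbit type is an embedded submanifold, open in the orbit type. -/
theorem exists_chart_connectedComponentIn (EG : Type*) [NormedAddCommGroup EG]
    [NormedSpace ℝ EG] [FiniteDimensional ℝ EG] [ChartedSpace EG G] [LieGroup 𝓘(ℝ, EG) ∞ G]
    [ContMDiffSMul 𝓘(ℝ, EG) 𝓘(ℝ, E) ∞ G M] {p : M}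
    (hp : p ∈ connectedComponentIn (orbitType M H) m) :
    ∃ φ ∈ IsManifold.maximalAtlas 𝓘(ℝ, E) ∞ M, p ∈ φ.source ∧
      φ.source ∩ orbitType M H ⊆ connectedComponentIn (orbitType M H) m ∧
      ∃ F : Submodule ℝ E,
      φ '' (φ.source ∩ connectedComponentIn (orbitType M H) m) = φ.target ∩ (F : Set E) := by
  have hpH : p ∈ orbitType M H := connectedComponentIn_subset _ _ hp
  obtain ⟨φ, hφ, hpφ, F, hF, hconn⟩ := exists_chart_orbitType (E := E) EG hpH
  have hsub : φ.source ∩ orbitType M H ⊆ connectedComponentIn (orbitType M H) m := by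
    rw [connectedComponentIn_eq hp]
    exact hconn.subset_connectedComponentIn ⟨hpφ, hpH⟩ Set.inter_subset_right
  refine ⟨φ, hφ, hpφ, hsub, F, ?_⟩
  ext e
  constructor
  · rintro ⟨x, ⟨hx, hxC⟩, rfl⟩
    refine ⟨φ.map_source hx, (hF _ (φ.map_source hx)).1 ?_⟩
    rw [φ.left_inv hx]
    exact connectedComponentIn_subset _ _ hxC
  · rintro ⟨he, heF⟩
    exact ⟨φ.symm e, ⟨φ.map_target he, hsub ⟨φ.map_target he, (hF e he).2 heF⟩⟩, φ.right_inv he⟩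

end OrbitTypeChart

/-! ### Extension of invariant functions and vector fields from a slice -/

/-! ### Velocities of curves in a manifold -/

section Velocity

variable {E : Type*} [NormedAddCommGroup E] [NormedSpace ℝ E]
  {M : Type*} [TopologicalSpace M] [ChartedSpace E M]

/-- The velocity of a curve at time `0`. -/
noncomputable def velocity (E : Type*) [NormedAddCommGroup E] [NormedSpace ℝ E]
    {M : Type*} [TopologicalSpace M] [ChartedSpace E M] (γ : ℝ → M) : E :=
  (mfderiv 𝓘(ℝ, ℝ) 𝓘(ℝ, E) γ 0 : ℝ →L[ℝ] E) 1

theorem velocity_congr {γ γ' : ℝ → M} (h : γ =ᶠ[𝓝 0] γ') : velocity E γ = velocity E γ' := by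
  have : (mfderiv 𝓘(ℝ, ℝ) 𝓘(ℝ, E) γ 0 : ℝ →L[ℝ] E) = mfderiv 𝓘(ℝ, ℝ) 𝓘(ℝ, E) γ' 0 :=
    h.mfderiv_eq
  exact DFunLike.congr_fun this 1

theorem velocity_const (x : M) : velocity E (fun _ => x) = 0 := by
  have : (mfderiv 𝓘(ℝ, ℝ) 𝓘(ℝ, E) (fun _ : ℝ => x) 0 : ℝ →L[ℝ] E) = 0 := mfderiv_const
  exact DFunLike.congr_fun this 1

theorem hasMFDerivAt_of_velocity_eq {γ : ℝ → M} (h : MDifferentiableAt 𝓘(ℝ, ℝ) 𝓘(ℝ, E) γ 0)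
    {v : E} (hv : velocity E γ = v) :
    HasMFDerivAt 𝓘(ℝ, ℝ) 𝓘(ℝ, E) γ 0 ((1 : ℝ →L[ℝ] ℝ).smulRight (v : E)) := by
  have h1 : ((1 : ℝ →L[ℝ] ℝ).smulRight v : ℝ →L[ℝ] E) =
      (mfderiv 𝓘(ℝ, ℝ) 𝓘(ℝ, E) γ 0 : ℝ →L[ℝ] E) := by
    refine ContinuousLinearMap.ext_ring ?_
    have : ((1 : ℝ →L[ℝ] ℝ).smulRight v) 1 = v := by simp
    exact this.trans hv.symm
  exact h1 ▸ h.hasMFDerivAt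

theorem HasMFDerivAt.velocity_eq {γ : ℝ → M} {L : ℝ →L[ℝ] E}
    (h : HasMFDerivAt 𝓘(ℝ, ℝ) 𝓘(ℝ, E) γ 0 L) : velocity E γ = L 1 := by
  have : (mfderiv 𝓘(ℝ, ℝ) 𝓘(ℝ, E) γ 0 : ℝ →L[ℝ] E) = L := h.mfderiv
  exact DFunLike.congr_fun this 1

theorem velocity_comp {E' : Type*} [NormedAddCommGroup E'] [NormedSpace ℝ E']
    {M' : Type*} [TopologicalSpace M'] [ChartedSpace E' M'] {γ : ℝ → M} {f : M → M'}
    (hf : MDifferentiableAt 𝓘(ℝ, E) 𝓘(ℝ, E') f (γ 0))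
    (hγ : MDifferentiableAt 𝓘(ℝ, ℝ) 𝓘(ℝ, E) γ 0) :
    velocity E' (fun t => f (γ t)) =
      (mfderiv 𝓘(ℝ, E) 𝓘(ℝ, E') f (γ 0) : E →L[ℝ] E') (velocity E γ) := by
  have : (mfderiv 𝓘(ℝ, ℝ) 𝓘(ℝ, E') (f ∘ γ) 0 : ℝ →L[ℝ] E') =
      (mfderiv 𝓘(ℝ, E) 𝓘(ℝ, E') f (γ 0) : E →L[ℝ] E') ∘L
        (mfderiv 𝓘(ℝ, ℝ) 𝓘(ℝ, E) γ 0 : ℝ →L[ℝ] E) := mfderiv_comp 0 hf hγ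
  exact DFunLike.congr_fun this 1

theorem velocity_eq_deriv (γ : ℝ → E) : velocity E γ = deriv γ 0 := by
  have : (mfderiv 𝓘(ℝ, ℝ) 𝓘(ℝ, E) γ 0 : ℝ →L[ℝ] E) = fderiv ℝ γ 0 := mfderiv_eq_fderiv
  have h : (fderiv ℝ γ 0 : ℝ →L[ℝ] E) 1 = deriv γ 0 := fderiv_apply_one_eq_deriv
  exact h ▸ DFunLike.congr_fun this 1

end Velocity

namespace LinearSlice

variable {G : Type*} [Group G] [TopologicalSpace G]
  {E : Type*} [NormedAddCommGroup E] [NormedSpace ℝ E]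
  {M : Type*} [TopologicalSpace M] [ChartedSpace E M] [MulAction G M] {m : M}
  (S : LinearSlice G E m)

open Classical in
/-- The `G`-invariant extension by zero of an invariant function on the slice. -/
noncomputable def extendFunction (ψ : E → ℝ) (x : M) : ℝ :=
  if h : ∃ p : G × E, p.2 ∈ S.slice ∧ x = p.1 • S.φ.symm p.2 then ψ h.choose.2 else 0

/-- The arbitrary choice in the definition is harmless: two representations differ by the isotropy
group, under which `ψ` is invariant. -/
theorem extendFunction_smul_symm {ψ : E → ℝ} (hψ : ∀ k, ∀ s ∈ S.slice, ψ (S.ρ k s) = ψ s) (g : G)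
    {s : E} (hs : s ∈ S.slice) : S.extendFunction ψ (g • S.φ.symm s) = ψ s := by
  have h : ∃ p : G × E, p.2 ∈ S.slice ∧ g • S.φ.symm s = p.1 • S.φ.symm p.2 := ⟨(g, s), hs, rfl⟩
  rw [extendFunction, dif_pos h]
  obtain ⟨h1, h2⟩ := h.choose_spec
  obtain ⟨k, hk, -⟩ := S.exists_of_smul_eq_smul hs h1 h2
  rw [← hk, hψ k s hs]

theorem extendFunction_symm {ψ : E → ℝ} (hψ : ∀ k, ∀ s ∈ S.slice, ψ (S.ρ k s) = ψ s) {e : E}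
    (he : e ∈ S.φ.target) : S.extendFunction ψ (S.φ.symm e) = ψ (e - S.P e) := by
  obtain ⟨g, hg⟩ := S.exists_smul_slice he
  rw [hg, S.extendFunction_smul_symm hψ g (S.sub_mem_slice he)]

theorem extendFunction_of_notMem {ψ : E → ℝ} {x : M} (hx : x ∉ S.tube) :
    S.extendFunction ψ x = 0 := by
  rw [extendFunction, dif_neg]
  rintro ⟨⟨g, s⟩, hs, rfl⟩
  exact hx ⟨g, s, hs, rfl⟩

theorem extendFunction_smul {ψ : E → ℝ} (hψ : ∀ k, ∀ s ∈ S.slice, ψ (S.ρ k s) = ψ s) (g : G)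
    (x : M) : S.extendFunction ψ (g • x) = S.extendFunction ψ x := by
  by_cases hx : x ∈ S.tube
  · obtain ⟨a, s, hs, rfl⟩ := hx
    rw [← mul_smul, S.extendFunction_smul_symm hψ _ hs, S.extendFunction_smul_symm hψ _ hs]
  · rw [S.extendFunction_of_notMem hx, S.extendFunction_of_notMem]
    rwa [S.smul_mem_tube_iff]

/-- The closed tube of radius `r`. -/
def closedTube (r : ℝ) : Set M := {x | ∃ (g : G), ∃ s ∈ S.slice, S.q s ≤ r ∧ x = g • S.φ.symm s}

-- For a proper action, `G` times a compact set is closed. This lets functions supported in a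
-- smaller tube be extended by zero.
open scoped Pointwise in
theorem isClosed_closedTube [FiniteDimensional ℝ E] [ProperSMul G M] {r : ℝ} (hr : r < S.δ) :
    IsClosed (S.closedTube r) := by
  set C : Set E := {s | S.P s = 0} ∩ {s | S.q s ≤ r} with hC
  have hCcl : IsClosed C :=
    (isClosed_eq S.P.continuous continuous_const).inter
      (isClosed_le S.contDiff_q.continuous continuous_const)
  obtain ⟨c, hc, hcq⟩ := S.le_q
  have hCb : C ⊆ Metric.closedBall 0 (Real.sqrt (r / c)) := by
    intro s hs
    rw [mem_closedBall_zero_iff]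
    apply Real.le_sqrt_of_sq_le
    rw [le_div_iff₀ hc, mul_comm]
    exact (hcq s).trans hs.2
  have : ProperSpace E := FiniteDimensional.proper ℝ E
  have hCc : IsCompact C := (isCompact_closedBall _ _).of_isClosed_subset hCcl hCb
  have hCs : C ⊆ S.slice := fun s hs => ⟨hs.1, lt_of_le_of_lt hs.2 hr⟩
  have himg : IsCompact (S.φ.symm '' C) :=
    hCc.image_of_continuousOn (S.φ.continuousOn_symm.mono (hCs.trans S.slice_subset_target))
  convert (isClosed_univ (X := G)).smul_right_of_isCompact himg using 1
  ext x
  simp only [closedTube, Set.mem_ofPred_eq, Set.mem_smul, Set.mem_univ, true_and, Set.mem_image]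
  constructor
  · rintro ⟨g, s, hs, hq, rfl⟩
    exact ⟨g, _, ⟨s, ⟨hs.1, hq⟩, rfl⟩, rfl⟩
  · rintro ⟨g, _, ⟨s, hs, rfl⟩, rfl⟩
    exact ⟨g, s, hCs hs, hs.2, rfl⟩

theorem closedTube_subset_tube (r : ℝ) : S.closedTube r ⊆ S.tube := by
  rintro x ⟨g, s, hs, -, rfl⟩
  exact ⟨g, s, hs, rfl⟩

theorem extendFunction_of_notMem_closedTube {ψ : E → ℝ}
    (hψ : ∀ k, ∀ s ∈ S.slice, ψ (S.ρ k s) = ψ s) {r : ℝ}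
    (hsupp : ∀ s ∈ S.slice, r < S.q s → ψ s = 0) {x : M} (hx : x ∉ S.closedTube r) :
    S.extendFunction ψ x = 0 := by
  by_cases h : x ∈ S.tube
  · obtain ⟨g, s, hs, rfl⟩ := h
    rw [S.extendFunction_smul_symm hψ g hs]
    refine hsupp s hs (not_le.1 fun hle => hx ⟨g, s, hs, hle, rfl⟩)
  · exact S.extendFunction_of_notMem h

/-- Invariance moves any point of the tube to the slice chart, where the extension is e ↦ ψ (e - P
e). Off the tube it vanishes nearby, since the closed tube is closed. -/
theorem contMDiff_extendFunction (EG : Type*) [NormedAddCommGroup EG] [NormedSpace ℝ EG]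
    [ChartedSpace EG G] [ContMDiffSMul 𝓘(ℝ, EG) 𝓘(ℝ, E) ∞ G M] [ProperSMul G M]
    [FiniteDimensional ℝ E] [IsManifold 𝓘(ℝ, E) ∞ M] {ψ : E → ℝ}
    (hψ : ∀ k, ∀ s ∈ S.slice, ψ (S.ρ k s) = ψ s) (hs : ContDiffOn ℝ ∞ ψ S.φ.target) {r : ℝ}
    (hr : r < S.δ) (hsupp : ∀ s ∈ S.slice, r < S.q s → ψ s = 0) :
    ContMDiff 𝓘(ℝ, E) 𝓘(ℝ, ℝ) ∞ (S.extendFunction ψ) := by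
  intro x
  by_cases hx : x ∈ S.tube
  · obtain ⟨g, s, hss, rfl⟩ := hx
    have hst := S.slice_subset_target hss
    have h1 : ContMDiffAt 𝓘(ℝ, E) 𝓘(ℝ, ℝ) ∞ (fun y => ψ (S.φ y - S.P (S.φ y))) (S.φ.symm s) := by
      have h2 := contMDiffAt_of_mem_maximalAtlas S.mem_atlas (S.φ.map_target hst)
      have h3 : ContDiffAt ℝ ∞ (fun e => ψ (e - S.P e)) (S.φ (S.φ.symm s)) := by
        rw [S.φ.right_inv hst]
        refine ContDiffAt.comp (g := ψ) s ?_ (by fun_prop)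
        rw [hss.1, sub_zero]
        exact hs.contDiffAt (S.φ.open_target.mem_nhds hst)
      exact h3.contMDiffAt.comp _ h2
    have h2 : ContMDiffAt 𝓘(ℝ, E) 𝓘(ℝ, ℝ) ∞ (S.extendFunction ψ) (S.φ.symm s) := by
      refine h1.congr_of_eventuallyEq ?_
      filter_upwards [S.φ.open_source.mem_nhds (S.φ.map_target hst)] with y hy
      rw [← S.extendFunction_symm hψ (S.φ.map_source hy), S.φ.left_inv hy]
    have h3 : S.extendFunction ψ = fun y => S.extendFunction ψ (g⁻¹ • y) :=
      funext fun y => (S.extendFunction_smul hψ g⁻¹ y).symm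
    rw [h3]
    refine ContMDiffAt.comp (g := S.extendFunction ψ) (f := fun y : M => g⁻¹ • y) _ ?_
      (ContMDiffSMul.contMDiff_const_smul (I := 𝓘(ℝ, EG)) g⁻¹).contMDiffAt
    rwa [inv_smul_smul]
  · refine (contMDiffAt_const (c := (0 : ℝ))).congr_of_eventuallyEq ?_
    have h1 := (S.isClosed_closedTube hr).isOpen_compl.mem_nhds
      (fun h => hx (S.closedTube_subset_tube r h))
    filter_upwards [h1] with y hy
    exact S.extendFunction_of_notMem_closedTube hψ hsupp hy

/-- An invariant field of fixed directions along the slice, with support of radius `r`. -/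
structure IsInvariantField (ξ : E → E) (r : ℝ) : Prop where
  contDiffOn : ContDiffOn ℝ ∞ ξ S.φ.target
  P_eq : ∀ s ∈ S.slice, S.P (ξ s) = 0
  Q_eq : ∀ s ∈ S.slice, S.Q (ξ s) = ξ s
  map_ρ : ∀ k, ∀ s ∈ S.slice, ξ (S.ρ k s) = ξ s
  support : ∀ s ∈ S.slice, r < S.q s → ξ s = 0

/-- The curve through a point of the tube in a direction along the slice. -/
def curve (ξ : E → E) (g : G) (s : E) (t : ℝ) : M := g • S.φ.symm (s + t • ξ s)

open Classical in
/-- The `G`-invariant extension by zero of a field of fixed directions along the slice. -/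
noncomputable def extendField (ξ : E → E) (x : M) : E :=
  if h : ∃ p : G × E, p.2 ∈ S.slice ∧ x = p.1 • S.φ.symm p.2 then
    velocity E (S.curve ξ h.choose.1 h.choose.2) else 0

variable {S} {ξ : E → E} {r : ℝ}

theorem IsInvariantField.eventually_mem_slice (hξ : S.IsInvariantField ξ r) {s : E}
    (hs : s ∈ S.slice) : ∃ ε > (0 : ℝ), ∀ t ∈ Set.Ioo (-ε) ε, s + t • ξ s ∈ S.slice := by
  have hc : Continuous fun t : ℝ => S.q (s + t • ξ s) :=
    S.contDiff_q.continuous.comp (by fun_prop)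
  have h1 : ∀ᶠ t in 𝓝 (0 : ℝ), S.q (s + t • ξ s) < S.δ :=
    hc.continuousAt.eventually_lt_const (by simpa using hs.2)
  obtain ⟨ε, hε, h2⟩ := Metric.eventually_nhds_iff.1 h1
  refine ⟨ε, hε, fun t ht => ⟨?_, h2 (by simpa [abs_lt] using ht)⟩⟩
  rw [map_add, map_smul, hs.1, hξ.P_eq s hs, smul_zero, add_zero]

theorem IsInvariantField.eventually_nhds_mem_slice (hξ : S.IsInvariantField ξ r) {s : E}
    (hs : s ∈ S.slice) : ∀ᶠ t in 𝓝 (0 : ℝ), s + t • ξ s ∈ S.slice := by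
  obtain ⟨ε, hε, h⟩ := hξ.eventually_mem_slice hs
  exact Filter.mem_of_superset (Ioo_mem_nhds (neg_lt_zero.2 hε) hε) h

/-- Independence of the representation holds because `ξ s` is a fixed vector: an isotropy element
carries s + t ξ(s) to k s + t ξ(k s). -/
theorem IsInvariantField.extendField_smul_symm (hξ : S.IsInvariantField ξ r) (g : G) {s : E}
    (hs : s ∈ S.slice) :
    S.extendField ξ (g • S.φ.symm s) = velocity E (S.curve ξ g s) := by
  have h : ∃ p : G × E, p.2 ∈ S.slice ∧ g • S.φ.symm s = p.1 • S.φ.symm p.2 := ⟨(g, s), hs, rfl⟩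
  rw [extendField, dif_pos h]
  obtain ⟨h1, h2⟩ := h.choose_spec
  obtain ⟨k, hk, hg⟩ := S.exists_of_smul_eq_smul hs h1 h2
  set g' := h.choose.1
  set s' := h.choose.2
  refine velocity_congr ?_
  filter_upwards [hξ.eventually_nhds_mem_slice hs] with t ht
  simp only [curve]
  rw [hg, mul_smul, S.smul_symm k _ ht.1 ht.2, map_add, map_smul, hk, ← hk, hξ.map_ρ k s hs,
    ← hξ.Q_eq s hs, S.ρ_Q]

theorem extendField_of_notMem {x : M} (hx : x ∉ S.tube) :
    S.extendField ξ x = 0 := by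
  rw [extendField, dif_neg]
  rintro ⟨⟨g, s⟩, hs, rfl⟩
  exact hx ⟨g, s, hs, rfl⟩

theorem IsInvariantField.contMDiffAt_curve (EG : Type*) [NormedAddCommGroup EG] [NormedSpace ℝ EG]
    [ChartedSpace EG G] [ContMDiffSMul 𝓘(ℝ, EG) 𝓘(ℝ, E) ∞ G M] (g : G) {s : E} {t : ℝ}
    (ht : s + t • ξ s ∈ S.slice) :
    ContMDiffAt 𝓘(ℝ, ℝ) 𝓘(ℝ, E) ∞ (S.curve ξ g s) t := by
  refine (ContMDiffSMul.contMDiff_const_smul (I := 𝓘(ℝ, EG)) g).contMDiffAt.comp t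
    (f := fun t => S.φ.symm (s + t • ξ s)) ?_
  refine (contMDiffAt_symm_of_mem_maximalAtlas S.mem_atlas (S.slice_subset_target ht)).comp t
    (f := fun t => s + t • ξ s) ?_
  exact (by fun_prop : ContDiff ℝ ∞ fun t : ℝ => s + t • ξ s).contMDiff.contMDiffAt

theorem curve_zero (g : G) (s : E) : S.curve ξ g s 0 = g • S.φ.symm s := by simp [curve]

theorem IsInvariantField.mdifferentiableAt_curve (EG : Type*) [NormedAddCommGroup EG]
    [NormedSpace ℝ EG]
    [ChartedSpace EG G] [ContMDiffSMul 𝓘(ℝ, EG) 𝓘(ℝ, E) ∞ G M] (g : G) {s : E}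
    (hs : s ∈ S.slice) : MDifferentiableAt 𝓘(ℝ, ℝ) 𝓘(ℝ, E) (S.curve ξ g s) 0 :=
  (contMDiffAt_curve EG g (by simpa using hs)).mdifferentiableAt (by simp)

/-- The extended field is invariant. -/
theorem IsInvariantField.mfderiv_extendField (EG : Type*) [NormedAddCommGroup EG]
    [NormedSpace ℝ EG]
    [ChartedSpace EG G] [ContMDiffSMul 𝓘(ℝ, EG) 𝓘(ℝ, E) ∞ G M] (hξ : S.IsInvariantField ξ r)
    (g : G) (x : M) :
    (mfderiv 𝓘(ℝ, E) 𝓘(ℝ, E) (fun y : M => g • y) x : E →L[ℝ] E) (S.extendField ξ x) =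
      S.extendField ξ (g • x) := by
  by_cases hx : x ∈ S.tube
  · obtain ⟨a, s, hs, rfl⟩ := hx
    have h1 := velocity_comp (E := E) (E' := E) (γ := S.curve ξ a s) (f := fun y : M => g • y)
      ((ContMDiffSMul.contMDiff_const_smul (I := 𝓘(ℝ, EG)) (n := ∞) g).contMDiffAt.mdifferentiableAt
        (by simp)) (mdifferentiableAt_curve EG a hs)
    rw [curve_zero] at h1
    rw [hξ.extendField_smul_symm a hs, ← mul_smul, hξ.extendField_smul_symm (g * a) hs]
    refine h1.symm.trans (velocity_congr (Filter.Eventually.of_forall fun t => ?_))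
    simp [curve, mul_smul]
  · rw [extendField_of_notMem hx, extendField_of_notMem (x := g • x)]
    · exact map_zero _
    · rwa [S.smul_mem_tube_iff]

/-- The extended field in the slice chart. -/
theorem IsInvariantField.extendField_symm (EG : Type*) [NormedAddCommGroup EG]
    [NormedSpace ℝ EG]
    [ChartedSpace EG G] [ContMDiffSMul 𝓘(ℝ, EG) 𝓘(ℝ, E) ∞ G M] (hξ : S.IsInvariantField ξ r)
    {e : E} (he : e ∈ S.φ.target) :
    S.extendField ξ (S.φ.symm e) =
      (mfderivWithin 𝓘(ℝ, E) 𝓘(ℝ, E) S.φ.symm S.φ.target e : E →L[ℝ] E) (ξ (e - S.P e)) := by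
  obtain ⟨g, hg⟩ := S.exists_smul e he
  have hs := S.sub_mem_slice he
  have h0 : S.φ.symm e = g • S.φ.symm (e - S.P e) := hg e he rfl
  set v := ξ (e - S.P e) with hv
  have h1 : S.extendField ξ (S.φ.symm e) = velocity E (fun t : ℝ => S.φ.symm (e + t • v)) := by
    rw [h0, hξ.extendField_smul_symm g hs]
    refine velocity_congr ?_
    have hc : ContinuousAt (fun t : ℝ => e + t • v) 0 := by fun_prop
    filter_upwards [hc.eventually_mem (S.φ.open_target.mem_nhds (by simpa using he))] with t ht
    -- The direction `v` lies in the slice, so the same `g` translates the whole curve from the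
    -- slice.
    have hP : S.P (e + t • v) = S.P e := by
      rw [map_add, map_smul, hv, hξ.P_eq _ hs, smul_zero, add_zero]
    rw [hg _ ht hP, curve]
    rw [← hv, add_sub_right_comm]
  rw [h1]
  have hd : MDifferentiableAt 𝓘(ℝ, E) 𝓘(ℝ, E) S.φ.symm e :=
    (contMDiffAt_symm_of_mem_maximalAtlas S.mem_atlas he).mdifferentiableAt (by simp)
  have h2 := velocity_comp (E := E) (E' := E) (γ := fun t : ℝ => e + t • v) (f := S.φ.symm)
    (by simpa using hd) (by
      exact ((by fun_prop : DifferentiableAt ℝ (fun t : ℝ => e + t • v) 0)).mdifferentiableAt)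
  rw [h2, velocity_eq_deriv]
  have h3 : deriv (fun t : ℝ => e + t • v) 0 = v := by
    have := ((hasDerivAt_id (0 : ℝ)).smul_const v).const_add e
    simpa using this.deriv
  rw [h3]
  have h4 : (mfderivWithin 𝓘(ℝ, E) 𝓘(ℝ, E) S.φ.symm S.φ.target e : E →L[ℝ] E) =
      mfderiv 𝓘(ℝ, E) 𝓘(ℝ, E) S.φ.symm e := mfderivWithin_of_isOpen S.φ.open_target he
  rw [h4]
  have h5 : e + (0 : ℝ) • v = e := by simp
  exact congrArg (fun y => (mfderiv 𝓘(ℝ, E) 𝓘(ℝ, E) S.φ.symm y : E →L[ℝ] E) v) h5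

/-- The extended field is smooth. -/
theorem IsInvariantField.contMDiff_extendField (EG : Type*) [NormedAddCommGroup EG]
    [NormedSpace ℝ EG] [FiniteDimensional ℝ E] [IsManifold 𝓘(ℝ, E) ∞ M] [ProperSMul G M]
    [ChartedSpace EG G] [ContMDiffSMul 𝓘(ℝ, EG) 𝓘(ℝ, E) ∞ G M] (hξ : S.IsInvariantField ξ r)
    (hr : r < S.δ) :
    ContMDiff 𝓘(ℝ, E) 𝓘(ℝ, E).tangent ∞
      (fun x => (⟨x, S.extendField ξ x⟩ : TangentBundle 𝓘(ℝ, E) M)) := by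
  set T : M → TangentBundle 𝓘(ℝ, E) M := fun x => ⟨x, S.extendField ξ x⟩ with hT
  have hsrc : ContMDiffOn 𝓘(ℝ, E) 𝓘(ℝ, E).tangent ∞ T S.φ.source := by
    have h1 := (contMDiffOn_symm_of_mem_maximalAtlas S.mem_atlas).contMDiffOn_tangentMapWithin
      (m := ∞) (by simp) S.φ.open_target.uniqueMDiffOn
    have h2 : ContMDiffOn 𝓘(ℝ, E) 𝓘(ℝ, E).tangent ∞
        (fun e : E => (⟨e, ξ (e - S.P e)⟩ : TangentBundle 𝓘(ℝ, E) E)) S.φ.target := by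
      refine contMDiffOn_vectorSpace_iff_contDiffOn (V := fun e : E => (ξ (e - S.P e) : E)).2 ?_
      refine hξ.contDiffOn.comp (by fun_prop) fun e he => ?_
      exact S.slice_subset_target (S.sub_mem_slice he)
    have h3 := (h1.comp h2 fun e he => he).comp
      (contMDiffOn_of_mem_maximalAtlas S.mem_atlas) fun x hx => S.φ.map_source hx
    refine h3.congr fun x hx => ?_
    have h4 : ∀ e ∈ S.φ.target, T (S.φ.symm e) =
        tangentMapWithin 𝓘(ℝ, E) 𝓘(ℝ, E) S.φ.symm S.φ.target ⟨e, ξ (e - S.P e)⟩ := by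
      intro e he
      simp only [hT, tangentMapWithin]
      rw [hξ.extendField_symm EG he]
    have h5 := h4 _ (S.φ.map_source hx)
    rw [S.φ.left_inv hx] at h5
    exact h5
  intro x
  by_cases hx : x ∈ S.tube
  · obtain ⟨g, s, hs, rfl⟩ := hx
    have h1 : ContMDiffAt 𝓘(ℝ, E) 𝓘(ℝ, E).tangent ∞ T (S.φ.symm s) :=
      hsrc.contMDiffAt (S.φ.open_source.mem_nhds (S.φ.map_target (S.slice_subset_target hs)))
    have h2 : ∀ y, T (g • y) = tangentMap 𝓘(ℝ, E) 𝓘(ℝ, E) (fun y : M => g • y) (T y) := by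
      intro y
      simp only [hT, tangentMap]
      rw [hξ.mfderiv_extendField EG g y]
    -- Invariance writes the field near `g • y` through the field near `y`, so smoothness need only
    -- be known in the slice chart.
    have h3 : T = fun y => tangentMap 𝓘(ℝ, E) 𝓘(ℝ, E) (fun y : M => g • y) (T (g⁻¹ • y)) :=
      funext fun y => by rw [← h2, smul_inv_smul]
    have h4 : ContMDiff 𝓘(ℝ, E).tangent 𝓘(ℝ, E).tangent ∞
        (tangentMap 𝓘(ℝ, E) 𝓘(ℝ, E) (fun y : M => g • y)) :=
      (ContMDiffSMul.contMDiff_const_smul (I := 𝓘(ℝ, EG)) (n := ∞) g).contMDiff_tangentMap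
        (by simp)
    rw [h3]
    refine h4.contMDiffAt.comp _ ?_
    refine ContMDiffAt.comp (g := T) (f := fun y : M => g⁻¹ • y) _ ?_
      (ContMDiffSMul.contMDiff_const_smul (I := 𝓘(ℝ, EG)) g⁻¹).contMDiffAt
    rwa [inv_smul_smul]
  · have h0 : ContMDiffAt 𝓘(ℝ, E) 𝓘(ℝ, E).tangent ∞
        (fun x : M => (⟨x, 0⟩ : TangentBundle 𝓘(ℝ, E) M)) x :=
      (Bundle.contMDiff_zeroSection ℝ (TangentSpace 𝓘(ℝ, E) : M → Type _)).contMDiffAt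
    refine h0.congr_of_eventuallyEq ?_
    have h1 := (S.isClosed_closedTube hr).isOpen_compl.mem_nhds
      (fun h => hx (S.closedTube_subset_tube r h))
    filter_upwards [h1] with y hy
    have h2 : S.extendField ξ y = (0 : E) := by
      by_cases h : y ∈ S.tube
      · obtain ⟨g, s, hs, rfl⟩ := h
        have hξs : ξ s = 0 :=
          hξ.support s hs (not_le.1 fun hle => hy ⟨g, s, hs, hle, rfl⟩)
        rw [hξ.extendField_smul_symm g hs]
        have : S.curve ξ g s = fun _ => g • S.φ.symm s := by
          ext t
          simp [curve, hξs]
        rw [this, velocity_const]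
      · exact extendField_of_notMem h
    simp only [hT]
    rw [h2]
    rfl

end LinearSlice

/-! ### Lifting a vector field on the orbit space near an orbit -/

section OrbitMap

variable {G M : Type*} [Group G] [MulAction G M]

theorem orbitMap_smul (g : G) (x : M) : orbitMap G (g • x) = orbitMap G x :=
  Quotient.sound ⟨g, rfl⟩

end OrbitMap

namespace LinearSlice

/-! ### Invariant functions near fixed points of the slice -/

section Estimate

variable {G : Type*} [Group G] [TopologicalSpace G]
  {E : Type*} [NormedAddCommGroup E] [NormedSpace ℝ E]
  {M : Type*} [TopologicalSpace M] [ChartedSpace E M] [MulAction G M] {m : M}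
  (S : LinearSlice G E m)

theorem Q_Q (v : E) : S.Q (S.Q v) = S.Q v := S.Q_eq _ fun k => S.ρ_Q k v

theorem exists_radial_cutoff {a b : ℝ} (hab : a < b) : ∃ η : E → ℝ, ContDiff ℝ ∞ η ∧
    (∀ k s, η (S.ρ k s) = η s) ∧ (∀ s, 0 ≤ η s) ∧ (∀ s, S.q s ≤ a → η s = 1) ∧
    (∀ s, b ≤ S.q s → η s = 0) ∧ ∀ s, S.q s < b → 0 < η s := by
  have h0 : 0 < b - a := sub_pos.2 hab
  refine ⟨fun s => Real.smoothTransition ((b - S.q s) / (b - a)),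
    Real.smoothTransition.contDiff.comp ((contDiff_const.sub S.contDiff_q).div_const _),
    fun k s => by simp only [S.q_ρ], fun s => Real.smoothTransition.nonneg _, fun s hs => ?_,
    fun s hs => ?_, fun s hs => ?_⟩
  · refine Real.smoothTransition.one_of_one_le ?_
    rw [le_div_iff₀ h0]
    linarith
  · refine Real.smoothTransition.zero_of_nonpos ?_
    exact div_nonpos_of_nonpos_of_nonneg (by linarith) h0.le
  · exact Real.smoothTransition.pos_of_pos (div_pos (by linarith) h0)

/-- An invariant function has, at a fixed point of the slice, no derivative in the directions that
`Q` kills. -/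
theorem fderiv_eq_zero_of_invariant {F : E → ℝ} (hF : ∀ k, ∀ s ∈ S.slice, F (S.ρ k s) = F s)
    {v : E} (hv : v ∈ S.slice) (hQv : S.Q v = v) (hd : DifferentiableAt ℝ F v) {w : E}
    (hPw : S.P w = 0) (hQw : S.Q w = 0) : fderiv ℝ F v w = 0 := by
  have hline : ∀ u : E, HasDerivAt (fun t : ℝ => F (v + t • u)) (fderiv ℝ F v u) 0 := by
    intro u
    have h1 : HasDerivAt (fun t : ℝ => v + t • u) u 0 := by
      simpa using ((hasDerivAt_id (0 : ℝ)).smul_const u).const_add v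
    have h2 : HasFDerivAt F (fderiv ℝ F v) (v + (0 : ℝ) • u) := by simpa using hd.hasFDerivAt
    exact h2.comp_hasDerivAt _ h1
  set L : E →L[ℝ] ℝ := fderiv ℝ F v ∘L (ContinuousLinearMap.id ℝ E - S.P) with hL
  have hLv : ∀ u, L u = fderiv ℝ F v (u - S.P u) := fun u => rfl
  have hinv : ∀ k u, L (S.ρ k u) = L u := by
    intro k u
    rw [hLv, hLv, ← S.ρ_P, ← map_sub]
    set u' := u - S.P u
    have hPu : S.P u' = 0 := by rw [map_sub, S.P_P, sub_self]
    refine (hline (S.ρ k u')).unique ((hline u').congr_of_eventuallyEq ?_)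
    have hc : Continuous fun t : ℝ => S.q (v + t • u') := S.contDiff_q.continuous.comp (by fun_prop)
    filter_upwards [hc.continuousAt.eventually_lt_const
      (show S.q (v + (0 : ℝ) • u') < S.δ by simpa using hv.2)] with t ht
    rw [← hF k (v + t • u') ⟨by rw [map_add, map_smul, hv.1, hPu, smul_zero, add_zero], ht⟩,
      map_add, map_smul, S.ρ_eq_of_Q_eq hQv]
  have h1 := S.comp_Q L hinv w
  rw [hQw, map_zero, hLv, hPw, sub_zero] at h1
  exact h1.symm

/-- An invariant function agrees with its value at the fixed part, up to second order. -/
theorem exists_abs_sub_Q_le {F : E → ℝ} (hF : ∀ k, ∀ s ∈ S.slice, F (S.ρ k s) = F s)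
    (hs : ContDiffOn ℝ ∞ F S.φ.target) {v : E} (hv : v ∈ S.slice) (hQv : S.Q v = v) :
    ∃ K : ℝ, ∀ᶠ s in 𝓝 v, s ∈ S.slice → |F s - F (S.Q s)| ≤ K * ‖s - S.Q s‖ ^ 2 := by
  have hvt := S.slice_subset_target hv
  have hFv : ContDiffAt ℝ ∞ F v := hs.contDiffAt (S.φ.open_target.mem_nhds hvt)
  have h1 : ContDiffAt ℝ 1 (fderiv ℝ F) v := by
    refine hFv.fderiv_right ?_
    rw [one_add_one_eq_two]
    exact WithTop.coe_le_coe.2 (le_top : (2 : ℕ∞) ≤ ⊤)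
  obtain ⟨K, t, ht, hK⟩ := h1.exists_lipschitzOnWith
  obtain ⟨r, hr, hrt⟩ := Metric.mem_nhds_iff.1 (Filter.inter_mem ht (S.φ.open_target.mem_nhds hvt))
  refine ⟨K, ?_⟩
  have hQc : ContinuousAt S.Q v := S.Q.continuous.continuousAt
  filter_upwards [Metric.ball_mem_nhds v hr,
    hQc.eventually_mem (by rw [hQv]; exact Metric.ball_mem_nhds v hr)] with s hsb hQsb hss
  have hQs : S.Q s ∈ S.slice := by
    have hP : S.P (S.Q s) = 0 := by rw [← S.Q_P, hss.1, map_zero]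
    refine ⟨hP, ?_⟩
    have := (S.mem_target.1 (hrt hQsb).2).1
    rwa [hP, sub_zero] at this
  have hdiff : ∀ y ∈ Metric.ball v r, HasFDerivAt F (fderiv ℝ F y) y := fun y hy =>
    ((hs.contDiffAt (S.φ.open_target.mem_nhds (hrt hy).2)).differentiableAt (by simp)).hasFDerivAt
  have hseg : segment ℝ (S.Q s) s ⊆ Metric.ball v r := (convex_ball v r).segment_subset hQsb hsb
  have h0 : fderiv ℝ F (S.Q s) (s - S.Q s) = 0 :=
    S.fderiv_eq_zero_of_invariant hF hQs (S.Q_Q s) (hdiff _ hQsb).differentiableAt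
      (by rw [map_sub, hss.1, hQs.1, sub_zero]) (by rw [map_sub, S.Q_Q, sub_self])
  -- The mean value inequality relative to the derivative at `Q s`, which kills `s - Q s`. The
  -- Lipschitz bound on the derivative supplies the second factor ‖s - Q s‖.
  have h2 := (convex_segment (𝕜 := ℝ) (S.Q s) s).norm_image_sub_le_of_norm_hasFDerivWithin_le'
    (f := F) (f' := fderiv ℝ F) (φ := fderiv ℝ F (S.Q s)) (C := K * ‖s - S.Q s‖)
    (fun y hy => (hdiff y (hseg hy)).hasFDerivWithinAt) (fun y hy => ?_)
    (left_mem_segment ℝ (S.Q s) s) (right_mem_segment ℝ (S.Q s) s)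
  · rw [h0, sub_zero, Real.norm_eq_abs] at h2
    exact h2.trans_eq (by ring)
  · have h3 := hK.norm_sub_le (hrt (hseg hy)).1 (hrt hQsb).1
    refine h3.trans ?_
    gcongr
    exact norm_sub_le_of_mem_segment hy

/-- The derivative of an invariant function along a curve in the slice whose
transversal part is stationary. -/
theorem hasDerivAt_comp_of_transversal {F : E → ℝ}
    (hF : ∀ k, ∀ s ∈ S.slice, F (S.ρ k s) = F s)
    (hs : ContDiffOn ℝ ∞ F S.φ.target) {v : E} (hv : v ∈ S.slice) (hQv : S.Q v = v)
    {σ : ℝ → E} (h0 : σ 0 = v) (hσ : ∀ᶠ t in 𝓝 0, σ t ∈ S.slice) {a : E}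
    (ha : HasDerivAt (fun t => S.Q (σ t)) a 0)
    (hR : HasDerivAt (fun t => S.q (σ t - S.Q (σ t))) 0 0) :
    HasDerivAt (fun t => F (σ t)) (fderiv ℝ F v a) 0 := by
  obtain ⟨c, hc, hcq⟩ := S.le_q
  have hR0 : S.q (σ 0 - S.Q (σ 0)) = 0 := by rw [h0, hQv, sub_self, S.q_zero]
  have hRlim : Filter.Tendsto (fun t => S.q (σ t - S.Q (σ t))) (𝓝 0) (𝓝 0) := by
    have := hR.continuousAt.tendsto
    rwa [hR0] at this
  -- No continuity of `σ` is assumed. It is recovered at 0 from the coercivity of `q`.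
  have hlim1 : Filter.Tendsto (fun t => σ t - S.Q (σ t)) (𝓝 0) (𝓝 0) := by
    rw [tendsto_zero_iff_norm_tendsto_zero]
    have h1 : Filter.Tendsto (fun t => Real.sqrt (S.q (σ t - S.Q (σ t)) / c)) (𝓝 0) (𝓝 0) := by
      have := (hRlim.div_const c).sqrt
      simpa using this
    refine squeeze_zero (fun t => norm_nonneg _) (fun t => ?_) h1
    apply Real.le_sqrt_of_sq_le
    rw [le_div_iff₀ hc, mul_comm]
    exact hcq _
  have hlim2 : Filter.Tendsto (fun t => S.Q (σ t)) (𝓝 0) (𝓝 v) := by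
    have := ha.continuousAt.tendsto
    rwa [h0, hQv] at this
  have hlim : Filter.Tendsto σ (𝓝 0) (𝓝 v) := by
    have := hlim1.add hlim2
    simpa using this
  obtain ⟨K, hK⟩ := S.exists_abs_sub_Q_le hF hs hv hQv
  have hFd : HasFDerivAt F (fderiv ℝ F v) (S.Q (σ 0)) := by
    rw [h0, hQv]
    exact ((hs.contDiffAt (S.φ.open_target.mem_nhds
      (S.slice_subset_target hv))).differentiableAt (by simp)).hasFDerivAt
  have h1 : HasDerivAt (fun t => F (S.Q (σ t))) (fderiv ℝ F v a) 0 := hFd.comp_hasDerivAt 0 ha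
  -- The difference is bounded by a multiple of q (σ t - Q (σ t)), which is o(t) by `hR`.
  have h2 : HasDerivAt (fun t => F (σ t) - F (S.Q (σ t))) 0 0 := by
    rw [hasDerivAt_iff_isLittleO] at hR ⊢
    refine Asymptotics.IsBigO.trans_isLittleO (Asymptotics.IsBigO.of_bound (|K| / c) ?_) hR
    filter_upwards [hσ, hlim.eventually hK] with t ht hKt
    have h3 := hcq (σ t - S.Q (σ t))
    have h4 : 0 ≤ S.q (σ t - S.Q (σ t)) := (by positivity : (0 : ℝ) ≤ _).trans h3
    simp only [hR0, smul_zero, sub_zero, Real.norm_eq_abs]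
    rw [h0, hQv, sub_self, sub_zero, abs_of_nonneg h4]
    calc _ ≤ K * ‖σ t - S.Q (σ t)‖ ^ 2 := hKt ht
      _ ≤ |K| * ‖σ t - S.Q (σ t)‖ ^ 2 := by gcongr; exact le_abs_self K
      _ = |K| / c * (c * ‖σ t - S.Q (σ t)‖ ^ 2) := by field_simp
      _ ≤ _ := by gcongr
  have h3 := h2.add h1
  rw [zero_add] at h3
  exact h3.congr_of_eventuallyEq (Filter.Eventually.of_forall fun t => by simp)

end Estimate

section OrbitFunction

variable {G : Type*} [Group G] [TopologicalSpace G]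
  {E : Type*} [NormedAddCommGroup E] [NormedSpace ℝ E] [FiniteDimensional ℝ E]
  {M : Type*} [TopologicalSpace M] [ChartedSpace E M] [IsManifold 𝓘(ℝ, E) ∞ M]
  [MulAction G M] [ProperSMul G M] {m : M}

theorem exists_smoothOrbitFunction (EG : Type*) [NormedAddCommGroup EG]
    [NormedSpace ℝ EG] [ChartedSpace EG G] [ContMDiffSMul 𝓘(ℝ, EG) 𝓘(ℝ, E) ∞ G M]
    (S : LinearSlice G E m) {ψ : E → ℝ} (hψ : ∀ k, ∀ s ∈ S.slice, ψ (S.ρ k s) = ψ s)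
    (hs : ContDiffOn ℝ ∞ ψ S.φ.target) {r : ℝ}
    (hr : r < S.δ) (hsupp : ∀ s ∈ S.slice, r < S.q s → ψ s = 0) :
    ∃ f : smoothOrbitFunctions E G M, ∀ x,
      (f : MulAction.orbitRel.Quotient G M → ℝ) (orbitMap G x) = S.extendFunction ψ x :=
  ⟨⟨fun o => Quotient.liftOn' o (S.extendFunction ψ) (by
      rintro _ y ⟨g, rfl⟩
      exact S.extendFunction_smul hψ g y),
    S.contMDiff_extendFunction EG hψ hs hr hsupp⟩, fun x => rfl⟩

end OrbitFunction

end LinearSlice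

section LocalLift

variable {G : Type*} [Group G] [TopologicalSpace G]
  {E : Type*} [NormedAddCommGroup E] [NormedSpace ℝ E]
  {M : Type*} [TopologicalSpace M] [ChartedSpace E M] [MulAction G M]

theorem LinearSlice.contDiffOn_orbitFunction {m : M} (S : LinearSlice G E m)
    (f : smoothOrbitFunctions E G M) :
    ContDiffOn ℝ ∞ (fun e => (f : MulAction.orbitRel.Quotient G M → ℝ) (orbitMap G (S.φ.symm e)))
      S.φ.target := by
  have h : ContMDiff 𝓘(ℝ, E) 𝓘(ℝ, ℝ) ∞
    (fun x : M => (f : MulAction.orbitRel.Quotient G M → ℝ) (orbitMap G x)) := f.2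
  exact (h.comp_contMDiffOn (contMDiffOn_symm_of_mem_maximalAtlas S.mem_atlas)).contDiffOn

theorem LinearSlice.orbitMap_symm_ρ {m : M} (S : LinearSlice G E m)
    (k : MulAction.stabilizer G m) {s : E} (hs : s ∈ S.slice) :
    orbitMap G (S.φ.symm (S.ρ k s)) = orbitMap G (S.φ.symm s) := by
  rw [← S.smul_symm k s hs.1 hs.2, orbitMap_smul]

/-- In a slice chart, a derivation with integral curves is, at fixed points of the slice, the
derivative in a direction of fixed vectors, determined by its values on the coordinates. -/
theorem LinearSlice.derivation_apply_eq_fderiv {m : M} (S : LinearSlice G E m)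
    {Y : Derivation ℝ (smoothOrbitFunctions E G M) (smoothOrbitFunctions E G M)}
    {η κ : E → ℝ} (hη : ∀ k s, η (S.ρ k s) = η s) (hκ : ∀ k s, κ (S.ρ k s) = κ s)
    (hκη : ∀ s, κ s ≠ 0 → η s = 1) {ι : Type*} [Fintype ι] (b : Module.Basis ι ℝ E)
    {V : ι → smoothOrbitFunctions E G M}
    (hV : ∀ i x, (V i : MulAction.orbitRel.Quotient G M → ℝ) (orbitMap G x) =
      S.extendFunction (fun s => η s * b.repr (S.Q s) i) x)
    {R c : smoothOrbitFunctions E G M}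
    (hR : ∀ x, (R : MulAction.orbitRel.Quotient G M → ℝ) (orbitMap G x) =
      S.extendFunction (fun s => η s * S.q (s - S.Q s)) x)
    (hc : ∀ x, (c : MulAction.orbitRel.Quotient G M → ℝ) (orbitMap G x) = S.extendFunction κ x)
    (f : smoothOrbitFunctions E G M) {v : E} (hv : v ∈ S.slice) (hQv : S.Q v = v)
    (hκv : κ v ≠ 0)
    (hY : ∃ ε > (0 : ℝ), ∃ γ, IsIntegralCurveFrom Y ε (orbitMap G (S.φ.symm v)) γ) :
    (Y f : MulAction.orbitRel.Quotient G M → ℝ) (orbitMap G (S.φ.symm v)) =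
      fderiv ℝ (fun e => (f : MulAction.orbitRel.Quotient G M → ℝ) (orbitMap G (S.φ.symm e))) v
        (∑ i, (Y (V i) : MulAction.orbitRel.Quotient G M → ℝ) (orbitMap G (S.φ.symm v)) •
          S.Q (b i - S.P (b i))) := by
  obtain ⟨ε, hε, γ, hγ0, hγ⟩ := hY
  have hder : ∀ f : smoothOrbitFunctions E G M,
      HasDerivAt (fun t => (f : MulAction.orbitRel.Quotient G M → ℝ) (γ t))
        ((Y f : MulAction.orbitRel.Quotient G M → ℝ) (orbitMap G (S.φ.symm v))) 0 := by
    intro f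
    have := hγ 0 ⟨neg_lt_zero.2 hε, hε⟩ f
    rwa [hγ0] at this
  have hκ' : ∀ k, ∀ s ∈ S.slice, κ (S.ρ k s) = κ s := fun k s _ => hκ k s
  have hlift : ∀ o : MulAction.orbitRel.Quotient G M,
      (c : MulAction.orbitRel.Quotient G M → ℝ) o ≠ 0 →
      ∃ s ∈ S.slice, η s = 1 ∧ o = orbitMap G (S.φ.symm s) := by
    intro o
    induction o using Quotient.inductionOn with
    | h x =>
      intro hx
      have hcx := hc x
      have hx' : S.extendFunction κ x ≠ 0 := hcx ▸ hx
      have hxt : x ∈ S.tube := by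
        by_contra h
        exact hx' (S.extendFunction_of_notMem h)
      obtain ⟨g, s, hs, rfl⟩ := hxt
      rw [S.extendFunction_smul_symm hκ' g hs] at hx'
      exact ⟨s, hs, hκη s hx', orbitMap_smul g _⟩
  -- The lift of `γ` to the slice is a bare choice. Only K-invariant expressions in it will be
  -- differentiated, and these are functions of `γ t`.
  have hex : ∀ t, ∃ s, (t = 0 → s = v) ∧
      ((c : MulAction.orbitRel.Quotient G M → ℝ) (γ t) ≠ 0 →
        s ∈ S.slice ∧ η s = 1 ∧ γ t = orbitMap G (S.φ.symm s)) := by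
    intro t
    by_cases ht : t = 0
    · exact ⟨v, fun _ => rfl, fun _ => ⟨hv, hκη v hκv, by rw [ht, hγ0]⟩⟩
    · by_cases hct : (c : MulAction.orbitRel.Quotient G M → ℝ) (γ t) = 0
      · exact ⟨0, fun h => absurd h ht, fun h => absurd hct h⟩
      · obtain ⟨s, h1, h2, h3⟩ := hlift _ hct
        exact ⟨s, fun h => absurd h ht, fun _ => ⟨h1, h2, h3⟩⟩
  choose σ hσ0 hσ using hex
  -- Nonvanishing of `c` certifies that `γ t` lies over the part of the slice where the cutoff `η`
  -- equals 1. Differentiability of `c ∘ γ` keeps it nonzero for small times.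
  have hcγ : ∀ᶠ t in 𝓝 (0 : ℝ), (c : MulAction.orbitRel.Quotient G M → ℝ) (γ t) ≠ 0 := by
    refine (hder c).continuousAt.eventually_ne ?_
    rw [hγ0, hc, S.extendFunction_symm hκ' (S.slice_subset_target hv), hv.1, sub_zero]
    exact hκv
  have hext : ∀ {ψ : E → ℝ}, (∀ k, ∀ s ∈ S.slice, ψ (S.ρ k s) = ψ s) → ∀ s ∈ S.slice,
      S.extendFunction ψ (S.φ.symm s) = ψ s := by
    intro ψ hψ s hs
    rw [S.extendFunction_symm hψ (S.slice_subset_target hs), hs.1, sub_zero]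
  -- The basis vectors are pushed into the slice and then onto the fixed vectors. `Q (σ t)` already
  -- lies there, so its coordinates recombine to it.
  have hVσ : ∀ᶠ t in 𝓝 (0 : ℝ), ∑ i, (V i : MulAction.orbitRel.Quotient G M → ℝ) (γ t) •
      S.Q (b i - S.P (b i)) = S.Q (σ t) := by
    filter_upwards [hcγ] with t ht
    obtain ⟨h1, h2, h3⟩ := hσ t ht
    have h4 : ∀ i, (V i : MulAction.orbitRel.Quotient G M → ℝ) (γ t) = b.repr (S.Q (σ t)) i := by
      intro i
      rw [h3, hV, hext (fun k s _ => by rw [hη, S.Q_ρ]) _ h1, h2, one_mul]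
    simp only [h4]
    calc _ = S.Q ((∑ i, b.repr (S.Q (σ t)) i • b i) - S.P (∑ i, b.repr (S.Q (σ t)) i • b i)) := by
          simp only [map_sum, map_sub, map_smul, smul_sub, Finset.sum_sub_distrib]
      _ = S.Q (σ t) := by
          rw [b.sum_repr, ← S.Q_P, h1.1, map_zero, sub_zero, S.Q_Q]
  have hRσ : ∀ᶠ t in 𝓝 (0 : ℝ), (R : MulAction.orbitRel.Quotient G M → ℝ) (γ t) =
      S.q (σ t - S.Q (σ t)) := by
    filter_upwards [hcγ] with t ht
    obtain ⟨h1, h2, h3⟩ := hσ t ht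
    rw [h3, hR, hext (fun k s _ => by rw [hη, S.Q_ρ, ← S.ρ_Q k s, ← map_sub, S.q_ρ, S.ρ_Q]) _ h1, h2,
      one_mul]
  have hσv : σ 0 = v := hσ0 0 rfl
  have hq0 : ∀ u, 0 ≤ S.q u := by
    obtain ⟨d, hd, h⟩ := S.le_q
    exact fun u => (by positivity : (0 : ℝ) ≤ d * ‖u‖ ^ 2).trans (h u)
  -- R ∘ γ has a minimum at the interior time 0, so its derivative vanishes.
  have hRmin : (Y R : MulAction.orbitRel.Quotient G M → ℝ) (orbitMap G (S.φ.symm v)) = 0 := by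
    refine IsLocalMin.hasDerivAt_eq_zero ?_ (hder R)
    filter_upwards [hRσ] with t ht
    rw [ht, hRσ.self_of_nhds, hσv, hQv, sub_self, S.q_zero]
    exact hq0 _
  have ha := HasDerivAt.fun_sum (u := Finset.univ) (fun i _ =>
    (hder (V i)).smul_const (S.Q (b i - S.P (b i))))
  have hd := S.hasDerivAt_comp_of_transversal
    (F := fun e => (f : MulAction.orbitRel.Quotient G M → ℝ) (orbitMap G (S.φ.symm e)))
    (fun k s hs => by simp only [S.orbitMap_symm_ρ k hs]) (S.contDiffOn_orbitFunction f) hv hQv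
    (σ := σ) hσv (hcγ.mono fun t ht => (hσ t ht).1)
    (ha.congr_of_eventuallyEq (hVσ.mono fun t ht => ht.symm))
    (by
      have := (hder R).congr_of_eventuallyEq (hRσ.mono fun t ht => ht.symm)
      rwa [hRmin] at this)
  refine (hder f).unique (hd.congr_of_eventuallyEq ?_)
  filter_upwards [hcγ] with t ht
  rw [(hσ t ht).2.2]

/-- `X` is a smooth invariant vector field that on the orbit type of `H` is tangent to the orbit
type and related to the multiple by the smooth invariant function `χ` of the derivation `Y` of the
smooth functions on the orbit space. -/
structure IsWeightedLift (H : Subgroup G)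
    (Y : Derivation ℝ (smoothOrbitFunctions E G M) (smoothOrbitFunctions E G M))
    (χ : M → ℝ) (X : M → E) : Prop where
  contMDiff_weight : ContMDiff 𝓘(ℝ, E) 𝓘(ℝ, ℝ) ∞ χ
  weight_smul : ∀ (g : G) x, χ (g • x) = χ x
  weight_nonneg : ∀ x, 0 ≤ χ x
  contMDiff : ∀ [IsManifold 𝓘(ℝ, E) ∞ M], ContMDiff 𝓘(ℝ, E) 𝓘(ℝ, E).tangent ∞
    (fun x => (⟨x, X x⟩ : TangentBundle 𝓘(ℝ, E) M))
  mfderiv_smul : ∀ (g : G) x,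
    (mfderiv 𝓘(ℝ, E) 𝓘(ℝ, E) (fun y : M => g • y) x : E →L[ℝ] E) (X x) = X (g • x)
  isTangentTo : ∀ x ∈ orbitType M H, IsTangentTo E (orbitType M H) x (X x)
  mfderiv_orbitMap : ∀ x ∈ orbitType M H, ∀ f : smoothOrbitFunctions E G M,
    (mfderiv 𝓘(ℝ, E) 𝓘(ℝ, ℝ)
      (fun y => (f : MulAction.orbitRel.Quotient G M → ℝ) (orbitMap G y)) x : E →L[ℝ] ℝ) (X x) =
      χ x * (Y f : MulAction.orbitRel.Quotient G M → ℝ) (orbitMap G x)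

theorem isTangentTo_of_velocity {T : Set M} {x : M} {v : E} {ε : ℝ} (hε : 0 < ε) {γ : ℝ → M}
    (h0 : γ 0 = x) (hγ : ∀ t ∈ Set.Ioo (-ε) ε, γ t ∈ T)
    (hs : ContMDiffOn 𝓘(ℝ, ℝ) 𝓘(ℝ, E) ∞ γ (Set.Ioo (-ε) ε)) (hv : velocity E γ = v) :
    IsTangentTo E T x v := by
  subst h0
  refine ⟨ε, hε, γ, rfl, hγ, hs, hasMFDerivAt_of_velocity_eq ?_ hv⟩
  exact (hs.contMDiffAt (Ioo_mem_nhds (neg_lt_zero.2 hε) hε)).mdifferentiableAt (by simp)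

end LocalLift

/-- Near each point of an orbit type, a derivation of the smooth functions on the orbit space that
has integral curves lifts to the orbit type. -/
theorem exists_isWeightedLift (EG : Type*) [NormedAddCommGroup EG] [NormedSpace ℝ EG]
    [FiniteDimensional ℝ EG]
    {G : Type*} [TopologicalSpace G] [ChartedSpace EG G] [Group G] [LieGroup 𝓘(ℝ, EG) ∞ G]
    [T2Space G]
    {E : Type*} [NormedAddCommGroup E] [NormedSpace ℝ E] [FiniteDimensional ℝ E]
    {M : Type*} [TopologicalSpace M] [ChartedSpace E M] [IsManifold 𝓘(ℝ, E) ∞ M]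
    [MulAction G M] [ContMDiffSMul 𝓘(ℝ, EG) 𝓘(ℝ, E) ∞ G M] [ProperSMul G M]
    {H : Subgroup G} {m : M} (hm : m ∈ orbitType M H)
    {Y : Derivation ℝ (smoothOrbitFunctions E G M) (smoothOrbitFunctions E G M)}
    (hY : ∀ x, ∃ ε > (0 : ℝ), ∃ γ, IsIntegralCurveFrom Y ε x γ) :
    ∃ (χ : M → ℝ) (X : M → E), IsWeightedLift H Y χ X ∧ 0 < χ m := by
  obtain ⟨S⟩ := exists_linearSlice EG (G := G) E m
  have hδ := S.δ_pos
  -- The weight `κ` lives where q ≤ δ / 2, and there `η` equals 1. Both supports stay inside the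
  -- slice of radius δ.
  obtain ⟨η, hη, hηρ, -, hη1, hη0, -⟩ :=
    S.exists_radial_cutoff (a := S.δ / 2) (b := 3 * S.δ / 4) (by linarith)
  obtain ⟨κ, hκ, hκρ, hκnn, hκ1, hκ0, -⟩ :=
    S.exists_radial_cutoff (a := S.δ / 4) (b := S.δ / 2) (by linarith)
  have hκη : ∀ s, κ s ≠ 0 → η s = 1 := fun s hs =>
    hη1 s (not_lt.1 fun h => hs (hκ0 s h.le))
  have hκ' : ∀ k, ∀ s ∈ S.slice, κ (S.ρ k s) = κ s := fun k s _ => hκρ k s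
  have hκs : ∀ s ∈ S.slice, S.δ / 2 < S.q s → κ s = 0 := fun s _ h => hκ0 s h.le
  let b := Module.finBasis ℝ E
  have hVex : ∀ i, ∃ f : smoothOrbitFunctions E G M, ∀ x,
      (f : MulAction.orbitRel.Quotient G M → ℝ) (orbitMap G x) =
        S.extendFunction (fun s => η s * b.repr (S.Q s) i) x := by
    intro i
    have hlin : ContDiff ℝ ∞ fun s => b.repr (S.Q s) i :=
      (LinearMap.toContinuousLinearMap (b.coord i)).contDiff.comp S.Q.contDiff
    refine LinearSlice.exists_smoothOrbitFunction EG S (fun k s _ => by rw [hηρ, S.Q_ρ])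
      (hη.mul hlin).contDiffOn (r := 3 * S.δ / 4) (by linarith) fun s _ h => ?_
    rw [hη0 s h.le, zero_mul]
  choose V hV using hVex
  obtain ⟨R, hR⟩ := LinearSlice.exists_smoothOrbitFunction EG S
    (ψ := fun s => η s * S.q (s - S.Q s))
    (fun k s _ => by rw [hηρ, S.Q_ρ, ← S.ρ_Q k s, ← map_sub, S.q_ρ, S.ρ_Q])
    (hη.mul (S.contDiff_q.comp (contDiff_id.sub S.Q.contDiff))).contDiffOn
    (r := 3 * S.δ / 4) (by linarith) fun s _ h => by rw [hη0 s h.le, zero_mul]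
  obtain ⟨c, hc⟩ := LinearSlice.exists_smoothOrbitFunction EG S (ψ := κ) hκ' hκ.contDiffOn
    (r := S.δ / 2) (by linarith) hκs
  set A : E → E := fun s => ∑ i, (Y (V i) : MulAction.orbitRel.Quotient G M → ℝ)
    (orbitMap G (S.φ.symm s)) • S.Q (b i - S.P (b i)) with hA
  have hPQ : ∀ w, S.P (S.Q (w - S.P w)) = 0 := fun w => by
    rw [← S.Q_P, map_sub, S.P_P, sub_self, map_zero]
  have hξ : S.IsInvariantField (fun s => κ s • A s) (S.δ / 2) :=
    { contDiffOn := by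
        refine hκ.contDiffOn.smul (ContDiffOn.sum fun i _ => ?_)
        exact (S.contDiffOn_orbitFunction (Y (V i))).smul contDiffOn_const
      P_eq := fun s _ => by
        simp only [hA, map_smul, map_sum, hPQ, smul_zero, Finset.sum_const_zero]
      Q_eq := fun s _ => by simp only [hA, map_smul, map_sum, S.Q_Q]
      map_ρ := fun k s hs => by simp only [hA, hκρ, S.orbitMap_symm_ρ k hs]
      support := fun s hs h => by simp only [hκs s hs h, zero_smul] }
  refine ⟨S.extendFunction κ, S.extendField (fun s => κ s • A s),
    ⟨S.contMDiff_extendFunction EG hκ' hκ.contDiffOn (r := S.δ / 2) (by linarith) hκs,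
      S.extendFunction_smul hκ', fun x => ?_, hξ.contMDiff_extendField EG (by linarith),
      hξ.mfderiv_extendField EG, fun x hx => ?_, fun x hx f => ?_⟩, ?_⟩
  · by_cases hx : x ∈ S.tube
    · obtain ⟨g, s, hs, rfl⟩ := hx
      rw [S.extendFunction_smul_symm hκ' g hs]
      exact hκnn s
    · rw [S.extendFunction_of_notMem hx]
  · by_cases hxt : x ∈ S.tube
    · obtain ⟨g, s, hs, rfl⟩ := hxt
      obtain ⟨ε, hε, hεs⟩ := hξ.eventually_mem_slice hs
      have hQs := (S.smul_symm_mem_orbitType_iff EG hm g hs).1 hx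
      refine isTangentTo_of_velocity hε (LinearSlice.curve_zero g s) (fun t ht => ?_) ?_
        (hξ.extendField_smul_symm g hs).symm
      · refine (S.smul_symm_mem_orbitType_iff EG hm g (hεs t ht)).2 ?_
        rw [map_add, map_smul, hQs, hξ.Q_eq s hs]
      · exact fun t ht =>
          (LinearSlice.IsInvariantField.contMDiffAt_curve EG g (hεs t ht)).contMDiffWithinAt
    · rw [LinearSlice.extendField_of_notMem hxt]
      exact isTangentTo_of_velocity one_pos (γ := fun _ => x) rfl (fun _ _ => hx)
        contMDiffOn_const (velocity_const x)
  · by_cases hxt : x ∈ S.tube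
    · obtain ⟨g, s, hs, rfl⟩ := hxt
      have hQs := (S.smul_symm_mem_orbitType_iff EG hm g hs).1 hx
      rw [hξ.extendField_smul_symm g hs, S.extendFunction_smul_symm hκ' g hs]
      have hf : ContMDiff 𝓘(ℝ, E) 𝓘(ℝ, ℝ) ∞
        (fun x : M => (f : MulAction.orbitRel.Quotient G M → ℝ) (orbitMap G x)) := f.2
      have h1 := velocity_comp (E := E) (E' := ℝ) (γ := S.curve (fun s => κ s • A s) g s)
        (hf.contMDiffAt.mdifferentiableAt (by simp))
        (LinearSlice.IsInvariantField.mdifferentiableAt_curve EG g hs)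
      rw [LinearSlice.curve_zero] at h1
      rw [← h1, velocity_eq_deriv]
      simp only [LinearSlice.curve, orbitMap_smul]
      have h2 : HasDerivAt (fun t : ℝ => s + t • κ s • A s) (κ s • A s) 0 := by
        simpa using ((hasDerivAt_id (0 : ℝ)).smul_const (κ s • A s)).const_add s
      set F : E → ℝ := fun e => (f : MulAction.orbitRel.Quotient G M → ℝ)
        (orbitMap G (S.φ.symm e)) with hF
      have h3 : HasFDerivAt F (fderiv ℝ F s) (s + (0 : ℝ) • κ s • A s) := by
        rw [zero_smul, add_zero]
        exact (((S.contDiffOn_orbitFunction f).contDiffAt (S.φ.open_target.mem_nhds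
          (S.slice_subset_target hs))).differentiableAt (by simp)).hasFDerivAt
      have h4 : HasDerivAt (fun t : ℝ => F (s + t • κ s • A s)) (fderiv ℝ F s (κ s • A s)) 0 :=
        HasFDerivAt.comp_hasDerivAt (f := fun t : ℝ => s + t • κ s • A s) (l := F)
          (l' := fderiv ℝ F s) (0 : ℝ) h3 h2
      rw [h4.deriv, map_smul, smul_eq_mul]
      -- Where the weight vanishes both sides are 0. Elsewhere `Y f` is the derivative in the
      -- direction `A s`.
      by_cases hκz : κ s = 0
      · rw [hκz, zero_mul, zero_mul]
      · rw [orbitMap_smul, S.derivation_apply_eq_fderiv hηρ hκρ hκη b hV hR hc f hs hQs hκz (hY _)]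
    · rw [LinearSlice.extendField_of_notMem hxt, S.extendFunction_of_notMem hxt, zero_mul]
      exact (mfderiv 𝓘(ℝ, E) 𝓘(ℝ, ℝ) (fun y => (f : MulAction.orbitRel.Quotient G M → ℝ)
        (orbitMap G y)) x : E →L[ℝ] ℝ).map_zero
  · have h := S.extendFunction_symm hκ' (S.slice_subset_target S.zero_mem_slice)
    rw [S.symm_zero, map_zero, sub_zero] at h
    rw [h, hκ1 0 (by rw [S.q_zero]; linarith)]
    exact one_pos

/-! ### Tangent vectors of an orbit type -/

section Tangent

variable {E : Type*} [NormedAddCommGroup E] [NormedSpace ℝ E]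
  {M : Type*} [TopologicalSpace M] [ChartedSpace E M]

theorem mfderiv_apply_add {E' : Type*} [NormedAddCommGroup E'] [NormedSpace ℝ E']
    {M' : Type*} [TopologicalSpace M'] [ChartedSpace E' M'] (f : M → M') (x : M) (v w : E) :
    (mfderiv 𝓘(ℝ, E) 𝓘(ℝ, E') f x : E →L[ℝ] E') (v + w : E) =
      ((mfderiv 𝓘(ℝ, E) 𝓘(ℝ, E') f x : E →L[ℝ] E') v : E') +
        ((mfderiv 𝓘(ℝ, E) 𝓘(ℝ, E') f x : E →L[ℝ] E') w : E') :=
  ContinuousLinearMap.map_add (M₁ := E) (M₂ := E') _ v w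

theorem mfderiv_apply_smul {E' : Type*} [NormedAddCommGroup E'] [NormedSpace ℝ E']
    {M' : Type*} [TopologicalSpace M'] [ChartedSpace E' M'] (f : M → M') (x : M) (c : ℝ) (v : E) :
    (mfderiv 𝓘(ℝ, E) 𝓘(ℝ, E') f x : E →L[ℝ] E') (c • v : E) =
      c • ((mfderiv 𝓘(ℝ, E) 𝓘(ℝ, E') f x : E →L[ℝ] E') v : E') :=
  ContinuousLinearMap.map_smul (M₁ := E) (M₂ := E') _ c v

theorem mfderiv_apply_zero {E' : Type*} [NormedAddCommGroup E'] [NormedSpace ℝ E']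
    {M' : Type*} [TopologicalSpace M'] [ChartedSpace E' M'] (f : M → M') (x : M) :
    (mfderiv 𝓘(ℝ, E) 𝓘(ℝ, E') f x : E →L[ℝ] E') (0 : E) = (0 : E') :=
  ContinuousLinearMap.map_zero (M₁ := E) (M₂ := E') _

theorem Submodule.deriv_mem [FiniteDimensional ℝ E] {F : Submodule ℝ E} {f : ℝ → E} {v : E}
    {t : ℝ} (hf : HasDerivAt f v t) (hF : ∀ᶠ s in 𝓝 t, f s ∈ F) : v ∈ F := by
  rw [hasDerivAt_iff_tendsto_slope] at hf
  refine F.closed_of_finiteDimensional.mem_of_tendsto hf ?_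
  filter_upwards [hF.filter_mono nhdsWithin_le_nhds] with s hs
  rw [slope_def_module]
  exact F.smul_mem _ (F.sub_mem hs hF.self_of_nhds)

/-- In a chart in which a set is a linear subspace, the tangent vectors of the set are the vectors
of the subspace. -/
theorem isTangentTo_iff_of_chart [FiniteDimensional ℝ E] [IsManifold 𝓘(ℝ, E) ∞ M] {T : Set M}
    {φ : OpenPartialHomeomorph M E} (hφ : φ ∈ IsManifold.maximalAtlas 𝓘(ℝ, E) ∞ M) {p : M}
    (hp : p ∈ φ.source) (hpT : p ∈ T) {F : Submodule ℝ E}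
    (hF : ∀ e ∈ φ.target, φ.symm e ∈ T ↔ e ∈ F) {v : E} :
    IsTangentTo E T p v ↔ (mfderiv 𝓘(ℝ, E) 𝓘(ℝ, E) φ p : E →L[ℝ] E) v ∈ F := by
  have hF' : ∀ x ∈ φ.source, x ∈ T → φ x ∈ F := fun x hx hxT =>
    (hF _ (φ.map_source hx)).1 (by rwa [φ.left_inv hx])
  have hdφ : MDifferentiableAt 𝓘(ℝ, E) 𝓘(ℝ, E) φ p :=
    (contMDiffAt_of_mem_maximalAtlas hφ hp).mdifferentiableAt (by simp)
  constructor
  · rintro ⟨ε, hε, γ, rfl, hγT, hγs, hγd⟩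
    have hγ : MDifferentiableAt 𝓘(ℝ, ℝ) 𝓘(ℝ, E) γ 0 := hγd.mdifferentiableAt
    have hv : velocity E γ = v := by
      have := HasMFDerivAt.velocity_eq (E := E) hγd
      rw [this]
      exact one_smul ℝ v
    have hcomp : MDifferentiableAt 𝓘(ℝ, ℝ) 𝓘(ℝ, E) (fun t => φ (γ t)) 0 := hdφ.comp 0 hγ
    have h1 := velocity_comp (E' := E) hdφ hγ
    rw [hv, velocity_eq_deriv] at h1
    have h2 : deriv (fun t => φ (γ t)) 0 ∈ F := by
      refine Submodule.deriv_mem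
        (mdifferentiableAt_iff_differentiableAt.1 hcomp).hasDerivAt ?_
      filter_upwards [hγ.continuousAt.eventually_mem (φ.open_source.mem_nhds hp),
        Ioo_mem_nhds (neg_lt_zero.2 hε) hε] with t ht htε
      exact hF' _ ht (hγT t htε)
    exact h1 ▸ h2
  · intro hv
    set w : E := (mfderiv 𝓘(ℝ, E) 𝓘(ℝ, E) φ p : E →L[ℝ] E) v with hw
    have hpt := φ.map_source hp
    have hc : Continuous fun t : ℝ => φ p + t • w := by fun_prop
    have h1 : ∀ᶠ t in 𝓝 (0 : ℝ), φ p + t • w ∈ φ.target :=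
      hc.continuousAt.eventually_mem (φ.open_target.mem_nhds (by simpa using hpt))
    obtain ⟨ε, hε, h2⟩ := Metric.eventually_nhds_iff.1 h1
    have h3 : ∀ t ∈ Set.Ioo (-ε) ε, φ p + t • w ∈ φ.target := fun t ht =>
      h2 (by simpa [abs_lt] using ht)
    refine isTangentTo_of_velocity hε (γ := fun t => φ.symm (φ p + t • w)) ?_ (fun t ht => ?_) ?_ ?_
    · simp only [zero_smul, add_zero, φ.left_inv hp]
    · exact (hF _ (h3 t ht)).2 (F.add_mem (hF' p hp hpT) (F.smul_mem t hv))
    · exact (contMDiffOn_symm_of_mem_maximalAtlas hφ).comp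
        (by fun_prop : ContDiff ℝ ∞ fun t : ℝ => φ p + t • w).contMDiff.contMDiffOn h3
    · have hds : MDifferentiableAt 𝓘(ℝ, E) 𝓘(ℝ, E) φ.symm (φ p) :=
        (contMDiffAt_symm_of_mem_maximalAtlas hφ hpt).mdifferentiableAt (by simp)
      have h4 := velocity_comp (E := E) (E' := E) (γ := fun t : ℝ => φ p + t • w) (f := φ.symm)
        (by simpa using hds)
        (by fun_prop : DifferentiableAt ℝ (fun t : ℝ => φ p + t • w) 0).mdifferentiableAt
      have h5 : deriv (fun t : ℝ => φ p + t • w) 0 = w := by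
        have := ((hasDerivAt_id (0 : ℝ)).smul_const w).const_add (φ p)
        simpa using this.deriv
      rw [h4, velocity_eq_deriv, h5]
      have h6 : (mfderiv 𝓘(ℝ, E) 𝓘(ℝ, E) (φ.symm ∘ φ) p : E →L[ℝ] E) =
          (mfderiv 𝓘(ℝ, E) 𝓘(ℝ, E) φ.symm (φ p) : E →L[ℝ] E) ∘L
            (mfderiv 𝓘(ℝ, E) 𝓘(ℝ, E) φ p : E →L[ℝ] E) := mfderiv_comp p hds hdφ
      have h7 : (mfderiv 𝓘(ℝ, E) 𝓘(ℝ, E) (φ.symm ∘ φ) p : E →L[ℝ] E) =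
          ContinuousLinearMap.id ℝ E := by
        have h8 : φ.symm ∘ φ =ᶠ[𝓝 p] id := by
          filter_upwards [φ.open_source.mem_nhds hp] with x hx using φ.left_inv hx
        exact h8.mfderiv_eq.trans mfderiv_id
      have h9 : φ p + (0 : ℝ) • w = φ p := by simp
      refine (congrArg (fun y => (mfderiv 𝓘(ℝ, E) 𝓘(ℝ, E) φ.symm y : E →L[ℝ] E) w) h9).trans ?_
      exact DFunLike.congr_fun (h6.symm.trans h7) v

/-- Functions that agree on a set near a point have the same derivatives along the tangent vectors
of the set. -/
theorem IsTangentTo.mfderiv_congr {T : Set M} {p : M} {v : E} (hv : IsTangentTo E T p v)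
    {u u' : M → ℝ} (hu : MDifferentiableAt 𝓘(ℝ, E) 𝓘(ℝ, ℝ) u p)
    (hu' : MDifferentiableAt 𝓘(ℝ, E) 𝓘(ℝ, ℝ) u' p) (h : ∀ᶠ x in 𝓝 p, x ∈ T → u x = u' x) :
    (mfderiv 𝓘(ℝ, E) 𝓘(ℝ, ℝ) u p : E →L[ℝ] ℝ) v =
      (mfderiv 𝓘(ℝ, E) 𝓘(ℝ, ℝ) u' p : E →L[ℝ] ℝ) v := by
  obtain ⟨ε, hε, γ, rfl, hγT, -, hγd⟩ := hv
  have hγ : MDifferentiableAt 𝓘(ℝ, ℝ) 𝓘(ℝ, E) γ 0 := hγd.mdifferentiableAt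
  have hv : velocity E γ = v := by
    have := HasMFDerivAt.velocity_eq (E := E) hγd
    rw [this]
    exact one_smul ℝ v
  have h1 := velocity_comp (E' := ℝ) hu hγ
  have h2 := velocity_comp (E' := ℝ) hu' hγ
  rw [hv] at h1 h2
  refine h1.symm.trans (Eq.trans (velocity_congr ?_) h2)
  filter_upwards [hγ.continuousAt.eventually h, Ioo_mem_nhds (neg_lt_zero.2 hε) hε] with t ht htε
  exact ht (hγT t htε)

/-- A tangent vector of a set is tangent to each neighbourhood of the point in the set. -/
theorem IsTangentTo.of_eventually {T T' : Set M} {p : M} {v : E} (hv : IsTangentTo E T p v)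
    (h : ∀ᶠ x in 𝓝 p, x ∈ T → x ∈ T') : IsTangentTo E T' p v := by
  obtain ⟨ε, hε, γ, rfl, hγT, hγs, hγd⟩ := hv
  obtain ⟨ε', hε', h'⟩ := Metric.eventually_nhds_iff.1
    (hγd.mdifferentiableAt.continuousAt.eventually h)
  have hsub : Set.Ioo (-min ε ε') (min ε ε') ⊆ Set.Ioo (-ε) ε :=
    Set.Ioo_subset_Ioo (neg_le_neg (min_le_left _ _)) (min_le_left _ _)
  refine ⟨min ε ε', lt_min hε hε', γ, rfl, fun t ht => ?_, hγs.mono hsub, hγd⟩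
  refine h' ?_ (hγT t (hsub ht))
  rw [Real.dist_eq, sub_zero, abs_lt]
  exact ⟨(neg_le_neg (min_le_right ε ε')).trans_lt ht.1, ht.2.trans_le (min_le_right ε ε')⟩

end Tangent

theorem IsWeightedLift.zero {G : Type*} [Group G] {E : Type*} [NormedAddCommGroup E]
    [NormedSpace ℝ E] {M : Type*} [TopologicalSpace M] [ChartedSpace E M] [MulAction G M]
    {H : Subgroup G}
    {Y : Derivation ℝ (smoothOrbitFunctions E G M) (smoothOrbitFunctions E G M)} :
    IsWeightedLift H Y (fun _ : M => 0) (fun _ => (0 : E)) where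
  contMDiff_weight := contMDiff_const
  weight_smul _ _ := rfl
  weight_nonneg _ := le_rfl
  contMDiff := Bundle.contMDiff_zeroSection ℝ (TangentSpace 𝓘(ℝ, E) : M → Type _)
  mfderiv_smul _ _ := ContinuousLinearMap.map_zero _
  isTangentTo x hx := isTangentTo_of_velocity one_pos (γ := fun _ => x) rfl (fun _ _ => hx)
     contMDiffOn_const (velocity_const x)
  mfderiv_orbitMap _ _ _ := by rw [mfderiv_apply_zero, zero_mul]

section WeightedLift

variable {G : Type*} [TopologicalSpace G] [Group G] [T2Space G]
  {E : Type*} [NormedAddCommGroup E] [NormedSpace ℝ E] [FiniteDimensional ℝ E]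
  {M : Type*} [TopologicalSpace M] [ChartedSpace E M] [IsManifold 𝓘(ℝ, E) ∞ M]
  [MulAction G M] [ProperSMul G M] {H : Subgroup G}
  {Y : Derivation ℝ (smoothOrbitFunctions E G M) (smoothOrbitFunctions E G M)}

/-- Velocities of curves in a set need not be closed under addition. For an orbit type they are,
thanks to a chart in which it is linear. -/
theorem IsTangentTo.add_orbitType (EG : Type*) [NormedAddCommGroup EG]
    [NormedSpace ℝ EG] [FiniteDimensional ℝ EG] [ChartedSpace EG G] [LieGroup 𝓘(ℝ, EG) ∞ G]
    [ContMDiffSMul 𝓘(ℝ, EG) 𝓘(ℝ, E) ∞ G M] {x : M} (hx : x ∈ orbitType M H) {v w : E}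
    (hv : IsTangentTo E (orbitType M H) x v) (hw : IsTangentTo E (orbitType M H) x w) :
    IsTangentTo E (orbitType M H) x (v + w : E) := by
  obtain ⟨φ, hφ, hxφ, F, hF, -⟩ := exists_chart_orbitType (E := E) EG hx
  rw [isTangentTo_iff_of_chart hφ hxφ hx hF] at hv hw ⊢
  rw [mfderiv_apply_add]
  exact F.add_mem hv hw

theorem IsTangentTo.smul_orbitType (EG : Type*) [NormedAddCommGroup EG]
    [NormedSpace ℝ EG] [FiniteDimensional ℝ EG] [ChartedSpace EG G] [LieGroup 𝓘(ℝ, EG) ∞ G]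
    [ContMDiffSMul 𝓘(ℝ, EG) 𝓘(ℝ, E) ∞ G M] {x : M} (hx : x ∈ orbitType M H) {v : E}
    (hv : IsTangentTo E (orbitType M H) x v) (c : ℝ) :
    IsTangentTo E (orbitType M H) x (c • v : E) := by
  obtain ⟨φ, hφ, hxφ, F, hF, -⟩ := exists_chart_orbitType (E := E) EG hx
  rw [isTangentTo_iff_of_chart hφ hxφ hx hF] at hv ⊢
  rw [mfderiv_apply_smul]
  exact F.smul_mem c hv

theorem IsWeightedLift.add (EG : Type*) [NormedAddCommGroup EG]
    [NormedSpace ℝ EG] [FiniteDimensional ℝ EG] [ChartedSpace EG G] [LieGroup 𝓘(ℝ, EG) ∞ G]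
    [ContMDiffSMul 𝓘(ℝ, EG) 𝓘(ℝ, E) ∞ G M] {χ χ' : M → ℝ} {X X' : M → E}
    (h : IsWeightedLift H Y χ X) (h' : IsWeightedLift H Y χ' X') :
    IsWeightedLift H Y (fun x => χ x + χ' x) (fun x => X x + X' x) where
  contMDiff_weight := h.contMDiff_weight.add h'.contMDiff_weight
  weight_smul g x := by rw [h.weight_smul, h'.weight_smul]
  weight_nonneg x := add_nonneg (h.weight_nonneg x) (h'.weight_nonneg x)
  contMDiff := ContMDiff.add_section h.contMDiff h'.contMDiff
  mfderiv_smul g x := by rw [mfderiv_apply_add, h.mfderiv_smul, h'.mfderiv_smul]; rfl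
  isTangentTo x hx := (h.isTangentTo x hx).add_orbitType EG hx (h'.isTangentTo x hx)
  mfderiv_orbitMap x hx f := by
    rw [mfderiv_apply_add, h.mfderiv_orbitMap x hx, h'.mfderiv_orbitMap x hx, add_mul]; rfl

theorem IsWeightedLift.mul (EG : Type*) [NormedAddCommGroup EG]
    [NormedSpace ℝ EG] [FiniteDimensional ℝ EG] [ChartedSpace EG G] [LieGroup 𝓘(ℝ, EG) ∞ G]
    [ContMDiffSMul 𝓘(ℝ, EG) 𝓘(ℝ, E) ∞ G M] {χ : M → ℝ} {X : M → E}
    (h : IsWeightedLift H Y χ X) {ψ : M → ℝ} (hψ : ContMDiff 𝓘(ℝ, E) 𝓘(ℝ, ℝ) ∞ ψ)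
    (hψs : ∀ (g : G) x, ψ (g • x) = ψ x) (hψ0 : ∀ x, 0 ≤ ψ x) :
    IsWeightedLift H Y (fun x => ψ x * χ x) (fun x => ψ x • X x) where
  contMDiff_weight := hψ.mul h.contMDiff_weight
  weight_smul g x := by rw [h.weight_smul, hψs]
  weight_nonneg x := mul_nonneg (hψ0 x) (h.weight_nonneg x)
  contMDiff := ContMDiff.smul_section hψ h.contMDiff
  mfderiv_smul g x := by rw [mfderiv_apply_smul, h.mfderiv_smul, hψs]; rfl
  isTangentTo x hx := (h.isTangentTo x hx).smul_orbitType EG hx _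
  mfderiv_orbitMap x hx f := by
    rw [mfderiv_apply_smul, h.mfderiv_orbitMap x hx]
    exact (mul_assoc (ψ x) (χ x) _).symm

theorem IsWeightedLift.sum (EG : Type*) [NormedAddCommGroup EG]
    [NormedSpace ℝ EG] [FiniteDimensional ℝ EG] [ChartedSpace EG G] [LieGroup 𝓘(ℝ, EG) ∞ G]
    [ContMDiffSMul 𝓘(ℝ, EG) 𝓘(ℝ, E) ∞ G M] {χ : ℕ → M → ℝ} {X : ℕ → M → E}
    (h : ∀ n, IsWeightedLift H Y (χ n) (X n)) (N : ℕ) :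
    IsWeightedLift H Y (fun x => ∑ n ∈ Finset.range N, χ n x)
      (fun x => ∑ n ∈ Finset.range N, X n x) := by
  induction N with
  | zero => simpa using IsWeightedLift.zero
  | succ N ih => simpa only [Finset.sum_range_succ] using ih.add EG (h N)

/-- Countably many local lifts can be glued to a lift on the whole orbit type. -/
theorem IsWeightedLift.exists_glue (EG : Type*) [NormedAddCommGroup EG]
    [NormedSpace ℝ EG] [FiniteDimensional ℝ EG] [ChartedSpace EG G] [LieGroup 𝓘(ℝ, EG) ∞ G]
    [ContMDiffSMul 𝓘(ℝ, EG) 𝓘(ℝ, E) ∞ G M] {χ : ℕ → M → ℝ} {X : ℕ → M → E}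
    (h : ∀ n, IsWeightedLift H Y (χ n) (X n)) :
    ∃ X' : M → E, ContMDiffOn 𝓘(ℝ, E) 𝓘(ℝ, E).tangent ∞
        (fun x => (⟨x, X' x⟩ : TangentBundle 𝓘(ℝ, E) M)) {x | ∃ n, 0 < χ n x} ∧
      ∀ x, (∃ n, 0 < χ n x) →
        (∀ g : G, (mfderiv 𝓘(ℝ, E) 𝓘(ℝ, E) (fun y : M => g • y) x : E →L[ℝ] E) (X' x) =
          X' (g • x)) ∧
        (x ∈ orbitType M H → IsTangentTo E (orbitType M H) x (X' x) ∧
          ∀ f : smoothOrbitFunctions E G M, (mfderiv 𝓘(ℝ, E) 𝓘(ℝ, ℝ)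
            (fun y => (f : MulAction.orbitRel.Quotient G M → ℝ) (orbitMap G y)) x : E →L[ℝ] ℝ)
              (X' x) = (Y f : MulAction.orbitRel.Quotient G M → ℝ) (orbitMap G x)) := by
  -- An invariant substitute for a partition of unity. `ψ n` is positive where all earlier `χ j` are
  -- below 1 / (n + 1) and vanishes elsewhere. The first index with χ n x > 0 therefore contributes,
  -- while positivity of some `χ k` at `x` kills all large indices near `x`.
  set ψ : ℕ → M → ℝ := fun n x =>
    ∏ j ∈ Finset.range n, expNegInvGlue (1 / ((n : ℝ) + 1) - χ j x) with hψ
  have hψg : ∀ n (g : G) x, ψ n (g • x) = ψ n x := fun n g x => by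
    simp only [hψ, (h _).weight_smul]
  have hlift : ∀ n, IsWeightedLift H Y (fun x => ψ n x * χ n x) (fun x => ψ n x • X n x) := by
    refine fun n => (h n).mul EG ?_ (hψg n) fun x =>
      Finset.prod_nonneg fun j _ => expNegInvGlue.nonneg _
    refine contMDiff_finsetProd fun j _ => ?_
    exact (expNegInvGlue.contDiff (n := ⊤)).contMDiff.comp
      (contMDiff_const.sub (h j).contMDiff_weight)
  set W : M → ℝ := fun x => ∑ᶠ n, ψ n x * χ n x with hW
  set X' : M → E := fun x => (W x)⁻¹ • ∑ᶠ n, ψ n x • X n x with hX'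
  have hpos : ∀ x k N, k < N → 0 < χ k x → 0 < ∑ n ∈ Finset.range N, ψ n x * χ n x := by
    classical
    intro x k N hkN hk
    have hex : ∃ n, 0 < χ n x := ⟨k, hk⟩
    refine Finset.sum_pos' (fun n _ => (hlift n).weight_nonneg x)
      ⟨Nat.find hex, Finset.mem_range.2 ((Nat.find_min' hex hk).trans_lt hkN),
        mul_pos (Finset.prod_pos fun j hj => ?_) (Nat.find_spec hex)⟩
    have h0 : χ j x = 0 := le_antisymm
      (not_lt.1 (Nat.find_min hex (Finset.mem_range.1 hj))) ((h j).weight_nonneg x)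
    rw [h0, sub_zero]
    exact expNegInvGlue.pos_of_pos (by positivity)
  have hlocal : ∀ x, (∃ n, 0 < χ n x) → ∃ N, (0 < ∑ n ∈ Finset.range N, ψ n x * χ n x) ∧
      ∀ᶠ y in 𝓝 x, ∀ g : G, X' (g • y) = (∑ n ∈ Finset.range N, ψ n y * χ n y)⁻¹ •
        ∑ n ∈ Finset.range N, ψ n (g • y) • X n (g • y) := by
    rintro x ⟨k, hk⟩
    -- Where `χ k` exceeds χ k x / 2, all terms with index at least max N (k + 1) vanish. As `χ k`
    -- is invariant, this holds along whole orbits, so one finite sum serves every `g`.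
    obtain ⟨N, hN⟩ := exists_nat_one_div_lt (half_pos hk)
    refine ⟨max N (k + 1), hpos x k _ (lt_max_of_lt_right (Nat.lt_succ_self k)) hk, ?_⟩
    have hcont : ContinuousAt (χ k) x := (h k).contMDiff_weight.continuous.continuousAt
    filter_upwards [hcont.eventually_const_lt (half_lt_self hk)] with y hy g
    have hzero : ∀ z, χ k x / 2 < χ k z → ∀ n, max N (k + 1) ≤ n → ψ n z = 0 := by
      intro z hz n hn
      refine Finset.prod_eq_zero (Finset.mem_range.2 (le_of_max_le_right hn)) ?_
      refine expNegInvGlue.zero_of_nonpos (sub_nonpos.2 ?_)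
      have h1 : 1 / ((n : ℝ) + 1) ≤ 1 / ((N : ℝ) + 1) :=
        one_div_le_one_div_of_le (by positivity)
          (by exact_mod_cast Nat.succ_le_succ (le_of_max_le_left hn))
      linarith
    have hgy : χ k x / 2 < χ k (g • y) := by rwa [(h k).weight_smul]
    have hsupp : ∀ n, ψ n (g • y) ≠ 0 → n ∈ Finset.range (max N (k + 1)) := fun n hn =>
      Finset.mem_range.2 (not_le.1 fun hle => hn (hzero _ hgy n hle))
    simp only [hX', hW]
    rw [finsum_eq_sum_of_support_subset (s := Finset.range (max N (k + 1))) _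
      (fun n hn => hsupp n fun h0 => hn (by simp only [h0, zero_mul])),
      finsum_eq_sum_of_support_subset (s := Finset.range (max N (k + 1))) _
      (fun n hn => hsupp n fun h0 => hn (by simp only [h0, zero_smul]))]
    simp only [hψg, (h _).weight_smul]
  refine ⟨X', fun x hx => ?_, fun x hx => ?_⟩
  · obtain ⟨N, hNpos, hN⟩ := hlocal x hx
    have hL := IsWeightedLift.sum EG hlift N
    have h1 : ContMDiffAt 𝓘(ℝ, E) 𝓘(ℝ, ℝ) ∞
        (fun y => (∑ n ∈ Finset.range N, ψ n y * χ n y)⁻¹) x :=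
      (hL.contMDiff_weight.contMDiffAt).inv₀ hNpos.ne'
    have h2 := ContMDiffAt.smul_section h1 hL.contMDiff.contMDiffAt
    refine ContMDiffAt.contMDiffWithinAt (h2.congr_of_eventuallyEq ?_)
    filter_upwards [hN] with y hy
    have h3 := hy 1
    rw [one_smul] at h3
    rw [h3]
    rfl
  · obtain ⟨N, hNpos, hN⟩ := hlocal x hx
    have hL := IsWeightedLift.sum EG hlift N
    have hxg := hN.self_of_nhds
    have hx1 := hxg 1
    rw [one_smul] at hx1
    refine ⟨fun g => ?_, fun hxH => ⟨?_, fun f => ?_⟩⟩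
    · rw [hx1, hxg g, mfderiv_apply_smul, hL.mfderiv_smul]
      rfl
    · rw [hx1]
      exact (hL.isTangentTo x hxH).smul_orbitType EG hxH _
    · rw [hx1, mfderiv_apply_smul, hL.mfderiv_orbitMap x hxH]
      exact inv_mul_cancel_left₀ hNpos.ne' _

end WeightedLift

/-! ### Lifting a vector field on the orbit space to an orbit type -/

/-- A local derivation of the smooth functions restricts to a subset as soon as it maps
functions that vanish on the subset near a point to functions that vanish at the point. -/
theorem exists_derivation_isRestrictionOf {S : Type*} [TopologicalSpace S]
    {A : Subalgebra ℝ (S → ℝ)} {T : Set S} (Y : Derivation ℝ A A)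
    (hY : ∀ (f : A) (U : Set S), IsOpen U → ∀ y ∈ T, y ∈ U →
      (∀ z ∈ T, z ∈ U → (f : S → ℝ) z = 0) → (Y f : S → ℝ) y = 0) :
    ∃ Z : Derivation ℝ (restrictedFunctions A T) (restrictedFunctions A T),
      IsRestrictionOf Z Y ∧ ∀ (h : restrictedFunctions A T) (y : T) (U : Set S), IsOpen U →
        (y : S) ∈ U → ∀ f : A, (∀ z : T, (z : S) ∈ U → (h : T → ℝ) z = (f : S → ℝ) z) →
          (Z h : T → ℝ) y = (Y f : S → ℝ) y := by
  -- Two local extensions differ by a function vanishing on `T` near `y`, so `hY` makes the value at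
  -- `y` independent of the extension.
  have huniq : ∀ (h : T → ℝ) (y : T) (U U' : Set S) (f f' : A), IsOpen U → IsOpen U' →
      (y : S) ∈ U → (y : S) ∈ U' → (∀ z : T, (z : S) ∈ U → h z = (f : S → ℝ) z) →
      (∀ z : T, (z : S) ∈ U' → h z = (f' : S → ℝ) z) → (Y f : S → ℝ) y = (Y f' : S → ℝ) y := by
    intro h y U U' f f' hU hU' hy hy' hf hf'
    have h0 := hY (f - f') (U ∩ U') (hU.inter hU') y y.2 ⟨hy, hy'⟩ fun z hz hzU => by
      have h1 := hf ⟨z, hz⟩ hzU.1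
      have h2 := hf' ⟨z, hz⟩ hzU.2
      simp only at h1 h2
      simp [← h1, ← h2]
    rw [map_sub] at h0
    exact sub_eq_zero.1 h0
  have hex : ∀ (h : restrictedFunctions A T) (y : T), ∃ (U : Set S) (f : A), IsOpen U ∧ (y : S) ∈ U ∧
      ∀ z : T, (z : S) ∈ U → (h : T → ℝ) z = (f : S → ℝ) z := by
    intro h y
    obtain ⟨U, hU, hyU, f, hf, hfU⟩ := h.2 y
    exact ⟨U, ⟨f, hf⟩, hU, hyU, hfU⟩
  choose U f hU hyU hf using hex
  have hval : ∀ (h : restrictedFunctions A T) (y : T) (V : Set S), IsOpen V → (y : S) ∈ V →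
      ∀ k : A, (∀ z : T, (z : S) ∈ V → (h : T → ℝ) z = (k : S → ℝ) z) →
        (Y (f h y) : S → ℝ) y = (Y k : S → ℝ) y := fun h y V hV hy k hk =>
    huniq h y _ V _ k (hU h y) hV (hyU h y) hy (hf h y) hk
  set D : restrictedFunctions A T → restrictedFunctions A T := fun h =>
    ⟨fun y => (Y (f h y) : S → ℝ) y, fun y => ⟨U h y, hU h y, hyU h y, Y (f h y), (Y (f h y)).2,
      fun z hz => hval h z _ (hU h y) hz _ (hf h y)⟩⟩ with hD
  have hDval : ∀ (h : restrictedFunctions A T) (y : T) (V : Set S), IsOpen V → (y : S) ∈ V →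
      ∀ k : A, (∀ z : T, (z : S) ∈ V → (h : T → ℝ) z = (k : S → ℝ) z) →
        (D h : T → ℝ) y = (Y k : S → ℝ) y := hval
  have hDf : ∀ (h : restrictedFunctions A T) (y : T), (D h : T → ℝ) y = (Y (f h y) : S → ℝ) y :=
    fun h y => rfl
  have hlin : IsLinearMap ℝ D := by
    refine ⟨fun h k => ?_, fun c h => ?_⟩
    · ext y
      have := hDval (h + k) y (U h y ∩ U k y) ((hU h y).inter (hU k y)) ⟨hyU h y, hyU k y⟩
        (f h y + f k y) fun z hz => by
          simp [← hf h y z hz.1, ← hf k y z hz.2]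
      rw [this, map_add]
      simp [hDf]
    · ext y
      have := hDval (c • h) y (U h y) (hU h y) (hyU h y) (c • f h y) fun z hz => by
          simp [← hf h y z hz]
      rw [this, Y.map_smul]
      simp [hDf]
  refine ⟨Derivation.mk' hlin.mk' fun h k => ?_, fun k => ?_, hDval⟩
  · ext y
    have := hDval (h * k) y (U h y ∩ U k y) ((hU h y).inter (hU k y)) ⟨hyU h y, hyU k y⟩
      (f h y * f k y) fun z hz => by
        simp [← hf h y z hz.1, ← hf k y z hz.2]
    refine this.trans ?_
    rw [Y.leibniz]
    simp [hDf, hf h y y (hyU h y), hf k y y (hyU k y)]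
  · ext y
    exact hDval _ y Set.univ isOpen_univ trivial k fun z _ => rfl

/-- A derivation of the smooth functions on the orbit space that has integral curves lifts to each
orbit type. -/
theorem exists_invariant_lift
    (EG : Type*) [NormedAddCommGroup EG] [NormedSpace ℝ EG] [FiniteDimensional ℝ EG]
    {G : Type*} [TopologicalSpace G] [ChartedSpace EG G] [Group G] [LieGroup 𝓘(ℝ, EG) ∞ G]
    [T2Space G]
    {E : Type*} [NormedAddCommGroup E] [NormedSpace ℝ E] [FiniteDimensional ℝ E]
    {M : Type*} [TopologicalSpace M] [ChartedSpace E M] [IsManifold 𝓘(ℝ, E) ∞ M]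
    [SecondCountableTopology M]
    [MulAction G M] [ContMDiffSMul 𝓘(ℝ, EG) 𝓘(ℝ, E) ∞ G M] [ProperSMul G M]
    {H : Subgroup G} (hne : (orbitType M H).Nonempty)
    {Y : Derivation ℝ (smoothOrbitFunctions E G M) (smoothOrbitFunctions E G M)}
    (hY : ∀ x, ∃ ε > (0 : ℝ), ∃ γ, IsIntegralCurveFrom Y ε x γ) :
    ∃ (X : M → E) (O : Set M), IsOpen O ∧ orbitType M H ⊆ O ∧
      ContMDiffOn 𝓘(ℝ, E) 𝓘(ℝ, E).tangent ∞
        (fun x => (⟨x, X x⟩ : TangentBundle 𝓘(ℝ, E) M)) O ∧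
      ∀ x ∈ orbitType M H,
        (∀ g : G, (mfderiv 𝓘(ℝ, E) 𝓘(ℝ, E) (fun y : M => g • y) x : E →L[ℝ] E) (X x) =
          X (g • x)) ∧
        IsTangentTo E (orbitType M H) x (X x) ∧
        ∀ f : smoothOrbitFunctions E G M, (mfderiv 𝓘(ℝ, E) 𝓘(ℝ, ℝ)
          (fun y => (f : MulAction.orbitRel.Quotient G M → ℝ) (orbitMap G y)) x : E →L[ℝ] ℝ)
            (X x) = (Y f : MulAction.orbitRel.Quotient G M → ℝ) (orbitMap G x) := by
  choose χ X hX hχ using fun p : orbitType M H => exists_isWeightedLift EG p.2 hY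
  -- The orbit type is second countable, so countably many of the sets where a local weight is
  -- positive cover it.
  have hcont : ∀ p, Continuous (χ p) := fun p => (hX p).contMDiff_weight.continuous
  obtain ⟨t, htc, ht⟩ := TopologicalSpace.countable_cover_nhds
    (f := fun p : orbitType M H => {x : orbitType M H | 0 < χ p x}) fun p =>
      (isOpen_lt continuous_const ((hcont p).comp continuous_subtype_val)).mem_nhds (hχ p)
  have hcov : ∀ x : orbitType M H, ∃ p ∈ t, 0 < χ p x := by
    intro x
    have : x ∈ ⋃ p ∈ t, {x : orbitType M H | 0 < χ p x} := ht ▸ Set.mem_univ x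
    simpa using this
  obtain ⟨m, hm⟩ := hne
  obtain ⟨p, hp, -⟩ := hcov ⟨m, hm⟩
  obtain ⟨s, rfl⟩ := htc.exists_eq_range ⟨p, hp⟩
  have hcov' : ∀ x ∈ orbitType M H, ∃ n, 0 < χ (s n) x := by
    intro x hx
    obtain ⟨_, ⟨n, rfl⟩, hn⟩ := hcov ⟨x, hx⟩
    exact ⟨n, hn⟩
  obtain ⟨X', hX', h⟩ := IsWeightedLift.exists_glue EG fun n => hX (s n)
  refine ⟨X', {x | ∃ n, 0 < χ (s n) x}, ?_, hcov', hX', fun x hx => ?_⟩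
  · have : {x | ∃ n, 0 < χ (s n) x} = ⋃ n, {x | 0 < χ (s n) x} := by
      ext x
      simp
    rw [this]
    exact isOpen_iUnion fun n => isOpen_lt continuous_const (hcont _)
  · obtain ⟨h1, h2⟩ := h x (hcov' x hx)
    exact ⟨h1, h2 hx⟩

theorem continuous_orbitMap (G : Type*) {M : Type*} [Group G] [TopologicalSpace M]
    [MulAction G M] : Continuous (orbitMap G : M → MulAction.orbitRel.Quotient G M) :=
  continuous_quotient_mk'

theorem theorem1
    {EG : Type*} [NormedAddCommGroup EG] [NormedSpace ℝ EG] [FiniteDimensional ℝ EG]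
    {G : Type*} [TopologicalSpace G] [ChartedSpace EG G] [Group G] [LieGroup 𝓘(ℝ, EG) ∞ G]
    [T2Space G]
    {E : Type*} [NormedAddCommGroup E] [NormedSpace ℝ E] [FiniteDimensional ℝ E]
    {M : Type*} [TopologicalSpace M] [ChartedSpace E M] [IsManifold 𝓘(ℝ, E) ∞ M]
    [T2Space M] [SecondCountableTopology M] [ConnectedSpace M]
    [MulAction G M] [ContMDiffSMul 𝓘(ℝ, EG) 𝓘(ℝ, E) ∞ G M] [ProperSMul G M]
    (H : Subgroup G) (hH : IsCompact (H : Set G))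
    (Y : Derivation ℝ (smoothOrbitFunctions E G M) (smoothOrbitFunctions E G M))
    (hY : IsVectorFieldOnSpace Y)
    (m₀ : M) (hm₀ : m₀ ∈ orbitType M H)
    (C : Set M) (hC : C = connectedComponentIn (orbitType M H) m₀) :
    IsEmbeddedSubmanifold E C ∧
    ∃ Z : Derivation ℝ (restrictedFunctions (smoothOrbitFunctions E G M) (orbitMap G '' C))
        (restrictedFunctions (smoothOrbitFunctions E G M) (orbitMap G '' C)),
      IsRestrictionOf Z Y ∧
      ∃ X : (m : M) → TangentSpace 𝓘(ℝ, E) m,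
        IsSmoothVectorFieldOn E C X ∧
        (∀ (g : G), ∀ m ∈ C,
          mfderiv 𝓘(ℝ, E) 𝓘(ℝ, E) (fun x : M => g • x) m (X m) = X (g • m)) ∧
        IsOrbitMapRelated E G C X Z := by
  have hchart : ∀ p ∈ C, ∃ φ ∈ IsManifold.maximalAtlas 𝓘(ℝ, E) ∞ M, p ∈ φ.source ∧
      φ.source ∩ orbitType M H ⊆ C ∧ ∃ F : Submodule ℝ E,
        φ '' (φ.source ∩ C) = φ.target ∩ (F : Set E) := by
    intro p hp
    rw [hC] at hp ⊢
    exact exists_chart_connectedComponentIn EG hp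
  have hCH : C ⊆ orbitType M H := hC ▸ connectedComponentIn_subset _ _
  have hcurve : ∀ x, ∃ ε > (0 : ℝ), ∃ γ, IsIntegralCurveFrom Y ε x γ := by
    intro x
    obtain ⟨U, -, hx, ε, hε, φ, hφ, -⟩ := hY x
    exact ⟨ε, hε, _, hφ x hx⟩
  -- The lift is built on the whole orbit type, which is `G`-invariant, so invariance makes sense
  -- even for elements that move `C` to another component.
  obtain ⟨X, O, hO, hHO, hXs, hX⟩ := exists_invariant_lift EG ⟨m₀, hm₀⟩ hcurve
  have htan : ∀ p ∈ C, IsTangentTo E C p (X p) := by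
    intro p hp
    obtain ⟨φ, -, hpφ, hφC, -⟩ := hchart p hp
    refine (hX p (hCH hp)).2.1.of_eventually ?_
    filter_upwards [φ.open_source.mem_nhds hpφ] with x hx hxH using hφC ⟨hx, hxH⟩
  have hsmooth : ∀ (f : smoothOrbitFunctions E G M) (p : M), MDifferentiableAt 𝓘(ℝ, E) 𝓘(ℝ, ℝ)
      (fun y => (f : MulAction.orbitRel.Quotient G M → ℝ) (orbitMap G y)) p := by
    intro f p
    have hf : ContMDiff 𝓘(ℝ, E) 𝓘(ℝ, ℝ) ∞
      (fun x : M => (f : MulAction.orbitRel.Quotient G M → ℝ) (orbitMap G x)) := f.2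
    exact hf.contMDiffAt.mdifferentiableAt (by simp)
  refine ⟨fun p hp => ?_, ?_⟩
  · obtain ⟨φ, hφ, hpφ, -, F, hF⟩ := hchart p hp
    exact ⟨φ, hφ, hpφ, F, hF⟩
  -- (Y f)(π p) is the derivative of f ∘ π along a vector tangent to `C`, so it vanishes when `f`
  -- vanishes on π(C) near π(p).
  obtain ⟨Z, hZY, hZ⟩ := exists_derivation_isRestrictionOf (T := orbitMap G '' C) Y (by
    rintro f U hU _ ⟨p, hp, rfl⟩ hpU hfU
    rw [← (hX p (hCH hp)).2.2 f]
    refine ((htan p hp).mfderiv_congr (hsmooth f p)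
      (mdifferentiableAt_const (c := (0 : ℝ))) ?_).trans ?_
    · filter_upwards [(continuous_orbitMap G).continuousAt.eventually_mem
        (hU.mem_nhds hpU)] with x hx hxC
      exact hfU _ ⟨x, hxC, rfl⟩ hx
    · have : (mfderiv 𝓘(ℝ, E) 𝓘(ℝ, ℝ) (fun _ : M => (0 : ℝ)) p : E →L[ℝ] ℝ) = 0 := mfderiv_const
      exact DFunLike.congr_fun this (X p))
  refine ⟨Z, hZY, X, ⟨htan, fun m hm => ⟨O, hO, hHO (hCH hm), X, hXs, fun _ _ => rfl⟩⟩,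
    fun g m hm => (hX m (hCH hm)).1 g, fun h u hu m hm hum => ?_⟩
  obtain ⟨U, hU, hmU, f, hf, hfU⟩ := h.2 ⟨orbitMap G m, Set.mem_image_of_mem _ hm⟩
  refine Eq.trans ?_ (hZ h ⟨orbitMap G m, Set.mem_image_of_mem _ hm⟩ U hU hmU ⟨f, hf⟩ hfU).symm
  refine Eq.trans ?_ ((hX m (hCH hm)).2.2 ⟨f, hf⟩)
  -- Both `u` and the pullback of the local extension `f` restrict to h ∘ π on `C` near `m`, and `X
  -- m` is tangent to `C`.
  refine (htan m hm).mfderiv_congr (hu.contMDiffAt.mdifferentiableAt (by simp))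
    (hsmooth ⟨f, hf⟩ m) ?_
  filter_upwards [hum, (continuous_orbitMap G).continuousAt.eventually_mem
    (hU.mem_nhds hmU)] with x hx hxU hxC
  exact (hx hxC).trans (hfU ⟨orbitMap G x, Set.mem_image_of_mem _ hxC⟩ hxU)
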